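/- Let $\beta>0$, $\kappa=\beta/2$, $h=\sqrt\kappa-1/\sqrt\kappa$, $\tilde\alpha_1>0$, and for $N\ge1$ let $\langle\,\cdot\,\rangle$ denote the average with respect to the Laguerre $\beta$-ensemble, i.e. the probability density on $(0,\infty)^N$ proportional to $$\prod_{l=1}^N\lambda_l^{\alpha_1}e^{-\lambda_l}\prod_{1\le j<k\le N}|\lambda_k-\lambda_j|^\beta,\qquad \alpha_1=\tilde\alpha_1N\kappa .$$ Put $a=(\sqrt{\tilde\alpha_1+1}-1)^2$, $b=(\sqrt{\tilde\alpha_1+1}+1)^2$ and $W_1(s)=N\kappa\,\Big\langle\sum_{j=1}^N\frac1{N\kappa s-\lambda_j}\Big\rangle$. Then there are functions $W_1^0,W_1^1,W_1^2$, analytic on $\mathbb C\setminus[a,b]$ and unique there, which are the first coefficients of the large $N$ expansion $$W_1(s)=N\sum_{l\ge0}\frac{W_1^l(s)}{(N\sqrt\kappa)^l},$$ in the sense that for some $R$ and every fixed non-real $s$ with $|s|>R$, $\frac1NW_1(s)=\sum_{l=0}^2W_1^l(s)(N\sqrt\kappa)^{-l}+o(N^{-2})$ as $N\to\infty$. The coefficients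 of the smoothed global density, $$\tilde\rho_1^l(x)=\frac1{2\pi i}\lim_{\epsilon\to0^+}\big(W_1^l(x-i\epsilon)-W_1^l(x+i\epsilon)\big),$$ exist as limits in the sense of distributions on $\mathbb R$ for $l=0,1,2$, and are given by $$\tilde\rho_1^0(x)=\frac1{2\pi x}\sqrt{(x-a)(b-x)}\,\chi_{x\in(a,b)},$$ $$\tilde\rho_1^1(x)=\frac h2\left[\frac{\tilde\alpha_1}{\pi x}\big((x-a)(b-x)\big)^{-1/2}\chi_{x\in(a,b)}-\frac{\tilde\alpha_1+2}{4\sqrt{\tilde\alpha_1+1}}\big(\delta(x-b)-\delta(x-a)\big)\right]+\frac h2\left[\frac{\tilde\alpha_1^2}{4\sqrt{\tilde\alpha_1+1}}\Big(\frac1b\delta(x-b)-\frac1a\delta(x-a)\Big)\right],$$ $$\begin{aligned}\tilde\rho_1^2(x)={}&\frac{(\tilde\alpha_1+1)x}{\pi}\big((x-a)(b-x)\big)^{-5/2}\chi_{x\in(a,b)}\\&+\frac{h^2\chi_{x\in(a,b)}}{\pi}\Big[5(\tilde\alpha_1+1)x\big((x-a)(b-x)\big)^{-5/2}-(\tilde\alpha_1+2)\big((x-a)(b-x)\big)^{-3/2}\Big]\\&-\frac{h^2\tilde\alpha_1(\tilde\alpha_1+2-x)}{16(\tilde\alpha_1+1)}\Big[\delta'(x-b)+\delta'(x-a)+\frac1{2\sqrt{\tilde\alpha_1+1}}\big(\delta(x-b)-\delta(x-a)\big)\Big].\end{aligned}$$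 In $\tilde\rho_1^2$ the non-integrable endpoint singularities, when paired with a test function, are understood as Hadamard finite parts (which exist). -/

import Mathlib

open MeasureTheory Filter Topology Set
open scoped Distributions

namespace LaguerreEnsemble

noncomputable section

/-- The unnormalised eigenvalue density of the Laguerre `β`-ensemble of `N` eigenvalues with
parameter `α₁`:
`∏ₗ λₗ ^ α₁ e ^ (-λₗ) χ(λₗ > 0) * ∏_{j < k} |λₖ - λⱼ| ^ β`. -/
def weight (N : ℕ) (β α₁ : ℝ) (lam : Fin N → ℝ) : ℝ :=
  (∏ l, if 0 < lam l then lam l ^ α₁ * Real.exp (-lam l) else 0) *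
    ∏ j, ∏ k ∈ Finset.Ioi j, |lam k - lam j| ^ β

/-- The ensemble average `⟨f⟩ = (1 / C_N) ∫ f(λ) w(λ) dλ`, where `C_N = ∫ w(λ) dλ`. -/
def average (N : ℕ) (β α₁ : ℝ) (f : (Fin N → ℝ) → ℂ) : ℂ :=
  (∫ lam, weight N β α₁ lam)⁻¹ • ∫ lam, weight N β α₁ lam • f lam

/-- The resolvent `⟨∑ⱼ 1 / (x - λⱼ)⟩` of the Laguerre `β`-ensemble. -/
def resolvent (N : ℕ) (β α₁ : ℝ) (x : ℂ) : ℂ :=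
  average N β α₁ fun lam => ∑ j, 1 / (x - (lam j : ℂ))

/-- The globally scaled resolvent `W₁(s) = N κ W̄₁(N κ s)`, with `κ = β / 2`, of the Laguerre
`β`-ensemble whose parameter is proportional to `N`, namely `α₁ = αt N κ`. -/
def scaledResolvent (N : ℕ) (β αt : ℝ) (s : ℂ) : ℂ :=
  ((N * (β / 2) : ℝ) : ℂ) *
    resolvent N β (αt * N * (β / 2)) (((N * (β / 2) : ℝ) : ℂ) * s)

/-- Left endpoint `a` of the support of the limiting density. -/
def leftEdge (αt : ℝ) : ℝ := (√(αt + 1) - 1) ^ 2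

/-- Right endpoint `b` of the support of the limiting density. -/
def rightEdge (αt : ℝ) : ℝ := (√(αt + 1) + 1) ^ 2

/-- `W 0, …, W L` are the first coefficients in the large `N` expansion
`W₁(s) = N ∑ₗ Wˡ(s) / (N √κ) ^ l`, `κ = β / 2`, of the scaled resolvent. The expansion is
an asymptotic expansion, for `N → ∞` at fixed `s`, at all non-real `s` near infinity; each
coefficient is an analytic function off the cut `[a, b]`. These two requirements determine
`W 0, …, W L` on the complement of `[a, b]`. -/
structure IsResolventExpansion (β αt : ℝ) (L : ℕ) (W : ℕ → ℂ → ℂ) : Prop where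
  analytic : ∀ l ≤ L, DifferentiableOn ℂ (W l)
    ((fun x : ℝ => (x : ℂ)) '' Icc (leftEdge αt) (rightEdge αt))ᶜ
  expansion : ∃ R : ℝ, ∀ s : ℂ, s.im ≠ 0 → R < ‖s‖ →
    (fun N : ℕ => scaledResolvent N β αt s / N -
      ∑ l ∈ Finset.range (L + 1), W l s / (((N * √(β / 2) : ℝ) : ℂ)) ^ l)
    =o[atTop] fun N : ℕ => (1 / (N : ℝ)) ^ L

/-- The value on the test function `φ` of the inverse Stieltjes transform
`(1 / 2πi) lim_{ε → 0⁺} (F (x - iε) - F (x + iε))`, a limit in the sense of distributions,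
exists and equals `v`. -/
def HasInverseStieltjes (F : ℂ → ℂ) (φ : 𝓓((⊤ : TopologicalSpace.Opens ℝ), ℂ)) (v : ℂ) : Prop :=
  Tendsto (fun ε : ℝ => 1 / (2 * (Real.pi : ℂ) * Complex.I) *
      ∫ x : ℝ, (F (x - ε * Complex.I) - F (x + ε * Complex.I)) * φ x)
    (𝓝[>] 0) (𝓝 v)

/-- The Dirac delta `δ(x - c)`. -/
def delta (c : ℝ) (φ : ℝ → ℂ) : ℂ := φ c

/-- The derivative `δ'(x - c)` of the Dirac delta. -/
def deltaDeriv (c : ℝ) (φ : ℝ → ℂ) : ℂ := -deriv φ c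

/-- `v` is the Hadamard finite part of `∫ₐᵇ f`, where `f` may be non-integrable at both
endpoints: `∫_{a+ε}^{b-ε} f` equals, up to a remainder tending to `v` as `ε → 0⁺`, a
finite linear combination of negative powers of `ε`. -/
def HasFinitePart (f : ℝ → ℂ) (a b : ℝ) (v : ℂ) : Prop :=
  ∃ (S : Finset ℝ) (c : ℝ → ℂ), (∀ p ∈ S, 0 < p) ∧
    Tendsto (fun ε : ℝ => (∫ x in (a + ε)..(b - ε), f x) - ∑ p ∈ S, c p * ((ε ^ (-p) : ℝ) : ℂ))
      (𝓝[>] 0) (𝓝 v)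

end

end LaguerreEnsemble

open LaguerreEnsemble

/-!
The coefficients are computed from the loop equations, and the resolvent is controlled by its
moments.

*Expansion of the moments.* In the variables `x = λ / (N κ)` let `p k = ∑ⱼ xⱼ ^ k`, let `m k` be
the moments of the limiting density, and centre: `Y k = p k - N m k`. Integrating
`∑ⱼ ∂ⱼ (λⱼ ^ (k + 1) f w)` gives the loop equation `integral_weight_loop`; the interaction
`|x - y| ^ β` is regularised, so that `β` may be arbitrarily small. As `m` satisfies the limiting
equation, the loop equation becomes a linear recursion `correlator_cons_succ` for the averages
`⟨∏ Y k⟩`. Its homogeneous part is the linearisation of the Catalan-type recursion of `m`, so an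
induction on the total degree bounds the averages by a factorial times a geometric sequence,
uniformly in `N` for degrees up to about `√N` (`abs_correlator_le`). No a
priori concentration of the eigenvalues is needed. Feeding the bound back into the recursion, one
and two steps deep, yields `⟨p k⟩ / N = m k + e₁ k / N + e₂ k / N ^ 2 + O (C ^ k / N ^ 3)`
(`exists_abs_correlator_sub_le`).

*Closed forms.* The recursions that define `e₁` and `e₂` are linear equations between formal power
series in `1 / s` whose coefficient is `√((s - a)(s - b)) / s`; solving them gives
`firstSeries_mul_sq` and `secondSeries_mul_pow`, rational expressions in `s` and the square root.
These define analytic functions off `[a, b]` (`resolventCoeff`).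

*From moments to the resolvent.* For non-real `s` the geometric sum of `1 / (s - x)` is
stopped after about `√N` terms. Its remainder is a moment of order `√N` divided by
`|s| ^ √N |Im s|`, which for large `|s|` is exponentially small in `√N`, since moments up to that
order obey the geometric bound. This is `isResolventExpansion_resolventCoeff`. Uniqueness is the
uniqueness of asymptotic expansions, followed by the identity theorem in the two half planes.

*Boundary values.* A jump across the real line commutes with differentiation
(`HasJump.of_hasDerivAt`). The coefficients are combinations of derivatives of order at most two of
functions whose boundary values exist by dominated convergence: quotients by the square root,
with singularities of order `-1/2` at the endpoints, and `log (s - a)`, `log (s - b)`, which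
produce the delta functions. The resulting distributions act by integrals of derivatives of the
test function against the arcsine weight. Integration by parts on `[a + ε, b - ε]`, where
the boundary terms expand in half-integer powers of `ε` and so have finite part zero
(`finitePart_integral_by_parts`), identifies these with the Hadamard finite parts.
-/

namespace LaguerreEnsemble

open Finset.HasAntidiagonal (antidiagonal mem_antidiagonal)

noncomputable section

/-! ### The ensemble weight and its integrability -/

section

/-- Measurable functions of polynomial growth on the positive orthant: the observables against
which the ensemble is integrated. -/
def PolyBounded {N : ℕ} (g : (Fin N → ℝ) → ℝ) : Prop :=
  Measurable g ∧ ∃ (C : ℝ) (M : ℕ), 0 ≤ C ∧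
    ∀ x, (∀ l, 0 < x l) → |g x| ≤ C * (1 + ∑ l, x l) ^ M

namespace PolyBounded

variable {N : ℕ} {f g : (Fin N → ℝ) → ℝ}

lemma const (c : ℝ) : PolyBounded (fun _ : Fin N → ℝ => c) :=
  ⟨measurable_const, |c|, 0, abs_nonneg c, fun x _ => by simp⟩

lemma coord (l : Fin N) : PolyBounded (fun x : Fin N → ℝ => x l) := by
  refine ⟨measurable_pi_apply l, 1, 1, zero_le_one, fun x hx => ?_⟩
  have h := Finset.single_le_sum (f := x) (fun i _ => (hx i).le) (Finset.mem_univ l)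
  rw [abs_of_pos (hx l), one_mul, pow_one]
  linarith

lemma one_le_base {x : Fin N → ℝ} (hx : ∀ l, 0 < x l) : 1 ≤ 1 + ∑ l, x l := by
  have := Finset.sum_nonneg (fun i (_ : i ∈ Finset.univ) => (hx i).le)
  linarith

lemma add (hf : PolyBounded f) (hg : PolyBounded g) : PolyBounded (fun x => f x + g x) := by
  obtain ⟨hf0, C, M, hC, hfb⟩ := hf
  obtain ⟨hg0, D, K, hD, hgb⟩ := hg
  refine ⟨hf0.add hg0, C + D, max M K, add_nonneg hC hD, fun x hx => ?_⟩
  have h1 := one_le_base hx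
  calc |f x + g x| ≤ |f x| + |g x| := abs_add_le _ _
    _ ≤ C * (1 + ∑ l, x l) ^ M + D * (1 + ∑ l, x l) ^ K := add_le_add (hfb x hx) (hgb x hx)
    _ ≤ C * (1 + ∑ l, x l) ^ max M K + D * (1 + ∑ l, x l) ^ max M K := by
        gcongr <;> first | exact h1 | simp
    _ = _ := by ring

lemma mul (hf : PolyBounded f) (hg : PolyBounded g) : PolyBounded (fun x => f x * g x) := by
  obtain ⟨hf0, C, M, hC, hfb⟩ := hf
  obtain ⟨hg0, D, K, hD, hgb⟩ := hg
  refine ⟨hf0.mul hg0, C * D, M + K, mul_nonneg hC hD, fun x hx => ?_⟩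
  have h1 := one_le_base hx
  rw [abs_mul]
  calc |f x| * |g x| ≤ (C * (1 + ∑ l, x l) ^ M) * (D * (1 + ∑ l, x l) ^ K) :=
        mul_le_mul (hfb x hx) (hgb x hx) (abs_nonneg _) (by positivity)
    _ = _ := by ring

lemma const_mul (c : ℝ) (hf : PolyBounded f) : PolyBounded (fun x => c * f x) := (const c).mul hf

lemma sub (hf : PolyBounded f) (hg : PolyBounded g) : PolyBounded (fun x => f x - g x) := by
  simpa [sub_eq_add_neg] using hf.add (hg.const_mul (-1))

lemma pow (hf : PolyBounded f) (n : ℕ) : PolyBounded (fun x => f x ^ n) := by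
  induction n with
  | zero => simpa using const (N := N) 1
  | succ n ih => simpa [pow_succ] using ih.mul hf

lemma sum {ι : Type*} (s : Finset ι) {F : ι → (Fin N → ℝ) → ℝ} (h : ∀ i ∈ s, PolyBounded (F i)) :
    PolyBounded (fun x => ∑ i ∈ s, F i x) := by
  classical
  induction s using Finset.induction_on with
  | empty => simpa using const (N := N) 0
  | insert i s hi ih =>
    simp_rw [Finset.sum_insert hi]
    exact (h i (by simp)).add (ih fun j hj => h j (by simp [hj]))

lemma prod {ι : Type*} (s : Finset ι) {F : ι → (Fin N → ℝ) → ℝ} (h : ∀ i ∈ s, PolyBounded (F i)) :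
    PolyBounded (fun x => ∏ i ∈ s, F i x) := by
  classical
  induction s using Finset.induction_on with
  | empty => simpa using const (N := N) 1
  | insert i s hi ih =>
    simp_rw [Finset.prod_insert hi]
    exact (h i (by simp)).mul (ih fun j hj => h j (by simp [hj]))

lemma multiset_prod (T : Multiset ℕ) {F : ℕ → (Fin N → ℝ) → ℝ} (h : ∀ i, PolyBounded (F i)) :
    PolyBounded (fun x => (T.map fun r => F r x).prod) := by
  induction T using Multiset.induction_on with
  | empty => simpa using const (N := N) 1
  | cons r T ih => simpa using (h r).mul ih

lemma multiset_sum (T : Multiset ℕ) {F : ℕ → (Fin N → ℝ) → ℝ} (h : ∀ i, PolyBounded (F i)) :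
    PolyBounded (fun x => (T.map fun r => F r x).sum) := by
  induction T using Multiset.induction_on with
  | empty => simpa using const (N := N) 0
  | cons r T ih => simpa using (h r).add ih

lemma of_le (hf : PolyBounded f) (hg : Measurable g) (h : ∀ x, (∀ l, 0 < x l) → |g x| ≤ |f x|) :
    PolyBounded g := by
  obtain ⟨_, C, M, hC, hb⟩ := hf
  exact ⟨hg, C, M, hC, fun x hx => (h x hx).trans (hb x hx)⟩

end PolyBounded

/-- The one-particle factor `u ^ α e ^ (-u) χ(u > 0)` of the ensemble density. -/
def oneBody (α u : ℝ) : ℝ := if 0 < u then u ^ α * Real.exp (-u) else 0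

lemma oneBody_nonneg (α u : ℝ) : 0 ≤ oneBody α u := by
  unfold oneBody; split_ifs <;> positivity

lemma measurable_oneBody (α : ℝ) : Measurable (oneBody α) := by
  unfold oneBody
  exact Measurable.ite measurableSet_Ioi
    ((measurable_id.pow_const α).mul (Real.measurable_exp.comp measurable_neg)) measurable_const

lemma integrable_oneBody_mul_pow {α : ℝ} (hα : 0 < α) (M : ℕ) :
    Integrable (fun u => oneBody α u * (1 + u) ^ M) := by
  have h0 : ∀ p : ℝ, 0 ≤ p → Integrable (oneBody (α + p)) := by
    intro p hp
    have := (Real.GammaIntegral_convergent (s := α + p + 1) (by linarith)).integrable_indicator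
      measurableSet_Ioi
    refine this.congr (Eventually.of_forall fun u => ?_)
    simp only [oneBody, indicator, mem_Ioi, add_sub_cancel_right]
    split_ifs <;> ring
  refine (((h0 0 le_rfl).add (h0 M M.cast_nonneg)).const_mul (2 ^ M : ℝ)).mono'
    ((measurable_oneBody α).mul (by fun_prop)).aestronglyMeasurable
    (Eventually.of_forall fun u => ?_)
  simp only [oneBody, Pi.add_apply]
  split_ifs with hu
  · rw [Real.norm_of_nonneg (by positivity), add_zero, Real.rpow_add hu, Real.rpow_natCast]
    have h2 : (1 + u) ^ M ≤ 2 ^ M * (1 + u ^ M) := by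
      rcases le_total u 1 with h1 | h1
      · calc (1 + u) ^ M ≤ 2 ^ M := by gcongr; linarith
          _ ≤ _ := le_mul_of_one_le_right (by positivity) (by linarith [pow_pos hu M])
      · calc (1 + u) ^ M ≤ (2 * u) ^ M := by gcongr; linarith
          _ = 2 ^ M * u ^ M := mul_pow _ _ _
          _ ≤ _ := by gcongr; linarith
    calc u ^ α * Real.exp (-u) * (1 + u) ^ M
        ≤ u ^ α * Real.exp (-u) * (2 ^ M * (1 + u ^ M)) := by gcongr
      _ = _ := by ring
  · simp

lemma one_add_sum_le_prod {ι : Type*} (s : Finset ι) {x : ι → ℝ} (hx : ∀ i ∈ s, 0 ≤ x i) :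
    1 + ∑ i ∈ s, x i ≤ ∏ i ∈ s, (1 + x i) := by
  classical
  induction s using Finset.induction_on with
  | empty => simp
  | insert i s hi ih =>
    rw [Finset.sum_insert hi, Finset.prod_insert hi]
    have h1 := ih fun j hj => hx j (by simp [hj])
    have h2 := Finset.sum_nonneg fun j hj => hx j (Finset.mem_insert_of_mem hj)
    nlinarith [hx i (by simp)]

/-- Observables of polynomial growth are integrable against the product of the one-particle
factors. -/
lemma PolyBounded.integrable_prod_oneBody {N : ℕ} {α : ℝ} (hα : 0 < α) {g : (Fin N → ℝ) → ℝ}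
    (hg : PolyBounded g) : Integrable (fun x => (∏ l, oneBody α (x l)) * g x) := by
  obtain ⟨hm, C, M, hC, hb⟩ := hg
  have h1 : Integrable (fun x : Fin N → ℝ => ∏ l, (oneBody α (x l) * (1 + x l) ^ M)) :=
    Integrable.fintype_prod (f := fun (_ : Fin N) u => oneBody α u * (1 + u) ^ M)
      (fun _ => integrable_oneBody_mul_pow hα M)
  refine (h1.const_mul C).mono' (((Finset.measurable_prod _ fun l _ =>
    (measurable_oneBody α).comp (measurable_pi_apply l)).mul hm).aestronglyMeasurable)
    (Eventually.of_forall fun x => ?_)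
  by_cases hx : ∀ l, 0 < x l
  · rw [norm_mul, Real.norm_of_nonneg (Finset.prod_nonneg fun l _ => oneBody_nonneg _ _),
      Finset.prod_mul_distrib, Finset.prod_pow]
    have h2 : 1 + ∑ l, x l ≤ ∏ l, (1 + x l) :=
      one_add_sum_le_prod Finset.univ fun l _ => (hx l).le
    have h3 := PolyBounded.one_le_base hx
    calc (∏ l, oneBody α (x l)) * ‖g x‖
        ≤ (∏ l, oneBody α (x l)) * (C * (∏ l, (1 + x l)) ^ M) := by
          refine mul_le_mul_of_nonneg_left ((hb x hx).trans ?_)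
            (Finset.prod_nonneg fun l _ => oneBody_nonneg _ _)
          gcongr
      _ = _ := by ring
  · push Not at hx
    obtain ⟨l, hl⟩ := hx
    have h0 : oneBody α (x l) = 0 := by simp [oneBody, not_lt.2 hl]
    rw [Finset.prod_eq_zero (Finset.mem_univ l) h0,
      Finset.prod_eq_zero (Finset.mem_univ l) (by rw [h0, zero_mul])]
    simp

/-- The interaction `∏_{j < k} ((λₖ - λⱼ)² + δ) ^ (β / 2)`; for `δ = 0` it is the repulsion of the
ensemble, for `δ > 0` it is smooth also where eigenvalues collide. -/
def interaction (N : ℕ) (β δ : ℝ) (x : Fin N → ℝ) : ℝ :=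
  ∏ j, ∏ k ∈ Finset.Ioi j, ((x k - x j) ^ 2 + δ) ^ (β / 2)

lemma weight_eq (N : ℕ) (β α : ℝ) (x : Fin N → ℝ) :
    weight N β α x = (∏ l, oneBody α (x l)) * interaction N β 0 x := by
  unfold weight oneBody interaction
  congr 1
  refine Finset.prod_congr rfl fun j _ => Finset.prod_congr rfl fun k _ => ?_
  rw [add_zero, ← sq_abs, ← Real.rpow_natCast, ← Real.rpow_mul (abs_nonneg _)]
  congr 1
  push_cast
  ring

lemma interaction_nonneg {N : ℕ} {β δ : ℝ} (hδ : 0 ≤ δ) (x : Fin N → ℝ) :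
    0 ≤ interaction N β δ x :=
  Finset.prod_nonneg fun _ _ => Finset.prod_nonneg fun _ _ => by positivity

lemma measurable_interaction (N : ℕ) (β δ : ℝ) : Measurable (interaction N β δ) := by
  unfold interaction
  refine Finset.measurable_prod _ fun j _ => Finset.measurable_prod _ fun k _ => ?_
  fun_prop

/-- A bound for the regularised interaction, uniform in the regularisation. -/
def interactionBound (N : ℕ) (β : ℝ) (x : Fin N → ℝ) : ℝ :=
  ∏ j : Fin N, ∏ _k ∈ Finset.Ioi j, (1 + ∑ l, x l) ^ ⌈β⌉₊

lemma interaction_le {N : ℕ} {β δ : ℝ} (hβ : 0 < β) (hδ : 0 ≤ δ) (hδ1 : δ ≤ 1) {x : Fin N → ℝ}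
    (hx : ∀ l, 0 < x l) : interaction N β δ x ≤ interactionBound N β x := by
  unfold interaction interactionBound
  refine Finset.prod_le_prod (fun _ _ => Finset.prod_nonneg fun _ _ => by positivity)
    fun j _ => Finset.prod_le_prod (fun _ _ => by positivity) fun k _ => ?_
  have h1 := PolyBounded.one_le_base hx
  have hk := Finset.single_le_sum (f := x) (fun i _ => (hx i).le) (Finset.mem_univ k)
  have hj := Finset.single_le_sum (f := x) (fun i _ => (hx i).le) (Finset.mem_univ j)
  have h2 : (x k - x j) ^ 2 + δ ≤ (1 + ∑ l, x l) ^ 2 := by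
    have h3 : |x k - x j| ≤ ∑ l, x l := abs_le.2 ⟨by linarith [hx k], by linarith [hx j]⟩
    have h4 : (x k - x j) ^ 2 ≤ (∑ l, x l) ^ 2 := sq_le_sq' (by linarith [abs_le.1 h3])
      (abs_le.1 h3).2
    nlinarith
  calc ((x k - x j) ^ 2 + δ) ^ (β / 2) ≤ ((1 + ∑ l, x l) ^ 2) ^ (β / 2) := by gcongr
    _ = (1 + ∑ l, x l) ^ β := by
        rw [← Real.rpow_natCast, ← Real.rpow_mul (by linarith)]
        congr 1; push_cast; ring
    _ ≤ (1 + ∑ l, x l) ^ (⌈β⌉₊ : ℝ) := Real.rpow_le_rpow_of_exponent_le h1 (Nat.le_ceil β)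
    _ = _ := Real.rpow_natCast _ _

lemma polyBounded_interactionBound (N : ℕ) (β : ℝ) : PolyBounded (interactionBound N β) := by
  have h : PolyBounded (fun x : Fin N → ℝ => 1 + ∑ l, x l) :=
    (PolyBounded.const 1).add (PolyBounded.sum _ fun l _ => PolyBounded.coord l)
  exact PolyBounded.prod _ fun j _ => PolyBounded.prod _ fun k _ => h.pow _

lemma polyBounded_interaction (N : ℕ) {β δ : ℝ} (hβ : 0 < β) (hδ : 0 ≤ δ) (hδ1 : δ ≤ 1) :
    PolyBounded (interaction N β δ) := by
  refine (polyBounded_interactionBound N β).of_le (measurable_interaction N β δ) fun x hx => ?_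
  rw [abs_of_nonneg (interaction_nonneg hδ x)]
  exact (interaction_le hβ hδ hδ1 hx).trans (le_abs_self _)

/-- Observables of polynomial growth are integrable in the ensemble. -/
lemma PolyBounded.integrable_weight {N : ℕ} {β α : ℝ} (hβ : 0 < β) (hα : 0 < α)
    {g : (Fin N → ℝ) → ℝ} (hg : PolyBounded g) : Integrable (fun x => weight N β α x * g x) := by
  simp_rw [weight_eq, mul_assoc]
  exact ((polyBounded_interaction N hβ le_rfl zero_le_one).mul hg).integrable_prod_oneBody hα

lemma weight_nonneg (N : ℕ) (β α : ℝ) (x : Fin N → ℝ) : 0 ≤ weight N β α x := by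
  rw [weight_eq]
  exact mul_nonneg (Finset.prod_nonneg fun l _ => oneBody_nonneg _ _) (interaction_nonneg le_rfl x)

lemma weight_eq_zero {N : ℕ} {β α : ℝ} {x : Fin N → ℝ} (hx : ¬ ∀ l, 0 < x l) :
    weight N β α x = 0 := by
  push Not at hx
  obtain ⟨l, hl⟩ := hx
  rw [weight_eq, Finset.prod_eq_zero (Finset.mem_univ l) (by simp [oneBody, not_lt.2 hl]), zero_mul]

lemma integral_weight_pos (N : ℕ) {β α : ℝ} (hβ : 0 < β) (hα : 0 < α) :
    0 < ∫ x, weight N β α x := by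
  have hint : Integrable (weight N β α) := by
    simpa using (PolyBounded.const (N := N) 1).integrable_weight hβ hα
  rw [integral_pos_iff_support_of_nonneg (weight_nonneg N β α) hint]
  let U : Set (Fin N → ℝ) := {x | ∀ l, 0 < x l} ∩ {x | ∀ j k, j < k → x j < x k}
  have hU : IsOpen U := by
    refine IsOpen.inter ?_ ?_
    · simp only [Set.ofPred_forall]
      exact isOpen_iInter_of_finite fun l => isOpen_lt continuous_const (continuous_apply l)
    · simp only [Set.ofPred_forall]
      exact isOpen_iInter_of_finite fun j => isOpen_iInter_of_finite fun k =>
        isOpen_iInter_of_finite fun _ => isOpen_lt (continuous_apply j) (continuous_apply k)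
  have hne : U.Nonempty := ⟨fun l => (l : ℝ) + 1, fun l => by positivity, fun j k hjk => by
    have : ((j : ℕ) : ℝ) < (k : ℕ) := by exact_mod_cast hjk
    simpa using this⟩
  refine (hU.measure_pos volume hne).trans_le (measure_mono fun x hx => ?_)
  rw [Function.mem_support, weight]
  refine (mul_pos (Finset.prod_pos fun l _ => ?_) (Finset.prod_pos fun j _ =>
    Finset.prod_pos fun k hk => ?_)).ne'
  · rw [if_pos (hx.1 l)]
    have := hx.1 l
    positivity
  · have := hx.2 j k (Finset.mem_Ioi.1 hk)
    have h2 : 0 < |x k - x j| := abs_pos.2 (by linarith)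
    positivity

end

/-! ### The loop equation -/

section

lemma hasDerivAt_pow_mul_oneBody {α : ℝ} (hα : 0 < α) (k : ℕ) (u : ℝ) :
    HasDerivAt (fun u => u ^ (k + 1) * oneBody α u)
      (((k + 1 + α) * u ^ k - u ^ (k + 1)) * oneBody α u) u := by
  rcases lt_trichotomy u 0 with hu | rfl | hu
  · have h0 : (fun u => u ^ (k + 1) * oneBody α u) =ᶠ[𝓝 u] fun _ => 0 := by
      filter_upwards [eventually_lt_nhds hu] with v hv
      simp [oneBody, hv.le.not_gt]
    have h1 : oneBody α u = 0 := by simp [oneBody, hu.le.not_gt]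
    rw [h1, mul_zero]
    exact (hasDerivAt_const u (0 : ℝ)).congr_of_eventuallyEq h0
  · have h1 : oneBody α 0 = 0 := by simp [oneBody]
    rw [h1, mul_zero, hasDerivAt_iff_tendsto_slope_zero]
    have h2 : Tendsto (fun t : ℝ => |t| ^ α) (𝓝[≠] 0) (𝓝 0) := by
      have : ContinuousAt (fun t : ℝ => |t| ^ α) 0 :=
        (continuous_abs.continuousAt).rpow_const (Or.inr hα.le)
      have h3 := this.tendsto.mono_left (nhdsWithin_le_nhds (s := {0}ᶜ))
      simpa [Real.zero_rpow hα.ne'] using h3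
    refine squeeze_zero_norm' ?_ h2
    have h4 : ∀ᶠ t : ℝ in 𝓝[≠] 0, |t| < 1 := by
      refine nhdsWithin_le_nhds ?_
      have : ContinuousAt (fun t : ℝ => |t|) 0 := continuous_abs.continuousAt
      exact this.eventually_lt_const (by simp)
    filter_upwards [h4, self_mem_nhdsWithin] with t ht ht0
    simp only [zero_add, h1, mul_zero, sub_zero, smul_eq_mul]
    rw [oneBody]
    split_ifs with htp
    · rw [pow_succ, show t⁻¹ * (t ^ k * t * (t ^ α * Real.exp (-t))) =
        t ^ k * (t ^ α * Real.exp (-t)) by field_simp]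
      rw [Real.norm_of_nonneg (by positivity), abs_of_pos htp]
      rw [abs_of_pos htp] at ht
      have h5 : t ^ k ≤ 1 := pow_le_one₀ htp.le ht.le
      have h6 : Real.exp (-t) ≤ 1 := Real.exp_le_one_iff.2 (by linarith)
      calc t ^ k * (t ^ α * Real.exp (-t)) ≤ 1 * (t ^ α * 1) := by gcongr
        _ = _ := by ring
    · simp only [mul_zero, norm_zero]
      positivity
  · have h0 : (fun u => u ^ (k + 1) * oneBody α u) =ᶠ[𝓝 u]
        fun u => u ^ (k + 1) * (u ^ α * Real.exp (-u)) := by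
      filter_upwards [eventually_gt_nhds hu] with v hv
      simp [oneBody, hv]
    refine HasDerivAt.congr_of_eventuallyEq ?_ h0
    have := (hasDerivAt_pow (k + 1) u).mul ((Real.hasDerivAt_rpow_const (p := α)
      (Or.inl hu.ne')).mul ((hasDerivAt_neg u).exp))
    refine this.congr_deriv ?_
    rw [oneBody, if_pos hu, Real.rpow_sub_one hu.ne']
    push_cast
    field_simp
    simp
    ring

/-- The logarithmic derivative of the regularised interaction in the coordinate `j`, up to the
factor `β`. -/
def repulsion (N : ℕ) (δ : ℝ) (j : Fin N) (x : Fin N → ℝ) : ℝ :=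
  ∑ i, ∑ l ∈ Finset.Ioi i, (x l - x i) / ((x l - x i) ^ 2 + δ) *
    ((Pi.single j 1 : Fin N → ℝ) l - (Pi.single j 1 : Fin N → ℝ) i)

lemma hasLineDerivAt_interaction {N : ℕ} (β : ℝ) {δ : ℝ} (hδ : 0 < δ) (j : Fin N)
    (x : Fin N → ℝ) :
    HasLineDerivAt ℝ (interaction N β δ) (β * repulsion N δ j x * interaction N β δ x) x
      (Pi.single j 1) := by
  unfold HasLineDerivAt
  set e : Fin N → ℝ := Pi.single j 1 with he
  have hq : ∀ (y : Fin N → ℝ) i l, 0 < (y l - y i) ^ 2 + δ := fun y i l => by positivity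
  have hI : ∀ y, interaction N β δ y =
      Real.exp (∑ i, ∑ l ∈ Finset.Ioi i, Real.log ((y l - y i) ^ 2 + δ) * (β / 2)) := by
    intro y
    unfold interaction
    simp_rw [Real.exp_sum, Real.rpow_def_of_pos (hq y _ _)]
  have h1 : HasDerivAt (fun t : ℝ => ∑ i, ∑ l ∈ Finset.Ioi i,
      Real.log (((x + t • e) l - (x + t • e) i) ^ 2 + δ) * (β / 2))
      (β * repulsion N δ j x) 0 := by
    have : β * repulsion N δ j x = ∑ i, ∑ l ∈ Finset.Ioi i,
        (2 * (x l - x i) * (e l - e i)) / ((x l - x i) ^ 2 + δ) * (β / 2) := by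
      rw [repulsion, Finset.mul_sum]
      refine Finset.sum_congr rfl fun i _ => ?_
      rw [Finset.mul_sum]
      refine Finset.sum_congr rfl fun l _ => ?_
      ring
    rw [this]
    refine HasDerivAt.fun_sum fun i _ => HasDerivAt.fun_sum fun l _ => ?_
    refine HasDerivAt.mul_const ?_ _
    have h2 : HasDerivAt (fun t : ℝ => (x + t • e) l - (x + t • e) i) (e l - e i) 0 := by
      simp only [Pi.add_apply, Pi.smul_apply, smul_eq_mul]
      have a1 := ((hasDerivAt_id (0 : ℝ)).mul_const (e l)).const_add (x l)
      have a2 := ((hasDerivAt_id (0 : ℝ)).mul_const (e i)).const_add (x i)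
      simpa using a1.fun_sub a2
    have h3 := ((h2.pow 2).add_const δ).log (by simpa using (hq x i l).ne')
    simpa using h3
  have h4 := h1.exp
  simp_rw [← hI] at h4
  refine h4.congr_deriv ?_
  simp [mul_comm]

/-- `f` is an observable of polynomial growth whose partial derivatives `f'` are of polynomial
growth as well. -/
structure IsObservable {N : ℕ} (f : (Fin N → ℝ) → ℝ) (f' : Fin N → (Fin N → ℝ) → ℝ) : Prop where
  polyBounded : PolyBounded f
  polyBounded_deriv : ∀ j, PolyBounded (f' j)
  hasLineDerivAt : ∀ j x, HasLineDerivAt ℝ f (f' j x) x (Pi.single j 1)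

lemma polyBounded_repulsion (N : ℕ) {δ : ℝ} (hδ : 0 < δ) (j : Fin N) :
    PolyBounded (repulsion N δ j) := by
  refine PolyBounded.sum _ fun i _ => PolyBounded.sum _ fun l _ => PolyBounded.mul ?_
    (PolyBounded.const _)
  refine (((PolyBounded.coord l).sub (PolyBounded.coord i)).const_mul (1 / δ)).of_le
    (by fun_prop) fun x _ => ?_
  rw [abs_div, abs_mul, abs_of_pos (show 0 < (x l - x i) ^ 2 + δ by positivity),
    abs_of_pos (show 0 < 1 / δ by positivity), div_eq_mul_one_div, mul_comm]
  gcongr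
  nlinarith [sq_nonneg (x l - x i)]

/-- Integration by parts in one coordinate, for the regularised interaction and the vector field
`xⱼ ^ (k + 1) ∂ⱼ`. -/
lemma integral_regularised_eq_zero {N : ℕ} {β α δ : ℝ} (hβ : 0 < β) (hα : 0 < α) (hδ : 0 < δ)
    (hδ1 : δ ≤ 1) (k : ℕ) {f : (Fin N → ℝ) → ℝ} {f' : Fin N → (Fin N → ℝ) → ℝ}
    (hf : IsObservable f f') (j : Fin N) :
    Integrable (fun x => (∏ l, oneBody α (x l)) * (interaction N β δ x *
      (((k + 1 + α) * x j ^ k - x j ^ (k + 1)) * f x + x j ^ (k + 1) * f' j x +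
        β * (repulsion N δ j x * x j ^ (k + 1)) * f x))) ∧
    ∫ x, (∏ l, oneBody α (x l)) * (interaction N β δ x *
      (((k + 1 + α) * x j ^ k - x j ^ (k + 1)) * f x + x j ^ (k + 1) * f' j x +
        β * (repulsion N δ j x * x j ^ (k + 1)) * f x)) = 0 := by
  have hx := PolyBounded.coord (N := N) j
  have hI := polyBounded_interaction N hβ hδ.le hδ1
  have hint : Integrable (fun x => (∏ l, oneBody α (x l)) * (interaction N β δ x *
      (((k + 1 + α) * x j ^ k - x j ^ (k + 1)) * f x + x j ^ (k + 1) * f' j x +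
        β * (repulsion N δ j x * x j ^ (k + 1)) * f x))) := by
    refine PolyBounded.integrable_prod_oneBody hα (hI.mul ?_)
    exact (((((hx.pow k).const_mul _).sub (hx.pow (k + 1))).mul hf.polyBounded).add
      ((hx.pow (k + 1)).mul (hf.polyBounded_deriv j))).add
      ((((polyBounded_repulsion N hδ j).mul (hx.pow (k + 1))).const_mul β).mul hf.polyBounded)
  refine ⟨hint, ?_⟩
  have hint2 : Integrable (fun x => (∏ l, oneBody α (x l)) *
      (interaction N β δ x * (x j ^ (k + 1) * f x))) :=
    (hI.mul ((hx.pow (k + 1)).mul hf.polyBounded)).integrable_prod_oneBody hα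
  have key := integral_bilinear_hasLineDerivAt_right_eq_neg_left_of_integrable
    (μ := (volume : Measure (Fin N → ℝ))) (f := fun _ : Fin N → ℝ => (1 : ℝ))
    (f' := fun _ => (0 : ℝ))
    (g := fun x => (∏ l, oneBody α (x l)) * (interaction N β δ x * (x j ^ (k + 1) * f x)))
    (g' := fun x => (∏ l, oneBody α (x l)) * (interaction N β δ x *
      (((k + 1 + α) * x j ^ k - x j ^ (k + 1)) * f x + x j ^ (k + 1) * f' j x +
        β * (repulsion N δ j x * x j ^ (k + 1)) * f x)))
    (v := Pi.single j 1) (B := ContinuousLinearMap.mul ℝ ℝ)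
    (by simp) (by simpa using hint) (by simpa using hint2)
    (fun x _ => hasDerivAt_const (0 : ℝ) (1 : ℝ)) ?_
  · simpa using key
  intro x _
  have h1 : HasLineDerivAt ℝ (fun x : Fin N → ℝ => x j ^ (k + 1) * oneBody α (x j))
      (((k + 1 + α) * x j ^ k - x j ^ (k + 1)) * oneBody α (x j)) x (Pi.single j 1) := by
    unfold HasLineDerivAt
    have a1 : HasDerivAt (fun t : ℝ => (x + t • (Pi.single j 1 : Fin N → ℝ)) j) 1 0 := by
      simp only [Pi.add_apply, Pi.smul_apply, smul_eq_mul, Pi.single_eq_same, mul_one]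
      exact (hasDerivAt_id (0 : ℝ)).const_add (x j)
    have a2 := hasDerivAt_pow_mul_oneBody hα k (x j)
    have a3 := HasDerivAt.comp_of_eq (0 : ℝ) a2 a1 (by simp)
    simpa [Function.comp_def] using a3
  have h2 := hasLineDerivAt_interaction β hδ j x
  have h3 := hf.hasLineDerivAt j x
  unfold HasLineDerivAt at h1 h2 h3 ⊢
  have h4 := (h1.mul (h2.mul h3)).const_mul (∏ l ∈ Finset.univ.erase j, oneBody α (x l))
  have hprod : ∀ y : Fin N → ℝ, ∏ l, oneBody α (y l) =
      (∏ l ∈ Finset.univ.erase j, oneBody α (y l)) * oneBody α (y j) := fun y =>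
    (Finset.prod_erase_mul _ _ (Finset.mem_univ j)).symm
  have herase : ∀ t : ℝ, ∏ l ∈ Finset.univ.erase j,
      oneBody α ((x + t • (Pi.single j 1 : Fin N → ℝ)) l) =
      ∏ l ∈ Finset.univ.erase j, oneBody α (x l) := fun t =>
    Finset.prod_congr rfl fun l hl => by
      simp [Pi.single_eq_of_ne (Finset.ne_of_mem_erase hl)]
  refine (h4.congr_of_eventuallyEq (Eventually.of_forall fun t => ?_)).congr_deriv ?_
  · simp only [hprod, herase, Pi.mul_apply]
    ring
  · simp only [hprod, zero_smul, add_zero, Pi.mul_apply]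
    ring

/-- The complete homogeneous symmetric polynomial of degree `k` in two variables. -/
def completeHomogeneous (k : ℕ) (u v : ℝ) : ℝ := ∑ p ∈ antidiagonal k, u ^ p.1 * v ^ p.2

lemma completeHomogeneous_mul (k : ℕ) (u v : ℝ) :
    completeHomogeneous k u v * (u - v) = u ^ (k + 1) - v ^ (k + 1) := by
  rw [completeHomogeneous, Finset.Nat.sum_antidiagonal_eq_sum_range_succ (fun i j => u ^ i * v ^ j),
    ← geom_sum₂_mul]
  rfl

lemma sum_repulsion_mul_pow (N : ℕ) (δ : ℝ) (k : ℕ) (x : Fin N → ℝ) :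
    ∑ j, repulsion N δ j x * x j ^ (k + 1) = ∑ i, ∑ l ∈ Finset.Ioi i,
      (x l - x i) ^ 2 / ((x l - x i) ^ 2 + δ) * completeHomogeneous k (x l) (x i) := by
  unfold repulsion
  simp_rw [Finset.sum_mul]
  rw [Finset.sum_comm]
  refine Finset.sum_congr rfl fun i _ => ?_
  rw [Finset.sum_comm]
  refine Finset.sum_congr rfl fun l _ => ?_
  have h1 : ∀ m : Fin N, ∑ j, (Pi.single j 1 : Fin N → ℝ) m * x j ^ (k + 1) = x m ^ (k + 1) := by
    intro m
    simp [Pi.single_apply]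
  simp_rw [mul_assoc, ← Finset.mul_sum, sub_mul, Finset.sum_sub_distrib, h1,
    ← completeHomogeneous_mul k (x l) (x i)]
  ring

lemma sum_completeHomogeneous (N k : ℕ) (x : Fin N → ℝ) :
    ∑ i, ∑ l ∈ Finset.Ioi i, completeHomogeneous k (x l) (x i) =
      (1 / 2) * (∑ p ∈ antidiagonal k, (∑ j, x j ^ p.1) * (∑ j, x j ^ p.2) -
        (k + 1) * ∑ j, x j ^ k) := by
  have hsymm : ∀ u v, completeHomogeneous k u v = completeHomogeneous k v u := by
    intro u v
    unfold completeHomogeneous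
    rw [← Finset.Nat.sum_antidiagonal_swap]
    exact Finset.sum_congr rfl fun p _ => by simp [mul_comm]
  have hdiag : ∀ u, completeHomogeneous k u u = (k + 1) * u ^ k := by
    intro u
    unfold completeHomogeneous
    have : ∀ p ∈ antidiagonal k, u ^ p.1 * u ^ p.2 = u ^ k := fun p hp => by
      rw [← pow_add, mem_antidiagonal.1 hp]
    rw [Finset.sum_congr rfl this]
    simp
  have h1 := Finset.sum_sum_Ioi_add_eq_sum_sum_off_diag
    (fun l i : Fin N => completeHomogeneous k (x l) (x i))
  have h2 : ∑ i : Fin N, ∑ l : Fin N, completeHomogeneous k (x l) (x i) =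
      ∑ p ∈ antidiagonal k, (∑ j, x j ^ p.1) * (∑ j, x j ^ p.2) := by
    unfold completeHomogeneous
    simp_rw [Finset.sum_mul_sum]
    rw [Finset.sum_comm]
    simp_rw [Finset.sum_comm (t := antidiagonal k)]
  have h3 : ∑ i : Fin N, ∑ l : Fin N, completeHomogeneous k (x l) (x i) =
      (k + 1) * ∑ j, x j ^ k +
      ∑ i : Fin N, ∑ l ∈ ({i}ᶜ : Finset (Fin N)), completeHomogeneous k (x l) (x i) := by
    rw [Finset.mul_sum, ← Finset.sum_add_distrib]
    refine Finset.sum_congr rfl fun i _ => ?_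
    rw [← hdiag, Fintype.sum_eq_add_sum_compl i]
  have h4 : ∑ i, ∑ l ∈ Finset.Ioi i,
      (completeHomogeneous k (x l) (x i) + completeHomogeneous k (x i) (x l)) =
      2 * ∑ i, ∑ l ∈ Finset.Ioi i, completeHomogeneous k (x l) (x i) := by
    simp_rw [hsymm (x _) (x _), ← two_mul, Finset.mul_sum]
  linarith

/-- A majorant of the regularised repulsion term. -/
def repulsionBound (N k : ℕ) (x : Fin N → ℝ) : ℝ :=
  ∑ i, ∑ l ∈ Finset.Ioi i, |completeHomogeneous k (x l) (x i)|

lemma polyBounded_repulsionBound (N k : ℕ) : PolyBounded (repulsionBound N k) := by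
  refine PolyBounded.sum _ fun i _ => PolyBounded.sum _ fun l _ => ?_
  have h : PolyBounded (fun x : Fin N → ℝ => completeHomogeneous k (x l) (x i)) :=
    PolyBounded.sum _ fun p _ => ((PolyBounded.coord l).pow _).mul ((PolyBounded.coord i).pow _)
  exact h.of_le (by simpa using h.1.norm) fun x _ => by simp

lemma continuous_interaction_reg (N : ℕ) {β : ℝ} (hβ : 0 < β) (x : Fin N → ℝ) :
    Continuous fun δ : ℝ => interaction N β δ x := by
  unfold interaction
  refine continuous_finsetProd _ fun i _ => continuous_finsetProd _ fun l _ => ?_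
  exact (continuous_const.add continuous_id).rpow_const fun _ => Or.inr (by positivity)

/-- As the regularisation is removed, interaction times repulsion converges everywhere: at a
collision the interaction vanishes while the repulsion term stays bounded. -/
lemma tendsto_interaction_mul_repulsion (N : ℕ) {β : ℝ} (hβ : 0 < β) (k : ℕ) (x : Fin N → ℝ) :
    Tendsto (fun δ : ℝ => interaction N β δ x * ∑ j, repulsion N δ j x * x j ^ (k + 1)) (𝓝[>] 0)
      (𝓝 (interaction N β 0 x * ∑ i, ∑ l ∈ Finset.Ioi i, completeHomogeneous k (x l) (x i))) := by
  simp_rw [sum_repulsion_mul_pow, Finset.mul_sum]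
  refine tendsto_finsetSum _ fun i _ => tendsto_finsetSum _ fun l hl => ?_
  have hI : Tendsto (fun δ : ℝ => interaction N β δ x) (𝓝[>] 0) (𝓝 (interaction N β 0 x)) :=
    ((continuous_interaction_reg N hβ x).tendsto 0).mono_left nhdsWithin_le_nhds
  by_cases hil : x l = x i
  · have h0 : interaction N β 0 x = 0 := by
      refine Finset.prod_eq_zero (Finset.mem_univ i) (Finset.prod_eq_zero hl ?_)
      simp [hil, Real.zero_rpow (show β / 2 ≠ 0 by positivity)]
    rw [h0, zero_mul]
    simp [hil]
  · refine hI.mul ?_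
    have hne : (x l - x i) ^ 2 ≠ 0 := pow_ne_zero _ (sub_ne_zero.2 hil)
    have h1 : Tendsto (fun δ : ℝ => (x l - x i) ^ 2 / ((x l - x i) ^ 2 + δ)) (𝓝[>] 0) (𝓝 1) := by
      have : ContinuousAt (fun δ : ℝ => (x l - x i) ^ 2 / ((x l - x i) ^ 2 + δ)) 0 :=
        continuousAt_const.div (by fun_prop) (by simpa using sub_ne_zero.2 hil)
      have h2 := this.tendsto.mono_left (nhdsWithin_le_nhds (s := Ioi (0 : ℝ)))
      simpa [div_self hne] using h2
    simpa using h1.mul_const (completeHomogeneous k (x l) (x i))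

lemma abs_sum_repulsion_le (N : ℕ) {δ : ℝ} (hδ : 0 < δ) (k : ℕ) (x : Fin N → ℝ) :
    |∑ j, repulsion N δ j x * x j ^ (k + 1)| ≤ repulsionBound N k x := by
  rw [sum_repulsion_mul_pow]
  refine (Finset.abs_sum_le_sum_abs _ _).trans (Finset.sum_le_sum fun i _ =>
    (Finset.abs_sum_le_sum_abs _ _).trans (Finset.sum_le_sum fun l _ => ?_))
  have hq : 0 < (x l - x i) ^ 2 + δ := by positivity
  rw [abs_mul, abs_div, abs_of_nonneg (sq_nonneg _), abs_of_pos hq]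
  refine mul_le_of_le_one_left (abs_nonneg _) ((div_le_one hq).2 (by linarith))

/-- The loop equation of the ensemble generated by the vector field `∑ⱼ xⱼ ^ (k + 1) ∂ⱼ` and
tested against the observable `f`. -/
theorem integral_weight_loop {N : ℕ} {β α : ℝ} (hβ : 0 < β) (hα : 0 < α) (k : ℕ)
    {f : (Fin N → ℝ) → ℝ} {f' : Fin N → (Fin N → ℝ) → ℝ} (hf : IsObservable f f') :
    ∫ x, weight N β α x * (((k + 1 + α) * ∑ j, x j ^ k - ∑ j, x j ^ (k + 1)) * f x +
      ∑ j, x j ^ (k + 1) * f' j x + β / 2 * (∑ p ∈ antidiagonal k,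
        (∑ j, x j ^ p.1) * (∑ j, x j ^ p.2) - (k + 1) * ∑ j, x j ^ k) * f x) = 0 := by
  have hpow : ∀ m : ℕ, PolyBounded (fun x : Fin N → ℝ => ∑ j, x j ^ m) := fun m =>
    PolyBounded.sum _ fun j _ => (PolyBounded.coord j).pow m
  let g : (Fin N → ℝ) → ℝ := fun x => ((k + 1 + α) * ∑ j, x j ^ k - ∑ j, x j ^ (k + 1)) * f x +
      ∑ j, x j ^ (k + 1) * f' j x
  have hg : PolyBounded g := ((((hpow k).const_mul _).sub (hpow _)).mul hf.polyBounded).add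
    (PolyBounded.sum _ fun j _ => ((PolyBounded.coord j).pow _).mul (hf.polyBounded_deriv j))
  let F : ℝ → (Fin N → ℝ) → ℝ := fun δ x => (∏ l, oneBody α (x l)) * (interaction N β δ x *
      (g x + β * (∑ j, repulsion N δ j x * x j ^ (k + 1)) * f x))
  have hF : ∀ δ, 0 < δ → δ ≤ 1 → Integrable (F δ) ∧ ∫ x, F δ x = 0 := by
    intro δ hδ hδ1
    have h := integral_regularised_eq_zero hβ hα hδ hδ1 k hf
    have hsum : F δ = fun x => ∑ j, (∏ l, oneBody α (x l)) * (interaction N β δ x *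
      (((k + 1 + α) * x j ^ k - x j ^ (k + 1)) * f x + x j ^ (k + 1) * f' j x +
        β * (repulsion N δ j x * x j ^ (k + 1)) * f x)) := by
      funext x
      simp only [F, g]
      rw [← Finset.mul_sum, ← Finset.mul_sum, Finset.sum_add_distrib, Finset.sum_add_distrib,
        ← Finset.sum_mul, ← Finset.sum_mul, ← Finset.mul_sum, Finset.sum_sub_distrib,
        ← Finset.mul_sum]
    rw [hsum]
    refine ⟨integrable_finsetSum _ fun j _ => (h j).1, ?_⟩
    rw [integral_finsetSum _ fun j _ => (h j).1]
    exact Finset.sum_eq_zero fun j _ => (h j).2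
  let B : (Fin N → ℝ) → ℝ := fun x =>
    interactionBound N β x * (|g x| + β * repulsionBound N k x * |f x|)
  have habs : ∀ {u : (Fin N → ℝ) → ℝ}, PolyBounded u → PolyBounded (fun x => |u x|) :=
    fun hu => hu.of_le (by simpa using hu.1.norm) fun x _ => by simp
  have hB : PolyBounded B := (polyBounded_interactionBound N β).mul
    ((habs hg).add (((polyBounded_repulsionBound N k).const_mul β).mul (habs hf.polyBounded)))
  have hlim : Tendsto (fun δ : ℝ => ∫ x, F δ x) (𝓝[>] 0) (𝓝 (∫ x, weight N β α x * (g x +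
      β * (∑ i, ∑ l ∈ Finset.Ioi i, completeHomogeneous k (x l) (x i)) * f x))) := by
    have hsmall : ∀ᶠ δ : ℝ in 𝓝[>] 0, 0 < δ ∧ δ ≤ 1 := by
      filter_upwards [Ioc_mem_nhdsGT (zero_lt_one' ℝ)] with δ hδ using hδ
    refine tendsto_integral_filter_of_dominated_convergence
      (fun x => (∏ l, oneBody α (x l)) * B x) ?_ ?_ (hB.integrable_prod_oneBody hα) ?_
    · filter_upwards [hsmall] with δ hδ using (hF δ hδ.1 hδ.2).1.aestronglyMeasurable
    · filter_upwards [hsmall] with δ hδ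
      refine Eventually.of_forall fun x => ?_
      by_cases hx : ∀ l, 0 < x l
      · have h0 : 0 ≤ ∏ l, oneBody α (x l) := Finset.prod_nonneg fun l _ => oneBody_nonneg _ _
        rw [Real.norm_eq_abs, abs_mul, abs_of_nonneg h0]
        refine mul_le_mul_of_nonneg_left ?_ h0
        rw [abs_mul, abs_of_nonneg (interaction_nonneg hδ.1.le x)]
        refine mul_le_mul (interaction_le hβ hδ.1.le hδ.2 hx) ((abs_add_le _ _).trans ?_)
          (abs_nonneg _) ((interaction_nonneg hδ.1.le x).trans (interaction_le hβ hδ.1.le hδ.2 hx))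
        rw [abs_mul, abs_mul, abs_of_pos hβ]
        gcongr
        exact abs_sum_repulsion_le N hδ.1 k x
      · push Not at hx
        obtain ⟨l, hl⟩ := hx
        simp only [F]
        rw [Finset.prod_eq_zero (Finset.mem_univ l) (by simp [oneBody, not_lt.2 hl])]
        simp
    · refine Eventually.of_forall fun x => ?_
      have h1 := ((continuous_interaction_reg N hβ x).tendsto 0).mono_left
        (nhdsWithin_le_nhds (s := Ioi (0 : ℝ)))
      have h2 := tendsto_interaction_mul_repulsion N hβ k x
      have h3 := ((h1.mul_const (g x)).add ((h2.const_mul β).mul_const (f x))).const_mul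
        (∏ l, oneBody α (x l))
      rw [weight_eq]
      refine (h3.congr fun δ => ?_).trans (le_of_eq (congrArg 𝓝 ?_))
      · simp only [F]
        ring
      · ring
  have hzero : Tendsto (fun δ : ℝ => ∫ x, F δ x) (𝓝[>] 0) (𝓝 0) := by
    refine tendsto_const_nhds.congr' ?_
    filter_upwards [Ioc_mem_nhdsGT (zero_lt_one' ℝ)] with δ hδ using (hF δ hδ.1 hδ.2).2.symm
  rw [← tendsto_nhds_unique hlim hzero]
  refine integral_congr_ae (Eventually.of_forall fun x => ?_)
  simp only [sum_completeHomogeneous, g]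
  ring

end

/-! ### Correlators of the power sums -/

section

/-- The ensemble average of a real observable. -/
def expect (N : ℕ) (β α : ℝ) (f : (Fin N → ℝ) → ℝ) : ℝ :=
  (∫ x, weight N β α x)⁻¹ * ∫ x, weight N β α x * f x

section expect

variable {N : ℕ} {β α : ℝ} {f g : (Fin N → ℝ) → ℝ}

lemma expect_one (hβ : 0 < β) (hα : 0 < α) : expect N β α (fun _ => 1) = 1 := by
  simp only [expect, mul_one]
  exact inv_mul_cancel₀ (integral_weight_pos N hβ hα).ne'

lemma expect_add (hβ : 0 < β) (hα : 0 < α) (hf : PolyBounded f) (hg : PolyBounded g) :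
    expect N β α (fun x => f x + g x) = expect N β α f + expect N β α g := by
  simp only [expect, mul_add]
  rw [integral_add (hf.integrable_weight hβ hα) (hg.integrable_weight hβ hα), mul_add]

lemma expect_const_mul (c : ℝ) (f : (Fin N → ℝ) → ℝ) :
    expect N β α (fun x => c * f x) = c * expect N β α f := by
  simp only [expect, mul_left_comm _ c, integral_const_mul]

lemma expect_sum {ι : Type*} (s : Finset ι) (hβ : 0 < β) (hα : 0 < α)
    {F : ι → (Fin N → ℝ) → ℝ} (h : ∀ i ∈ s, PolyBounded (F i)) :
    expect N β α (fun x => ∑ i ∈ s, F i x) = ∑ i ∈ s, expect N β α (F i) := by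
  simp only [expect, Finset.mul_sum]
  rw [integral_finsetSum _ fun i hi => (h i hi).integrable_weight hβ hα, Finset.mul_sum]

lemma expect_multiset_sum (T : Multiset ℕ) (hβ : 0 < β) (hα : 0 < α)
    {F : ℕ → (Fin N → ℝ) → ℝ} (h : ∀ i, PolyBounded (F i)) :
    expect N β α (fun x => (T.map fun r => F r x).sum) = (T.map fun r => expect N β α (F r)).sum := by
  induction T using Multiset.induction_on with
  | empty => simp [expect]
  | cons r T ih =>
    simp only [Multiset.map_cons, Multiset.sum_cons]
    rw [expect_add hβ hα (h r) (PolyBounded.multiset_sum T h), ih]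

end expect

/-- The moments of the limiting density, given by the recursion that the loop equation of
lowest order imposes. -/
def limitMoment (αt : ℝ) : ℕ → ℝ
  | 0 => 1
  | k + 1 => αt * limitMoment αt k +
      ∑ p : Fin (k + 1), limitMoment αt p * limitMoment αt (k - p)

lemma limitMoment_zero (αt : ℝ) : limitMoment αt 0 = 1 := by rw [limitMoment]

lemma limitMoment_succ (αt : ℝ) (k : ℕ) : limitMoment αt (k + 1) = αt * limitMoment αt k +
    ∑ p ∈ antidiagonal k, limitMoment αt p.1 * limitMoment αt p.2 := by
  rw [limitMoment, Finset.Nat.sum_antidiagonal_eq_sum_range_succ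
    (fun i j => limitMoment αt i * limitMoment αt j), Finset.sum_range]

/-- The fluctuation `∑ⱼ (xⱼ / c) ^ k - N mₖ` of a power sum, in the global scaling `c = N κ`,
around its leading deterministic value. -/
def fluctuation (N : ℕ) (c αt : ℝ) (k : ℕ) (x : Fin N → ℝ) : ℝ :=
  ∑ j, (x j / c) ^ k - N * limitMoment αt k

/-- The product of the fluctuations indexed by the multiset `T`. -/
def fluctuationProd (N : ℕ) (c αt : ℝ) (T : Multiset ℕ) (x : Fin N → ℝ) : ℝ :=
  (T.map fun r => fluctuation N c αt r x).prod

/-- The correlator of the fluctuations indexed by `T`, in the ensemble with `α₁ = αt N κ`. -/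
def correlator (N : ℕ) (β αt : ℝ) (T : Multiset ℕ) : ℝ :=
  expect N β (αt * N * (β / 2)) (fluctuationProd N (N * (β / 2)) αt T)

lemma polyBounded_powerSum (N : ℕ) (c : ℝ) (k : ℕ) :
    PolyBounded (fun x : Fin N → ℝ => ∑ j, (x j / c) ^ k) := by
  refine PolyBounded.sum _ fun j _ => PolyBounded.pow ?_ k
  simpa [div_eq_mul_inv] using (PolyBounded.coord j).mul (PolyBounded.const c⁻¹)

lemma polyBounded_fluctuation (N : ℕ) (c αt : ℝ) (k : ℕ) :
    PolyBounded (fluctuation N c αt k) :=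
  (polyBounded_powerSum N c k).sub (PolyBounded.const _)

lemma polyBounded_fluctuationProd (N : ℕ) (c αt : ℝ) (T : Multiset ℕ) :
    PolyBounded (fluctuationProd N c αt T) :=
  PolyBounded.multiset_prod T fun r => polyBounded_fluctuation N c αt r

lemma fluctuationProd_cons (N : ℕ) (c αt : ℝ) (k : ℕ) (T : Multiset ℕ) (x : Fin N → ℝ) :
    fluctuationProd N c αt (k ::ₘ T) x = fluctuation N c αt k x * fluctuationProd N c αt T x := by
  simp [fluctuationProd]

/-- The partial derivatives of a product of fluctuations. -/
def fluctuationProdDeriv (N : ℕ) (c αt : ℝ) (T : Multiset ℕ) (j : Fin N) (x : Fin N → ℝ) : ℝ :=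
  (T.map fun r => r * (x j / c) ^ (r - 1) / c * fluctuationProd N c αt (T.erase r) x).sum

lemma fluctuationProdDeriv_cons (N : ℕ) (c αt : ℝ) (k : ℕ) (T : Multiset ℕ) (j : Fin N)
    (x : Fin N → ℝ) : fluctuationProdDeriv N c αt (k ::ₘ T) j x =
      k * (x j / c) ^ (k - 1) / c * fluctuationProd N c αt T x +
        fluctuation N c αt k x * fluctuationProdDeriv N c αt T j x := by
  unfold fluctuationProdDeriv
  rw [Multiset.map_cons, Multiset.sum_cons, Multiset.erase_cons_head, ← Multiset.sum_map_mul_left]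
  congr 2
  refine Multiset.map_congr rfl fun r hr => ?_
  rw [Multiset.erase_cons_tail_of_mem hr, fluctuationProd_cons]
  ring

lemma isObservable_fluctuationProd (N : ℕ) (c αt : ℝ) (T : Multiset ℕ) :
    IsObservable (fluctuationProd N c αt T) (fluctuationProdDeriv N c αt T) := by
  refine ⟨polyBounded_fluctuationProd N c αt T, fun j => ?_, fun j x => ?_⟩
  · refine PolyBounded.multiset_sum T fun r => PolyBounded.mul ?_ (polyBounded_fluctuationProd _ _ _ _)
    have h : PolyBounded (fun x : Fin N → ℝ => x j / c) := by
      simpa [div_eq_mul_inv] using (PolyBounded.coord j).mul (PolyBounded.const c⁻¹)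
    simpa [div_eq_mul_inv] using ((h.pow (r - 1)).const_mul r).mul (PolyBounded.const c⁻¹)
  · induction T using Multiset.induction_on with
    | empty =>
      unfold HasLineDerivAt
      simpa [fluctuationProd, fluctuationProdDeriv] using hasDerivAt_const (0 : ℝ) (1 : ℝ)
    | cons k T ih =>
      have h1 : HasLineDerivAt ℝ (fluctuation N c αt k) (k * (x j / c) ^ (k - 1) / c) x
          (Pi.single j 1) := by
        unfold HasLineDerivAt fluctuation
        have h2 : ∀ i ∈ Finset.univ, HasDerivAt
            (fun t : ℝ => ((x + t • (Pi.single j 1 : Fin N → ℝ)) i / c) ^ k)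
            (k * (x i / c) ^ (k - 1) * ((Pi.single j 1 : Fin N → ℝ) i / c)) 0 := by
          intro i _
          have a1 : HasDerivAt (fun t : ℝ => (x + t • (Pi.single j 1 : Fin N → ℝ)) i / c)
              ((Pi.single j 1 : Fin N → ℝ) i / c) 0 := by
            simp only [Pi.add_apply, Pi.smul_apply, smul_eq_mul]
            simpa using (((hasDerivAt_id (0 : ℝ)).mul_const
              ((Pi.single j 1 : Fin N → ℝ) i)).const_add (x i)).div_const c
          simpa using a1.fun_pow k
        refine ((HasDerivAt.fun_sum h2).sub_const _).congr_deriv ?_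
        simp [Pi.single_apply, div_eq_mul_inv]
      unfold HasLineDerivAt at h1 ih ⊢
      have h3 := h1.fun_mul ih
      simp only [← fluctuationProd_cons] at h3
      refine h3.congr_deriv ?_
      rw [fluctuationProdDeriv_cons]
      simp

/-- The loop equations for the correlators of the fluctuations. They express a correlator of
total degree `d + 1` through correlators of total degree at most `d`. -/
theorem correlator_cons_succ {N : ℕ} {β αt : ℝ} (hN : 0 < N) (hβ : 0 < β) (hα : 0 < αt) (k : ℕ)
    (T : Multiset ℕ) :
    correlator N β αt ((k + 1) ::ₘ T) = αt * correlator N β αt (k ::ₘ T) +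
      ∑ p ∈ antidiagonal k, (2 * limitMoment αt p.1 * correlator N β αt (p.2 ::ₘ T) +
        correlator N β αt (p.1 ::ₘ p.2 ::ₘ T) / N) +
      (1 / (β / 2) - 1) * (k + 1) * (limitMoment αt k * correlator N β αt T +
        correlator N β αt (k ::ₘ T) / N) +
      1 / (β / 2) * (T.map fun r => r * (limitMoment αt (k + r) * correlator N β αt (T.erase r) +
        correlator N β αt ((k + r) ::ₘ T.erase r) / N)).sum := by
  have hN' : (0 : ℝ) < N := by exact_mod_cast hN
  set κ := β / 2 with hκ
  have hκ0 : 0 < κ := by positivity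
  set c : ℝ := N * κ with hc
  have hc0 : 0 < c := by positivity
  have hα1 : 0 < αt * N * κ := by positivity
  set m := limitMoment αt with hm
  let Y := fluctuation N c αt
  let f := fluctuationProd N c αt
  have hloop := integral_weight_loop hβ hα1 k (isObservable_fluctuationProd N c αt T)
  have hp : ∀ i (x : Fin N → ℝ), ∑ j, (x j) ^ i = c ^ i * (N * m i + Y i x) := by
    intro i x
    simp only [Y, fluctuation, hm, add_sub_cancel, Finset.mul_sum, div_pow]
    exact Finset.sum_congr rfl fun j _ => by field_simp
  have hder : ∀ x : Fin N → ℝ, ∑ j, x j ^ (k + 1) * fluctuationProdDeriv N c αt T j x =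
      c ^ k * (T.map fun r => r * ((N * m (k + r) + Y (k + r) x) * f (T.erase r) x)).sum := by
    intro x
    unfold fluctuationProdDeriv
    simp_rw [← Multiset.sum_map_mul_left]
    rw [← Multiset.sum_map_sum]
    congr 1
    refine Multiset.map_congr rfl fun r _ => ?_
    -- For `r = 0` both sides vanish because of the factor `r`, so the truncated exponent `r - 1`
    -- is harmless.
    have h1 : ∀ j, x j ^ (k + 1) * (r * (x j / c) ^ (r - 1) / c *
        fluctuationProd N c αt (T.erase r) x) =
        c ^ k * (r * ((x j ^ (k + r) / c ^ (k + r)) * f (T.erase r) x)) := by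
      intro j
      rcases r with _ | r
      · simp
      · simp only [Nat.add_sub_cancel, f]
        rw [show k + (r + 1) = (k + 1) + r by ring, pow_add c (k + 1) r, pow_succ c k, div_pow,
          pow_add (x j) (k + 1)]
        field_simp
    simp_rw [h1, ← Finset.mul_sum, ← Finset.sum_mul, ← Finset.sum_div, hp]
    field_simp
  -- The integrand of the loop equation in the centred variables. The deterministic terms of
  -- order `N ^ 2` cancel by the recursion of the limiting moments; the two parts of the double sum
  -- linear in the fluctuations coincide by symmetry.
  have hpt : ∀ x : Fin N → ℝ, ((k + 1 + αt * N * κ) * ∑ j, x j ^ k - ∑ j, x j ^ (k + 1)) * f T x +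
      ∑ j, x j ^ (k + 1) * fluctuationProdDeriv N c αt T j x + κ * (∑ p ∈ antidiagonal k,
        (∑ j, x j ^ p.1) * (∑ j, x j ^ p.2) - (k + 1) * ∑ j, x j ^ k) * f T x =
      c ^ (k + 1) * ((-1) * f ((k + 1) ::ₘ T) x + (αt * f (k ::ₘ T) x +
        (∑ p ∈ antidiagonal k, (2 * m p.1 * f (p.2 ::ₘ T) x + 1 / N * f (p.1 ::ₘ p.2 ::ₘ T) x) +
        ((1 / κ - 1) * (k + 1) * (m k * f T x + 1 / N * f (k ::ₘ T) x) +
        1 / κ * (T.map fun r => r * (m (k + r) * f (T.erase r) x +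
          1 / N * f ((k + r) ::ₘ T.erase r) x)).sum)))) := by
    intro x
    rw [hder]
    simp only [hp]
    have h2 : ∑ p ∈ antidiagonal k, c ^ p.1 * (N * m p.1 + Y p.1 x) *
        (c ^ p.2 * (N * m p.2 + Y p.2 x)) = c ^ k * (N ^ 2 * (m (k + 1) - αt * m k) +
        N * ∑ p ∈ antidiagonal k, (2 * m p.1 * Y p.2 x + 1 / N * (Y p.1 x * Y p.2 x))) := by
      have h3 : ∑ p ∈ antidiagonal k, m p.2 * Y p.1 x = ∑ p ∈ antidiagonal k, m p.1 * Y p.2 x :=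
        Finset.Nat.sum_antidiagonal_swap (f := fun p => m p.1 * Y p.2 x)
      have h4 : ∀ p ∈ antidiagonal k, c ^ p.1 * (N * m p.1 + Y p.1 x) *
        (c ^ p.2 * (N * m p.2 + Y p.2 x)) = c ^ k * (N ^ 2 * (m p.1 * m p.2) +
          N * (m p.1 * Y p.2 x) + N * (m p.2 * Y p.1 x) + Y p.1 x * Y p.2 x) := by
        intro p hp
        rw [← mem_antidiagonal.1 hp, pow_add]
        ring
      rw [Finset.sum_congr rfl h4, hm, limitMoment_succ, ← hm]
      simp only [← Finset.mul_sum, Finset.sum_add_distrib, mul_assoc, h3]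
      field_simp
      ring
    have h5 : (T.map fun r : ℕ => (r : ℝ) * ((N * m (k + r) + Y (k + r) x) * f (T.erase r) x)).sum =
        N * (T.map fun r : ℕ => (r : ℝ) * (m (k + r) * f (T.erase r) x +
          1 / N * f ((k + r) ::ₘ T.erase r) x)).sum := by
      rw [← Multiset.sum_map_mul_left]
      congr 1
      refine Multiset.map_congr rfl fun r _ => ?_
      simp only [f, fluctuationProd_cons, Y]
      field_simp
    have h6 : ∑ p ∈ antidiagonal k,
        (2 * m p.1 * f (p.2 ::ₘ T) x + 1 / N * f (p.1 ::ₘ p.2 ::ₘ T) x) =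
        (∑ p ∈ antidiagonal k, (2 * m p.1 * Y p.2 x + 1 / N * (Y p.1 x * Y p.2 x))) * f T x := by
      rw [Finset.sum_mul]
      refine Finset.sum_congr rfl fun p _ => ?_
      simp only [f, fluctuationProd_cons, Y]
      ring
    rw [h2, h5, h6]
    simp only [f, fluctuationProd_cons]
    change _ = c ^ (k + 1) * (-1 * (Y (k + 1) x * f T x) + (αt * (Y k x * f T x) + (_ +
      ((1 / κ - 1) * (k + 1) * (m k * f T x + 1 / N * (Y k x * f T x)) + _))))
    change (_ * (c ^ k * (N * m k + Y k x)) - _) * f T x + _ + _ * f T x = _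
    rw [hc]
    field_simp
    ring
  have hE := congrArg (fun I => (∫ x, weight N β (αt * N * κ) x)⁻¹ * I) hloop
  simp only [mul_zero] at hE
  change expect N β (αt * N * κ) (fun x => ((k + 1 + αt * N * κ) * ∑ j, x j ^ k -
    ∑ j, x j ^ (k + 1)) * f T x + ∑ j, x j ^ (k + 1) * fluctuationProdDeriv N c αt T j x +
    κ * (∑ p ∈ antidiagonal k, (∑ j, x j ^ p.1) * (∑ j, x j ^ p.2) - (k + 1) * ∑ j, x j ^ k) *
    f T x) = 0 at hE
  simp_rw [hpt, expect_const_mul] at hE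
  have hf : ∀ S, PolyBounded (f S) := fun S => polyBounded_fluctuationProd N c αt S
  have b1 : ∀ r : ℕ, PolyBounded (fun x => (r : ℝ) * (m (k + r) * f (T.erase r) x +
      1 / N * f ((k + r) ::ₘ T.erase r) x)) := fun r =>
    (((hf _).const_mul _).add ((hf _).const_mul _)).const_mul _
  have b2 : ∀ p : ℕ × ℕ, PolyBounded (fun x => 2 * m p.1 * f (p.2 ::ₘ T) x +
      1 / N * f (p.1 ::ₘ p.2 ::ₘ T) x) := fun p => ((hf _).const_mul _).add ((hf _).const_mul _)
  have b3 : PolyBounded (fun x => m k * f T x + 1 / N * f (k ::ₘ T) x) :=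
    ((hf _).const_mul _).add ((hf _).const_mul _)
  have b4 := (PolyBounded.multiset_sum T b1).const_mul (1 / κ)
  have b5 := (b3.const_mul ((1 / κ - 1) * (k + 1))).add b4
  have b6 := (PolyBounded.sum (antidiagonal k) fun p _ => b2 p).add b5
  rw [expect_add hβ hα1 ((hf _).const_mul _) (((hf _).const_mul _).add b6),
    expect_add hβ hα1 ((hf _).const_mul _) b6,
    expect_add hβ hα1 (PolyBounded.sum (antidiagonal k) fun p _ => b2 p) b5,
    expect_add hβ hα1 (b3.const_mul _) b4, expect_const_mul, expect_const_mul, expect_const_mul,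
    expect_const_mul, expect_multiset_sum T hβ hα1 b1, expect_sum _ hβ hα1 fun p _ => b2 p,
    expect_add hβ hα1 ((hf _).const_mul _) ((hf _).const_mul _), expect_const_mul,
    expect_const_mul] at hE
  have c1 : ∀ r : ℕ, expect N β (αt * N * κ) (fun x => (r : ℝ) * (m (k + r) * f (T.erase r) x +
      1 / N * f ((k + r) ::ₘ T.erase r) x)) = r * (m (k + r) * correlator N β αt (T.erase r) +
        correlator N β αt ((k + r) ::ₘ T.erase r) / N) := by
    intro r
    rw [expect_const_mul, expect_add hβ hα1 ((hf _).const_mul _) ((hf _).const_mul _),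
      expect_const_mul, expect_const_mul, one_div_mul_eq_div]
    rfl
  have c2 : ∀ p : ℕ × ℕ, expect N β (αt * N * κ) (fun x => 2 * m p.1 * f (p.2 ::ₘ T) x +
      1 / N * f (p.1 ::ₘ p.2 ::ₘ T) x) = 2 * m p.1 * correlator N β αt (p.2 ::ₘ T) +
        correlator N β αt (p.1 ::ₘ p.2 ::ₘ T) / N := by
    intro p
    rw [expect_add hβ hα1 ((hf _).const_mul _) ((hf _).const_mul _),
      expect_const_mul, expect_const_mul, one_div_mul_eq_div]
    rfl
  simp_rw [c1, c2] at hE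
  have hE2 := (mul_eq_zero.1 hE).resolve_left (by positivity)
  change -1 * correlator N β αt ((k + 1) ::ₘ T) + (αt * correlator N β αt (k ::ₘ T) + (_ +
    (_ * (m k * correlator N β αt T + 1 / N * correlator N β αt (k ::ₘ T)) + _))) = 0 at hE2
  rw [one_div_mul_eq_div] at hE2
  linarith

lemma correlator_zero_cons (N : ℕ) (β αt : ℝ) (T : Multiset ℕ) :
    correlator N β αt (0 ::ₘ T) = 0 := by
  simp only [correlator, expect]
  simp [fluctuationProd_cons, fluctuation, limitMoment_zero]

lemma correlator_empty {N : ℕ} {β αt : ℝ} (hN : 0 < N) (hβ : 0 < β) (hα : 0 < αt) :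
    correlator N β αt 0 = 1 := by
  have hN' : (0 : ℝ) < N := by exact_mod_cast hN
  have := expect_one (N := N) hβ (show 0 < αt * N * (β / 2) by positivity)
  have h0 : fluctuationProd N (N * (β / 2)) αt 0 = fun _ => 1 := by
    funext x
    simp [fluctuationProd]
  rw [correlator, h0, this]

end

/-! ### A bound on the correlators -/

section

lemma limitMoment_nonneg {αt : ℝ} (hα : 0 < αt) (k : ℕ) : 0 ≤ limitMoment αt k := by
  induction k using Nat.strong_induction_on with
  | _ k ih =>
    rcases k with _ | k
    · simp [limitMoment_zero]
    · rw [limitMoment_succ]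
      refine add_nonneg (mul_nonneg hα.le (ih k (by omega))) (Finset.sum_nonneg fun p hp => ?_)
      have := mem_antidiagonal.1 hp
      exact mul_nonneg (ih _ (by omega)) (ih _ (by omega))

lemma sum_range_antidiagonal_le {g : ℕ → ℝ} (hg : ∀ k, 0 ≤ g k) (K : ℕ) :
    ∑ k ∈ Finset.range K, ∑ p ∈ antidiagonal k, g p.1 * g p.2 ≤ (∑ k ∈ Finset.range K, g k) ^ 2 := by
  rw [sq, Finset.sum_mul_sum, ← Finset.sum_product', ← Finset.sum_biUnion]
  · refine Finset.sum_le_sum_of_subset_of_nonneg (fun p hp => ?_) fun p _ _ =>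
      mul_nonneg (hg _) (hg _)
    simp only [Finset.mem_biUnion, Finset.mem_range, Finset.HasAntidiagonal.mem_antidiagonal] at hp
    obtain ⟨k, hk, h⟩ := hp
    simp only [Finset.mem_product, Finset.mem_range]
    omega
  · intro i _ j _ hij
    refine Finset.disjoint_left.2 fun p hp hq => hij ?_
    rw [← mem_antidiagonal.1 hp, ← mem_antidiagonal.1 hq]

/-- The generating function of the limiting moments stays below `2` well inside its disc of
convergence: the recursion maps partial sums bounded by `2` to partial sums bounded by `2`. -/
lemma sum_range_limitMoment_le {αt A : ℝ} (hα : 0 < αt) (hA : 2 * αt + 4 ≤ A) (K : ℕ) :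
    ∑ k ∈ Finset.range K, limitMoment αt k * A⁻¹ ^ k ≤ 2 := by
  have hA0 : 0 < A := by linarith
  induction K with
  | zero => simp
  | succ K ih =>
    set S := ∑ k ∈ Finset.range K, limitMoment αt k * A⁻¹ ^ k with hS
    have hS0 : 0 ≤ S := Finset.sum_nonneg fun k _ =>
      mul_nonneg (limitMoment_nonneg hα k) (by positivity)
    have h1 := sum_range_antidiagonal_le
      (fun k => mul_nonneg (limitMoment_nonneg hα k) (by positivity : 0 ≤ A⁻¹ ^ k)) K
    rw [Finset.sum_range_succ']
    have h2 : ∑ k ∈ Finset.range K, limitMoment αt (k + 1) * A⁻¹ ^ (k + 1) = A⁻¹ * (αt * S +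
        ∑ k ∈ Finset.range K, ∑ p ∈ antidiagonal k,
          (limitMoment αt p.1 * A⁻¹ ^ p.1) * (limitMoment αt p.2 * A⁻¹ ^ p.2)) := by
      rw [hS, Finset.mul_sum, ← Finset.sum_add_distrib, Finset.mul_sum]
      refine Finset.sum_congr rfl fun k _ => ?_
      have h3 : ∑ p ∈ antidiagonal k,
          (limitMoment αt p.1 * A⁻¹ ^ p.1) * (limitMoment αt p.2 * A⁻¹ ^ p.2) =
          (∑ p ∈ antidiagonal k, limitMoment αt p.1 * limitMoment αt p.2) * A⁻¹ ^ k := by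
        rw [Finset.sum_mul]
        refine Finset.sum_congr rfl fun p hp => ?_
        rw [← mem_antidiagonal.1 hp, pow_add]
        ring
      rw [h3, limitMoment_succ, pow_succ]
      ring
    rw [h2, limitMoment_zero, pow_zero, mul_one]
    have h4 : A⁻¹ * (αt * S + ∑ k ∈ Finset.range K, ∑ p ∈ antidiagonal k,
          (limitMoment αt p.1 * A⁻¹ ^ p.1) * (limitMoment αt p.2 * A⁻¹ ^ p.2)) ≤ 1 := by
      rw [inv_mul_le_iff₀ hA0]
      nlinarith
    linarith

lemma sum_antidiagonal_limitMoment_le {αt A : ℝ} (hα : 0 < αt) (hA : 2 * αt + 4 ≤ A) (k : ℕ) :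
    ∑ p ∈ antidiagonal k, limitMoment αt p.1 * A ^ p.2 ≤ 2 * A ^ k := by
  have hA0 : 0 < A := by linarith
  have h := sum_range_limitMoment_le hα hA (k + 1)
  have h2 : ∑ p ∈ antidiagonal k, limitMoment αt p.1 * A ^ p.2 =
      (∑ i ∈ Finset.range (k + 1), limitMoment αt i * A⁻¹ ^ i) * A ^ k := by
    rw [Finset.Nat.sum_antidiagonal_eq_sum_range_succ (fun i j => limitMoment αt i * A ^ j),
      Finset.sum_mul]
    refine Finset.sum_congr rfl fun i hi => ?_
    have hik : i ≤ k := by simpa [Nat.lt_succ_iff] using hi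
    rw [mul_assoc]
    congr 1
    rw [inv_pow, ← div_eq_inv_mul, eq_div_iff (by positivity), ← pow_add, Nat.sub_add_cancel hik]
  rw [h2]
  gcongr

lemma limitMoment_le {αt A : ℝ} (hα : 0 < αt) (hA : 2 * αt + 4 ≤ A) (k : ℕ) :
    limitMoment αt k ≤ 2 * A ^ k := by
  have hA0 : 0 < A := by linarith
  refine le_trans ?_ (sum_antidiagonal_limitMoment_le hα hA k)
  have h0 : ∀ p ∈ antidiagonal k, 0 ≤ limitMoment αt p.1 * A ^ p.2 := fun p _ =>
    mul_nonneg (limitMoment_nonneg hα _) (by positivity)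
  simpa using Finset.single_le_sum h0 (show (k, 0) ∈ antidiagonal k by simp [Finset.HasAntidiagonal.mem_antidiagonal])

lemma succ_mul_limitMoment_le {αt A : ℝ} (hα : 0 < αt) (hA : 4 * αt + 8 ≤ A) (k : ℕ) :
    (k + 1) * limitMoment αt k ≤ 2 * A ^ k := by
  have h1 := limitMoment_le hα (show 2 * αt + 4 ≤ A / 2 by linarith) k
  have h2 : (k : ℝ) + 1 ≤ 2 ^ k := by exact_mod_cast Nat.lt_two_pow_self (n := k)
  calc (k + 1) * limitMoment αt k ≤ 2 ^ k * (2 * (A / 2) ^ k) := by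
        gcongr
        exact limitMoment_nonneg hα k
    _ = 2 * A ^ k := by rw [div_pow]; field_simp

/-- Exponential bounds propagate through the linearised loop equation
`vₖ₊₁ = α̃ vₖ + 2 ∑ᵢ mᵢ vₖ₋ᵢ + (source)`. -/
lemma abs_le_of_linear_recursion {αt P δ : ℝ} (hα : 0 < αt) (hP : 2 * αt + 5 ≤ P) (hδ : 0 ≤ δ)
    {v s : ℕ → ℝ} {L : ℕ} (h0 : |v 0| ≤ δ) (hs : ∀ k < L, |s k| ≤ δ * P ^ k)
    (hv : ∀ k < L, v (k + 1) = αt * v k +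
      2 * ∑ p ∈ antidiagonal k, limitMoment αt p.1 * v p.2 + s k) :
    ∀ k ≤ L, |v k| ≤ δ * P ^ k := by
  have hP0 : 0 < P := by linarith
  intro k
  induction k using Nat.strong_induction_on with
  | _ k ih =>
    intro hk
    rcases k with _ | k
    · simpa using h0
    · rw [hv k hk]
      have h1 : |∑ p ∈ antidiagonal k, limitMoment αt p.1 * v p.2| ≤ δ * (2 * P ^ k) := by
        refine (Finset.abs_sum_le_sum_abs _ _).trans ?_
        calc ∑ p ∈ antidiagonal k, |limitMoment αt p.1 * v p.2|
            ≤ ∑ p ∈ antidiagonal k, δ * (limitMoment αt p.1 * P ^ p.2) := by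
              refine Finset.sum_le_sum fun p hp => ?_
              have := mem_antidiagonal.1 hp
              rw [abs_mul, abs_of_nonneg (limitMoment_nonneg hα _), mul_left_comm]
              exact mul_le_mul_of_nonneg_left (ih _ (by omega) (by omega))
                (limitMoment_nonneg hα _)
          _ ≤ δ * (2 * P ^ k) := by
              rw [← Finset.mul_sum]
              exact mul_le_mul_of_nonneg_left
                (sum_antidiagonal_limitMoment_le hα (by linarith) k) hδ
      have h2 := ih k (by omega) (by omega)
      calc |αt * v k + 2 * ∑ p ∈ antidiagonal k, limitMoment αt p.1 * v p.2 + s k|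
          ≤ αt * |v k| + 2 * |∑ p ∈ antidiagonal k, limitMoment αt p.1 * v p.2| + |s k| := by
            refine (abs_add_le _ _).trans (add_le_add ((abs_add_le _ _).trans ?_) le_rfl)
            rw [abs_mul, abs_mul, abs_of_pos hα, abs_of_pos (two_pos : (0 : ℝ) < 2)]
        _ ≤ αt * (δ * P ^ k) + 2 * (δ * (2 * P ^ k)) + δ * P ^ k := by
            gcongr
            exact hs k hk
        _ = (αt + 5) * (δ * P ^ k) := by ring
        _ ≤ P * (δ * P ^ k) := by gcongr; linarith
        _ = _ := by ring

/-- The exponential rate at which the correlators of fluctuations are controlled. -/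
def growthRate (β αt : ℝ) : ℝ := 4 * αt + 8 + 3 * |1 / (β / 2) - 1| + 3 * (1 / (β / 2))

lemma growthRate_ge {β αt : ℝ} (hβ : 0 < β) : 4 * αt + 8 ≤ growthRate β αt := by
  unfold growthRate
  have : 0 < 1 / (β / 2) := by positivity
  linarith [abs_nonneg (1 / (β / 2) - 1)]

/-- The correlators of fluctuations are bounded uniformly in `N`, as long as their total degree is
at most of order `√N`. -/
theorem abs_correlator_le {N : ℕ} {β αt : ℝ} (hN : 0 < N) (hβ : 0 < β) (hα : 0 < αt)
    (T : Multiset ℕ) (hT : (T.sum + 2) ^ 2 ≤ N) :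
    |correlator N β αt T| ≤ (T.card).factorial * growthRate β αt ^ T.sum := by
  induction hd : T.sum using Nat.strong_induction_on generalizing T with
  | _ d ih =>
  set A := growthRate β αt with hA
  have hA8 := growthRate_ge (αt := αt) hβ
  rw [← hA] at hA8
  have hA0 : 0 < A := by linarith
  have hN' : (0 : ℝ) < N := by exact_mod_cast hN
  -- The fluctuation of degree zero vanishes, so all factors may be taken of positive degree; then
  -- their number is at most the total degree.
  by_cases hz : 0 ∈ T
  · obtain ⟨S, rfl⟩ := Multiset.exists_cons_of_mem hz
    rw [correlator_zero_cons, abs_zero]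
    positivity
  induction T using Multiset.induction_on with
  | empty =>
    rw [correlator_empty hN hβ hα]
    simp at hd
    simp [← hd]
  | cons a S _ =>
  obtain ⟨k, rfl⟩ : ∃ k, a = k + 1 :=
    Nat.exists_eq_succ_of_ne_zero fun h => hz (by simp [h])
  have hpos : ∀ r ∈ S, 1 ≤ r := fun r hr => Nat.one_le_iff_ne_zero.2 fun h =>
    hz (by rw [← h]; exact Multiset.mem_cons_of_mem hr)
  have hcard : S.card ≤ S.sum := by
    simpa using Multiset.card_nsmul_le_sum hpos
  simp only [Multiset.sum_cons] at hd hT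
  set c := S.card with hc
  set n := S.sum with hn
  have hsq : ∀ e, e ≤ k + n → (e + 2) ^ 2 ≤ N := fun e he =>
    le_trans (Nat.pow_le_pow_left (by omega) 2) hT
  have hb : ∀ U : Multiset ℕ, U.sum ≤ k + n →
      |correlator N β αt U| ≤ (U.card).factorial * A ^ U.sum := fun U hU =>
    ih U.sum (by omega) U (hsq _ hU) rfl
  have hNd : ((k : ℝ) + n + 3) ^ 2 ≤ N := by
    have : (k + 1 + n + 2) ^ 2 ≤ N := hT
    calc ((k : ℝ) + n + 3) ^ 2 = (((k + 1 + n + 2) ^ 2 : ℕ) : ℝ) := by push_cast; ring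
      _ ≤ N := by exact_mod_cast this
  have hk0 : (0 : ℝ) ≤ k := k.cast_nonneg
  have hn0 : (0 : ℝ) ≤ n := n.cast_nonneg
  have hc0 : (0 : ℝ) ≤ c := c.cast_nonneg
  have hcn : (c : ℝ) ≤ n := by exact_mod_cast hcard
  set η := 1 / (β / 2) - 1 with hη
  have hκ : 0 < 1 / (β / 2) := by positivity
  -- Each term on the right of the loop equation is at most a multiple of `Q`, and `A` is chosen to
  -- exceed the sum of the multiples.
  set Q : ℝ := ((c + 1).factorial : ℝ) * A ^ (k + n) with hQ
  have hQ0 : 0 < Q := by positivity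
  have hfac : ((c.factorial : ℕ) : ℝ) ≤ (c + 1).factorial := by
    exact_mod_cast Nat.factorial_le (Nat.le_succ c)
  have t1 : |correlator N β αt (k ::ₘ S)| ≤ Q := by
    simpa [hQ, ← hc, ← hn] using hb (k ::ₘ S) (by simp [← hn])
  -- Splitting `Y k` in two raises the factorial by `c + 2`; with the `k + 1` terms of the sum this
  -- is absorbed by the prefactor `1 / N`, the square of the degree being at most `N`.
  have t2 : |∑ p ∈ antidiagonal k, (2 * limitMoment αt p.1 * correlator N β αt (p.2 ::ₘ S) +
        correlator N β αt (p.1 ::ₘ p.2 ::ₘ S) / N)| ≤ 5 * Q := by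
    refine (Finset.abs_sum_le_sum_abs _ _).trans ?_
    calc _ ≤ ∑ p ∈ antidiagonal k, (2 * (limitMoment αt p.1 * A ^ p.2) *
          ((c + 1).factorial * A ^ n) + (c + 2).factorial * A ^ (k + n) / N) := by
          refine Finset.sum_le_sum fun p hp => (abs_add_le _ _).trans ?_
          have hp' := mem_antidiagonal.1 hp
          have m0 := limitMoment_nonneg hα p.1
          have e1 : |correlator N β αt (p.2 ::ₘ S)| ≤ (c + 1).factorial * A ^ (p.2 + n) := by
            simpa [← hc, ← hn] using hb (p.2 ::ₘ S) (by simp [← hn]; omega)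
          have e2 : |correlator N β αt (p.1 ::ₘ p.2 ::ₘ S)| ≤
              (c + 2).factorial * A ^ (k + n) := by
            have := hb (p.1 ::ₘ p.2 ::ₘ S) (by simp [← hn]; omega)
            simpa [← hc, ← hn, ← add_assoc, hp'] using this
          rw [abs_mul, abs_div, abs_of_nonneg (show 0 ≤ 2 * limitMoment αt p.1 by positivity),
            Nat.abs_cast]
          refine add_le_add ?_ (div_le_div_of_nonneg_right e2 hN'.le)
          calc _ ≤ 2 * limitMoment αt p.1 * ((c + 1).factorial * A ^ (p.2 + n)) := by gcongr
            _ = _ := by rw [pow_add]; ring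
      _ = 2 * (∑ p ∈ antidiagonal k, limitMoment αt p.1 * A ^ p.2) *
          ((c + 1).factorial * A ^ n) + (k + 1) * ((c + 2).factorial * A ^ (k + n) / N) := by
          rw [Finset.sum_add_distrib, ← Finset.sum_mul, ← Finset.mul_sum]
          simp
      _ ≤ 2 * (2 * A ^ k) * ((c + 1).factorial * A ^ n) + Q := by
          refine add_le_add ?_ ?_
          · gcongr
            exact sum_antidiagonal_limitMoment_le hα (by linarith) k
          · rw [hQ, Nat.factorial_succ (c + 1), mul_div_assoc', div_le_iff₀ hN']
            push_cast
            have : ((k : ℝ) + 1) * (c + 1 + 1) ≤ N := by nlinarith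
            calc _ = (((k : ℝ) + 1) * (c + 1 + 1)) * ((c + 1).factorial * A ^ (k + n)) := by ring
              _ ≤ N * ((c + 1).factorial * A ^ (k + n)) := by gcongr
              _ = _ := by ring
      _ = 5 * Q := by rw [hQ, pow_add]; ring
  have t3 : |(k + 1) * (limitMoment αt k * correlator N β αt S +
      correlator N β αt (k ::ₘ S) / N)| ≤ 3 * Q := by
    have e1 : |correlator N β αt S| ≤ (c + 1).factorial * A ^ n := by
      refine (hb S (by omega)).trans ?_
      rw [← hc, ← hn]
      gcongr
    have m1 := succ_mul_limitMoment_le hα hA8 k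
    have m0 := limitMoment_nonneg hα k
    rw [mul_add]
    refine (abs_add_le _ _).trans ?_
    rw [← mul_assoc, abs_mul, abs_of_nonneg (show 0 ≤ (k + 1) * limitMoment αt k by positivity),
      abs_mul, abs_div, Nat.abs_cast, abs_of_nonneg (show (0 : ℝ) ≤ k + 1 by positivity)]
    have e2 : ((k : ℝ) + 1) * (|correlator N β αt (k ::ₘ S)| / N) ≤ Q := by
      rw [mul_div_assoc', div_le_iff₀ hN', mul_comm]
      gcongr
      nlinarith
    calc _ ≤ (2 * A ^ k) * ((c + 1).factorial * A ^ n) + Q := by gcongr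
      _ = 3 * Q := by rw [hQ, pow_add]; ring
  -- Contraction with one of the `c` other factors leaves `c - 1` of them, and `c * (c - 1)! = c!`.
  have t4 : |(S.map fun r => r * (limitMoment αt (k + r) * correlator N β αt (S.erase r) +
        correlator N β αt ((k + r) ::ₘ S.erase r) / N)).sum| ≤ 3 * Q := by
    refine (Multiset.abs_sum_le_sum_abs (s := S.map _)).trans ?_
    rw [Multiset.map_map]
    calc _ ≤ (S.map fun r : ℕ => 2 * (c - 1).factorial * A ^ (k + n) +
          (r : ℝ) * (c.factorial * A ^ (k + n) / N)).sum := by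
          refine Multiset.sum_map_le_sum_map _ _ fun r hr => ?_
          have hrn : r + (S.erase r).sum = n := by
            rw [← Multiset.sum_cons, Multiset.cons_erase hr]
          have hrc : (S.erase r).card = c - 1 := Multiset.card_erase_of_mem hr
          have hc1 : 1 ≤ c := Multiset.card_pos_iff_exists_mem.2 ⟨r, hr⟩
          have e1 := hb (S.erase r) (by omega)
          have e2 := hb ((k + r) ::ₘ S.erase r) (by simp only [Multiset.sum_cons]; omega)
          rw [hrc] at e1
          simp only [Multiset.card_cons, Multiset.sum_cons, hrc, add_assoc, hrn] at e2
          rw [Nat.sub_add_cancel hc1] at e2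
          have m1 : (r : ℝ) * limitMoment αt (k + r) ≤ 2 * A ^ (k + r) := by
            refine le_trans ?_ (succ_mul_limitMoment_le hα hA8 (k + r))
            have := limitMoment_nonneg hα (k + r)
            gcongr
            push_cast
            linarith
          have m0 := limitMoment_nonneg hα (k + r)
          simp only [Function.comp]
          rw [mul_add]
          refine (abs_add_le _ _).trans (add_le_add ?_ ?_)
          · rw [← mul_assoc, abs_mul,
              abs_of_nonneg (show 0 ≤ (r : ℝ) * limitMoment αt (k + r) by positivity)]
            calc _ ≤ (2 * A ^ (k + r)) * ((c - 1).factorial * A ^ (S.erase r).sum) := by gcongr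
              _ = _ := by rw [← hrn, ← add_assoc, pow_add A (k + r)]; ring
          · rw [abs_mul, abs_div, Nat.abs_cast, Nat.abs_cast]
            gcongr
      _ = c * (2 * (c - 1).factorial * A ^ (k + n)) + n * (c.factorial * A ^ (k + n) / N) := by
          have e : (S.map fun r : ℕ => (r : ℝ)).sum = n := (Nat.cast_multiset_sum S).symm
          rw [Multiset.sum_map_add, Multiset.sum_map_mul_right (f := fun r : ℕ => (r : ℝ)), e,
            Multiset.map_const', Multiset.sum_replicate, nsmul_eq_mul]
      _ ≤ 2 * Q + Q := by
          refine add_le_add ?_ ?_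
          · have : (c : ℝ) * (c - 1).factorial ≤ (c + 1).factorial := by
              rcases Nat.eq_zero_or_pos c with h | h
              · simp [h]
              · exact_mod_cast (Nat.mul_factorial_pred h.ne').le.trans
                  (Nat.factorial_le (Nat.le_succ c))
            calc _ = 2 * ((c : ℝ) * (c - 1).factorial) * A ^ (k + n) := by ring
              _ ≤ 2 * ((c + 1).factorial : ℝ) * A ^ (k + n) := by gcongr
              _ = _ := by rw [hQ]; ring
          · rw [mul_div_assoc', div_le_iff₀ hN', hQ, mul_comm]
            gcongr
            nlinarith
      _ = 3 * Q := by ring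
  rw [correlator_cons_succ hN hβ hα, ← hd]
  simp only [Multiset.card_cons, ← hc]
  calc _ ≤ αt * |correlator N β αt (k ::ₘ S)| + 5 * Q + |η| * (3 * Q) + 1 / (β / 2) * (3 * Q) := by
        refine (abs_add_le _ _).trans (add_le_add ((abs_add_le _ _).trans (add_le_add
          ((abs_add_le _ _).trans (add_le_add ?_ t2)) ?_)) ?_)
        · rw [abs_mul, abs_of_pos hα]
        · rw [mul_assoc, abs_mul]
          gcongr
        · rw [abs_mul, abs_of_pos hκ]
          gcongr
    _ ≤ αt * Q + 5 * Q + |η| * (3 * Q) + 1 / (β / 2) * (3 * Q) := by gcongr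
    _ = (αt + 5 + 3 * |η| + 3 * (1 / (β / 2))) * Q := by ring
    _ ≤ A * Q := by
        gcongr
        rw [hA, growthRate, hη]
        linarith
    _ = _ := by rw [hQ, show k + 1 + n = (k + n) + 1 by ring, pow_succ]; ring

end

/-! ### The formal expansion of the resolvent -/

section

open PowerSeries

/-- The generating function of the limiting moments, as a formal power series in `1 / s`. -/
def momentSeries (αt : ℝ) : ℝ⟦X⟧ := PowerSeries.mk (limitMoment αt)

/-- The formal power series in `1 / s` of `√((s - a)(s - b)) / s`, the coefficient of the unknown
in the linearised loop equation. -/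
def rootSeries (αt : ℝ) : ℝ⟦X⟧ := 1 - C αt * X - 2 * (X * momentSeries αt)

/-- The series of the first correction to the moments. -/
def firstSeries (η αt : ℝ) : ℝ⟦X⟧ :=
  C η * X * derivative ℝ (X * momentSeries αt) * (rootSeries αt)⁻¹

/-- The diagonal of the limiting two-point correlator of fluctuations. -/
def pairSeries (η ι αt : ℝ) : ℝ⟦X⟧ :=
  (C η * X * derivative ℝ (X * momentSeries αt) * firstSeries η αt +
    C (ι / 2) * X ^ 2 * derivative ℝ (derivative ℝ (X * momentSeries αt))) * (rootSeries αt)⁻¹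

/-- The series of the second correction to the moments. -/
def secondSeries (η ι αt : ℝ) : ℝ⟦X⟧ :=
  (X * pairSeries η ι αt + C η * X * derivative ℝ (X * firstSeries η αt)) * (rootSeries αt)⁻¹

lemma momentSeries_eq (αt : ℝ) :
    momentSeries αt = 1 + C αt * (X * momentSeries αt) + X * momentSeries αt ^ 2 := by
  ext k
  rcases k with _ | k
  · simp [momentSeries, limitMoment_zero]
  · rw [map_add, map_add, coeff_C_mul, coeff_succ_X_mul, coeff_succ_X_mul, sq, coeff_mul, coeff_one,
      if_neg (Nat.succ_ne_zero k)]
    simp only [momentSeries, coeff_mk]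
    rw [limitMoment_succ, zero_add]

lemma rootSeries_mul_inv (αt : ℝ) : rootSeries αt * (rootSeries αt)⁻¹ = 1 := by
  refine PowerSeries.mul_inv_cancel _ ?_
  simp [rootSeries]

lemma firstSeries_mul (η αt : ℝ) : firstSeries η αt * rootSeries αt =
    C η * X * derivative ℝ (X * momentSeries αt) := by
  rw [firstSeries, mul_assoc, mul_comm _⁻¹, rootSeries_mul_inv, mul_one]

lemma pairSeries_mul (η ι αt : ℝ) : pairSeries η ι αt * rootSeries αt =
    C η * X * derivative ℝ (X * momentSeries αt) * firstSeries η αt +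
    C (ι / 2) * X ^ 2 * derivative ℝ (derivative ℝ (X * momentSeries αt)) := by
  rw [pairSeries, mul_assoc, mul_comm _⁻¹, rootSeries_mul_inv, mul_one]

lemma secondSeries_mul (η ι αt : ℝ) : secondSeries η ι αt * rootSeries αt =
    X * pairSeries η ι αt + C η * X * derivative ℝ (X * firstSeries η αt) := by
  rw [secondSeries, mul_assoc, mul_comm _⁻¹, rootSeries_mul_inv, mul_one]

/-- A series `F` with `F Δ = X S` has coefficients that solve the linearised loop equation with
source `S`. -/
lemma coeff_zero_of_mul_rootSeries {αt : ℝ} {F S : ℝ⟦X⟧} (h : F * rootSeries αt = X * S) :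
    coeff 0 F = 0 := by
  have := congrArg (coeff 0) h
  simpa [rootSeries, coeff_zero_X_mul] using this

lemma coeff_succ_of_mul_rootSeries {αt : ℝ} {F S : ℝ⟦X⟧} (h : F * rootSeries αt = X * S) (k : ℕ) :
    coeff (k + 1) F = αt * coeff k F +
      2 * ∑ p ∈ antidiagonal k, limitMoment αt p.1 * coeff p.2 F + coeff k S := by
  have h1 : F = X * (C αt * F + C 2 * (momentSeries αt * F) + S) := by
    have : (C 2 : ℝ⟦X⟧) = 2 := map_ofNat _ 2
    rw [this]
    rw [rootSeries] at h
    linear_combination h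
  have h2 := congrArg (coeff (k + 1)) h1
  rw [coeff_succ_X_mul] at h2
  rw [h2]
  rw [map_add, map_add, coeff_C_mul, coeff_C_mul, coeff_mul]
  simp only [momentSeries, coeff_mk]

lemma coeff_derivative_X_mul (f : ℝ⟦X⟧) (k : ℕ) :
    coeff k (derivative ℝ (X * f)) = (k + 1) * coeff k f := by
  rw [coeff_derivative, coeff_succ_X_mul, mul_comm]

lemma coeff_X_mul_derivative_derivative (f : ℝ⟦X⟧) (k : ℕ) :
    coeff k (X * derivative ℝ (derivative ℝ (X * f))) = k * (k + 1) * coeff k f := by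
  rcases k with _ | k
  · simp [coeff_zero_X_mul]
  · rw [coeff_succ_X_mul, coeff_derivative, coeff_derivative_X_mul]
    push_cast
    ring

section recursion

variable (η ι αt : ℝ)

lemma firstSeries_zero : coeff 0 (firstSeries η αt) = 0 :=
  coeff_zero_of_mul_rootSeries (S := C η * derivative ℝ (X * momentSeries αt))
    (by rw [firstSeries_mul]; ring)

lemma firstSeries_succ (k : ℕ) : coeff (k + 1) (firstSeries η αt) = αt * coeff k (firstSeries η αt) +
    2 * ∑ p ∈ antidiagonal k, limitMoment αt p.1 * coeff p.2 (firstSeries η αt) +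
      η * ((k + 1) * limitMoment αt k) := by
  rw [coeff_succ_of_mul_rootSeries (S := C η * derivative ℝ (X * momentSeries αt))
    (by rw [firstSeries_mul]; ring), coeff_C_mul, coeff_derivative_X_mul]
  simp [momentSeries]

lemma pairSeries_eq_X_mul : pairSeries η ι αt * rootSeries αt = X * (C η *
    (derivative ℝ (X * momentSeries αt) * firstSeries η αt) +
      C (ι / 2) * (X * derivative ℝ (derivative ℝ (X * momentSeries αt)))) := by
  rw [pairSeries_mul]
  ring

lemma pairSeries_zero : coeff 0 (pairSeries η ι αt) = 0 :=
  coeff_zero_of_mul_rootSeries (pairSeries_eq_X_mul η ι αt)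

lemma pairSeries_succ (k : ℕ) : coeff (k + 1) (pairSeries η ι αt) =
    αt * coeff k (pairSeries η ι αt) +
    2 * ∑ p ∈ antidiagonal k, limitMoment αt p.1 * coeff p.2 (pairSeries η ι αt) +
      (η * ∑ p ∈ antidiagonal k, (p.1 + 1) * limitMoment αt p.1 * coeff p.2 (firstSeries η αt) +
        ι / 2 * (k * (k + 1) * limitMoment αt k)) := by
  rw [coeff_succ_of_mul_rootSeries (pairSeries_eq_X_mul η ι αt), map_add, coeff_C_mul, coeff_C_mul,
    coeff_X_mul_derivative_derivative, coeff_mul]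
  simp only [coeff_derivative_X_mul]
  simp [momentSeries]

lemma secondSeries_eq_X_mul : secondSeries η ι αt * rootSeries αt = X * (pairSeries η ι αt +
    C η * derivative ℝ (X * firstSeries η αt)) := by
  rw [secondSeries_mul]
  ring

lemma secondSeries_zero : coeff 0 (secondSeries η ι αt) = 0 :=
  coeff_zero_of_mul_rootSeries (secondSeries_eq_X_mul η ι αt)

lemma secondSeries_succ (k : ℕ) : coeff (k + 1) (secondSeries η ι αt) =
    αt * coeff k (secondSeries η ι αt) +
    2 * ∑ p ∈ antidiagonal k, limitMoment αt p.1 * coeff p.2 (secondSeries η ι αt) +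
      (coeff k (pairSeries η ι αt) + η * ((k + 1) * coeff k (firstSeries η αt))) := by
  rw [coeff_succ_of_mul_rootSeries (secondSeries_eq_X_mul η ι αt), map_add, coeff_C_mul,
    coeff_derivative_X_mul]

end recursion

/-! ### Formal identities -/

lemma rootSeries_sq (αt : ℝ) : rootSeries αt ^ 2 = (1 - C αt * X) ^ 2 - 4 * X := by
  have h := momentSeries_eq αt
  rw [rootSeries]
  linear_combination (-4 * X) * h

lemma X_mul_momentSeries_eq (αt : ℝ) : X * momentSeries αt =
    X + C αt * X * (X * momentSeries αt) + (X * momentSeries αt) ^ 2 := by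
  have h := momentSeries_eq αt
  linear_combination X * h

lemma derivative_mul_rootSeries (αt : ℝ) : derivative ℝ (X * momentSeries αt) * rootSeries αt =
    1 + C αt * (X * momentSeries αt) := by
  have h := congrArg (derivative ℝ) (X_mul_momentSeries_eq αt)
  rw [rootSeries]
  generalize X * momentSeries αt = w at h ⊢
  simp only [map_add, Derivation.leibniz, derivative_X, smul_eq_mul, derivative_C, sq] at h
  linear_combination h

lemma derivative_derivative_mul_rootSeries (αt : ℝ) :
    derivative ℝ (derivative ℝ (X * momentSeries αt)) * rootSeries αt =
    2 * C αt * derivative ℝ (X * momentSeries αt) +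
      2 * derivative ℝ (X * momentSeries αt) ^ 2 := by
  have h := congrArg (derivative ℝ) (derivative_mul_rootSeries αt)
  rw [rootSeries] at h ⊢
  have h2 : (2 : ℝ⟦X⟧) = C 2 := (map_ofNat _ 2).symm
  rw [h2] at h ⊢
  generalize X * momentSeries αt = w at h ⊢
  simp only [map_add, map_sub, Derivation.leibniz, derivative_X, smul_eq_mul, derivative_C,
    PowerSeries.derivative_one] at h
  rw [← h2] at h ⊢
  linear_combination h

lemma firstSeries_mul_sq (η αt : ℝ) : firstSeries η αt * rootSeries αt ^ 2 =
    C η * X * (1 + C αt * (X * momentSeries αt)) := by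
  linear_combination rootSeries αt * firstSeries_mul η αt +
    C η * X * derivative_mul_rootSeries αt

lemma derivative_firstSeries_mul (η αt : ℝ) :
    derivative ℝ (firstSeries η αt) * rootSeries αt = C η * derivative ℝ (X * momentSeries αt) +
      C η * X * derivative ℝ (derivative ℝ (X * momentSeries αt)) +
      firstSeries η αt * (C αt + 2 * derivative ℝ (X * momentSeries αt)) := by
  have h := congrArg (derivative ℝ) (firstSeries_mul η αt)
  rw [rootSeries] at h ⊢
  have h2 : (2 : ℝ⟦X⟧) = C 2 := (map_ofNat _ 2).symm
  rw [h2] at h ⊢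
  generalize X * momentSeries αt = w at h ⊢
  simp only [map_sub, Derivation.leibniz, derivative_X, smul_eq_mul, derivative_C,
    PowerSeries.derivative_one] at h
  rw [← h2] at h ⊢
  linear_combination h

/-- The closed form of the second correction. Multiplication by powers of the root series
eliminates all derivatives, and what remains is the quadratic equation of the root. -/
lemma secondSeries_mul_pow (η ι αt : ℝ) : secondSeries η ι αt * rootSeries αt ^ 5 =
    C (ι + 5 * η ^ 2) * C (αt + 1) * X ^ 3 + C (η ^ 2) * X ^ 2 * (C (αt + 2) * rootSeries αt ^ 2 -
      C αt * (1 - C (αt + 2) * X) * rootSeries αt) := by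
  have hW := X_mul_momentSeries_eq αt
  have hu := derivative_mul_rootSeries αt
  have hD' := derivative_derivative_mul_rootSeries αt
  have hE' := derivative_firstSeries_mul η αt
  have s2 := firstSeries_mul_sq η αt
  have hG := pairSeries_mul η ι αt
  have hH := secondSeries_mul η ι αt
  have hXE : derivative ℝ (X * firstSeries η αt) =
      firstSeries η αt + X * derivative ℝ (firstSeries η αt) := by
    simp only [Derivation.leibniz, derivative_X, smul_eq_mul]
    ring
  rw [hXE] at hH
  have c1 : C (ι + 5 * η ^ 2) = 2 * C (ι / 2) + 5 * (C η : ℝ⟦X⟧) ^ 2 := by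
    have h2 : (2 : ℝ⟦X⟧) = C 2 := (map_ofNat _ 2).symm
    have h5 : (5 : ℝ⟦X⟧) = C 5 := (map_ofNat _ 5).symm
    rw [h2, h5, ← map_mul, ← map_pow, ← map_mul, ← map_add]
    congr 1
    ring
  have c2 : C (αt + 1) = (C αt : ℝ⟦X⟧) + 1 := by simp
  have c3 : C (αt + 2) = (C αt : ℝ⟦X⟧) + 2 := by rw [map_add, map_ofNat]
  have c4 : C (η ^ 2) = (C η : ℝ⟦X⟧) ^ 2 := map_pow _ _ _
  rw [c1, c2, c3, c4]
  have hΔ : rootSeries αt = 1 - C αt * X - 2 * (X * momentSeries αt) := rfl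
  -- All series are now treated as independent variables related by the equations above: `s1` to
  -- `s5` successively remove the derivatives and the lower corrections, and `f1`, `f2` use the
  -- quadratic equation of `w`.
  generalize X * momentSeries αt = w at *
  generalize secondSeries η ι αt = H at *
  generalize pairSeries η ι αt = G at *
  generalize derivative ℝ (firstSeries η αt) = E' at *
  generalize firstSeries η αt = E at *
  generalize derivative ℝ (derivative ℝ w) = D' at *
  generalize derivative ℝ w = D at *
  generalize rootSeries αt = Δ at *
  generalize (C αt : ℝ⟦X⟧) = a at *
  generalize (C η : ℝ⟦X⟧) = e at *
  generalize (C (ι / 2) : ℝ⟦X⟧) = J at *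
  generalize (X : ℝ⟦X⟧) = z at *
  obtain ⟨u, hu'⟩ : ∃ u, u = 1 + a * w := ⟨_, rfl⟩
  rw [← hu'] at hu s2
  have s1 : D' * Δ ^ 3 = 2 * a * u * Δ + 2 * u ^ 2 := by
    linear_combination Δ ^ 2 * hD' + (2 * a * Δ + 2 * D * Δ + 2 * u) * hu
  have s3 : E' * Δ ^ 4 = e * u * Δ ^ 2 + e * z * (2 * a * u * Δ + 2 * u ^ 2) +
      e * z * u * (a * Δ + 2 * u) := by
    linear_combination Δ ^ 3 * hE' + e * Δ ^ 2 * hu + e * z * s1 + (a * Δ + 2 * D * Δ) * s2 +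
      2 * e * z * u * hu
  have s4 : G * Δ ^ 4 = e ^ 2 * z ^ 2 * u ^ 2 + J * z ^ 2 * (2 * a * u * Δ + 2 * u ^ 2) := by
    linear_combination Δ ^ 3 * hG + e * z * E * Δ ^ 2 * hu + e * z * u * s2 + J * z ^ 2 * s1
  have s5 : H * Δ ^ 5 = z * (e ^ 2 * z ^ 2 * u ^ 2 + J * z ^ 2 * (2 * a * u * Δ + 2 * u ^ 2)) +
      e ^ 2 * z ^ 2 * u * Δ ^ 2 + e * z ^ 2 * (e * u * Δ ^ 2 +
        e * z * (2 * a * u * Δ + 2 * u ^ 2) + e * z * u * (a * Δ + 2 * u)) := by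
    linear_combination Δ ^ 4 * hH + z * s4 + e * z * Δ ^ 2 * s2 + e * z ^ 2 * s3
  have f1 : u * (a * Δ + u) = a + 1 := by
    rw [hu', hΔ]
    linear_combination a ^ 2 * hW
  have f2 : (a + 2) * Δ - a * (1 - (a + 2) * z) = 2 * u * (Δ - a * z) := by
    rw [hu', hΔ]
    linear_combination (-4 * a) * hW
  linear_combination s5 + (2 * J + 5 * e ^ 2) * z ^ 3 * f1 - e ^ 2 * z ^ 2 * Δ * f2

end

/-! ### Convergence of the correlators -/

section

open PowerSeries

lemma succ_mul_pow_le {P : ℝ} (hP : 0 ≤ P) (k : ℕ) : (k + 1) * P ^ k ≤ (2 * P) ^ k := by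
  have h2 : (k : ℝ) + 1 ≤ 2 ^ k := by exact_mod_cast Nat.lt_two_pow_self (n := k)
  rw [mul_pow]
  gcongr

lemma sum_antidiagonal_pow (P : ℝ) (k : ℕ) :
    ∑ p ∈ antidiagonal k, P ^ p.1 * P ^ p.2 = (k + 1) * P ^ k := by
  have : ∀ p ∈ antidiagonal k, P ^ p.1 * P ^ p.2 = P ^ k := fun p hp => by
    rw [← pow_add, mem_antidiagonal.1 hp]
  rw [Finset.sum_congr rfl this]
  simp

lemma sum_antidiagonal_snd (n : ℕ) : ∑ p ∈ antidiagonal n, (p.2 : ℝ) = n * (n + 1) / 2 := by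
  rw [← Finset.Nat.sum_antidiagonal_swap]
  simp only [Prod.snd_swap]
  rw [Finset.Nat.sum_antidiagonal_eq_sum_range_succ (fun i _ => (i : ℝ))]
  induction n with
  | zero => simp
  | succ n ih =>
    rw [Finset.sum_range_succ, ih]
    push_cast
    ring

lemma sum_antidiagonal_assoc (n : ℕ) (m : ℕ → ℝ) (c : ℕ → ℕ → ℝ) :
    ∑ p ∈ antidiagonal n, ∑ q ∈ antidiagonal p.1, m q.1 * c q.2 p.2 =
      ∑ p ∈ antidiagonal n, m p.1 * ∑ q ∈ antidiagonal p.2, c q.1 q.2 := by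
  simp_rw [Finset.mul_sum]
  rw [Finset.sum_sigma', Finset.sum_sigma']
  refine Finset.sum_nbij' (fun x => ⟨(x.2.1, x.2.2 + x.1.2), (x.2.2, x.1.2)⟩)
    (fun x => ⟨(x.1.1 + x.2.1, x.2.2), (x.1.1, x.2.1)⟩) ?_ ?_ ?_ ?_ ?_
  · rintro ⟨⟨a, b⟩, ⟨c, d⟩⟩ h
    simp only [Finset.mem_sigma, Finset.HasAntidiagonal.mem_antidiagonal] at h ⊢
    exact ⟨by omega, trivial⟩
  · rintro ⟨⟨a, b⟩, ⟨c, d⟩⟩ h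
    simp only [Finset.mem_sigma, Finset.HasAntidiagonal.mem_antidiagonal] at h ⊢
    exact ⟨by omega, trivial⟩
  · rintro ⟨⟨a, b⟩, ⟨c, d⟩⟩ h
    simp only [Finset.mem_sigma, Finset.HasAntidiagonal.mem_antidiagonal] at h
    obtain ⟨_, rfl⟩ := h
    rfl
  · rintro ⟨⟨a, b⟩, ⟨c, d⟩⟩ h
    simp only [Finset.mem_sigma, Finset.HasAntidiagonal.mem_antidiagonal] at h
    obtain ⟨_, rfl⟩ := h
    rfl
  · rintro ⟨⟨a, b⟩, ⟨c, d⟩⟩ h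
    rfl

section series

variable {β αt : ℝ}

lemma abs_firstSeries_le (hβ : 0 < β) (hα : 0 < αt) (k : ℕ) :
    |coeff k (firstSeries (1 / (β / 2) - 1) αt)| ≤
      2 * |1 / (β / 2) - 1| * growthRate β αt ^ k := by
  have hA := growthRate_ge (αt := αt) hβ
  set η := 1 / (β / 2) - 1
  refine abs_le_of_linear_recursion hα (P := growthRate β αt) (by linarith) (by positivity) (L := k)
    (v := fun k => coeff k (firstSeries η αt))
    (s := fun k => η * ((k + 1) * limitMoment αt k)) ?_ (fun k _ => ?_)
    (fun k _ => firstSeries_succ η αt k) k le_rfl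
  · rw [firstSeries_zero, abs_zero]
    positivity
  · have := succ_mul_limitMoment_le hα hA k
    have h0 := limitMoment_nonneg hα k
    rw [abs_mul, abs_of_nonneg (show 0 ≤ ((k : ℝ) + 1) * limitMoment αt k by positivity)]
    calc _ ≤ |η| * (2 * growthRate β αt ^ k) := by gcongr
      _ = _ := by ring

lemma exists_abs_secondSeries_le (hβ : 0 < β) (hα : 0 < αt) : ∃ C, 0 ≤ C ∧ ∀ k,
    |coeff k (secondSeries (1 / (β / 2) - 1) (1 / (β / 2)) αt)| ≤
      C * (2 * growthRate β αt) ^ k := by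
  have hA := growthRate_ge (αt := αt) hβ
  have hE := abs_firstSeries_le hβ hα
  set η := 1 / (β / 2) - 1
  set ι := 1 / (β / 2)
  set A := growthRate β αt
  have hι : 0 < ι := by positivity
  have hA0 : 0 < A := by linarith
  have hG : ∀ k, |coeff k (pairSeries η ι αt)| ≤ (4 * η ^ 2 + ι) * (2 * A) ^ k := by
    intro k
    refine abs_le_of_linear_recursion hα (P := 2 * A) (by linarith) (by positivity) (L := k)
      (v := fun k => coeff k (pairSeries η ι αt))
      (s := fun k => η * ∑ p ∈ antidiagonal k, (p.1 + 1) * limitMoment αt p.1 *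
        coeff p.2 (firstSeries η αt) + ι / 2 * (k * (k + 1) * limitMoment αt k)) ?_ (fun k _ => ?_)
      (fun k _ => pairSeries_succ η ι αt k) k le_rfl
    · rw [pairSeries_zero, abs_zero]
      positivity
    · have h1 : |∑ p ∈ antidiagonal k, (p.1 + 1) * limitMoment αt p.1 *
          coeff p.2 (firstSeries η αt)| ≤ 4 * |η| * (2 * A) ^ k := by
        refine (Finset.abs_sum_le_sum_abs _ _).trans ?_
        calc _ ≤ ∑ p ∈ antidiagonal k, 4 * |η| * (A ^ p.1 * A ^ p.2) := by
              refine Finset.sum_le_sum fun p _ => ?_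
              have m1 := succ_mul_limitMoment_le hα hA p.1
              have m0 := limitMoment_nonneg hα p.1
              rw [abs_mul,
                abs_of_nonneg (show 0 ≤ ((p.1 : ℝ) + 1) * limitMoment αt p.1 by positivity)]
              calc _ ≤ (2 * A ^ p.1) * (2 * |η| * A ^ p.2) := by gcongr; exact hE _
                _ = _ := by ring
          _ = 4 * |η| * ((k + 1) * A ^ k) := by rw [← Finset.mul_sum, sum_antidiagonal_pow]
          _ ≤ _ := by gcongr; exact succ_mul_pow_le hA0.le k
      have m1 := succ_mul_limitMoment_le hα hA k
      have m0 := limitMoment_nonneg hα k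
      refine (abs_add_le _ _).trans ?_
      rw [abs_mul, abs_of_nonneg (show 0 ≤ ι / 2 * (k * (k + 1) * limitMoment αt k) by positivity)]
      calc |η| * _ + ι / 2 * (k * (k + 1) * limitMoment αt k)
          ≤ |η| * (4 * |η| * (2 * A) ^ k) + ι / 2 * ((k + 1) * (2 * A ^ k)) := by
            have m2 : k * (k + 1) * limitMoment αt k ≤ ((k : ℝ) + 1) * (2 * A ^ k) := by
              rw [mul_assoc]
              exact mul_le_mul (by linarith) m1 (by positivity) (by positivity)
            gcongr
        _ = 4 * |η| ^ 2 * (2 * A) ^ k + ι * ((k + 1) * A ^ k) := by ring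
        _ ≤ 4 * |η| ^ 2 * (2 * A) ^ k + ι * (2 * A) ^ k := by
            gcongr
            exact succ_mul_pow_le hA0.le k
        _ = _ := by rw [sq_abs]; ring
  refine ⟨6 * η ^ 2 + ι, by positivity, fun k => ?_⟩
  refine abs_le_of_linear_recursion hα (P := 2 * A) (by linarith) (by positivity) (L := k)
    (v := fun k => coeff k (secondSeries η ι αt))
    (s := fun k => coeff k (pairSeries η ι αt) + η * ((k + 1) * coeff k (firstSeries η αt))) ?_
    (fun k _ => ?_) (fun k _ => secondSeries_succ η ι αt k) k le_rfl
  · rw [secondSeries_zero, abs_zero]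
    positivity
  · refine (abs_add_le _ _).trans ?_
    rw [abs_mul, abs_mul, abs_of_nonneg (show (0 : ℝ) ≤ k + 1 by positivity)]
    calc _ ≤ (4 * η ^ 2 + ι) * (2 * A) ^ k + |η| * ((k + 1) * (2 * |η| * A ^ k)) := by
          gcongr
          · exact hG k
          · exact hE k
      _ = (4 * η ^ 2 + ι) * (2 * A) ^ k + 2 * |η| ^ 2 * ((k + 1) * A ^ k) := by ring
      _ ≤ (4 * η ^ 2 + ι) * (2 * A) ^ k + 2 * |η| ^ 2 * (2 * A) ^ k := by
          gcongr
          exact succ_mul_pow_le hA0.le k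
      _ = _ := by rw [sq_abs]; ring

end series

section correlators

variable {N : ℕ} {β αt : ℝ}

lemma correlator_singleton_succ (hN : 0 < N) (hβ : 0 < β) (hα : 0 < αt) (k : ℕ) :
    correlator N β αt {k + 1} = αt * correlator N β αt {k} +
      2 * ∑ p ∈ antidiagonal k, limitMoment αt p.1 * correlator N β αt {p.2} +
      ((∑ p ∈ antidiagonal k, correlator N β αt {p.1, p.2}) / N +
        (1 / (β / 2) - 1) * ((k + 1) * (limitMoment αt k + correlator N β αt {k} / N))) := by
  have h := correlator_cons_succ hN hβ hα k 0
  rw [correlator_empty hN hβ hα] at h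
  simp only [Multiset.cons_zero, Multiset.map_zero, Multiset.sum_zero] at h
  change correlator N β αt {k + 1} = αt * correlator N β αt {k} + ∑ p ∈ antidiagonal k,
    (2 * limitMoment αt p.1 * correlator N β αt {p.2} + correlator N β αt {p.1, p.2} / N) +
      _ + _ at h
  rw [h, Finset.sum_add_distrib, Finset.sum_div, Finset.mul_sum]
  simp only [mul_assoc]
  ring

lemma sum_correlator_pair_succ (hN : 0 < N) (hβ : 0 < β) (hα : 0 < αt) (n : ℕ) :
    ∑ p ∈ antidiagonal (n + 1), correlator N β αt {p.1, p.2} =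
      αt * ∑ p ∈ antidiagonal n, correlator N β αt {p.1, p.2} +
      2 * ∑ p ∈ antidiagonal n, limitMoment αt p.1 *
        ∑ q ∈ antidiagonal p.2, correlator N β αt {q.1, q.2} +
      ((∑ p ∈ antidiagonal n, ∑ q ∈ antidiagonal p.1, correlator N β αt {q.1, q.2, p.2}) / N +
        (1 / (β / 2) - 1) * ∑ p ∈ antidiagonal n, (p.1 + 1) * (limitMoment αt p.1 *
          correlator N β αt {p.2} + correlator N β αt {p.1, p.2} / N) +
        1 / (β / 2) / 2 * (n * (n + 1) * (limitMoment αt n + correlator N β αt {n} / N))) := by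
  rw [Finset.Nat.sum_antidiagonal_succ]
  have h0 : correlator N β αt {0, n + 1} = 0 := correlator_zero_cons N β αt _
  have h : ∀ p ∈ antidiagonal n, correlator N β αt {p.1 + 1, p.2} =
      αt * correlator N β αt {p.1, p.2} +
      2 * (∑ q ∈ antidiagonal p.1, limitMoment αt q.1 * correlator N β αt {q.2, p.2}) +
      (∑ q ∈ antidiagonal p.1, correlator N β αt {q.1, q.2, p.2}) / N +
      (1 / (β / 2) - 1) * ((p.1 + 1) * (limitMoment αt p.1 * correlator N β αt {p.2} +
        correlator N β αt {p.1, p.2} / N)) +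
      1 / (β / 2) * (limitMoment αt n + correlator N β αt {n} / N) * p.2 := by
    intro p hp
    have h := correlator_cons_succ hN hβ hα p.1 {p.2}
    simp only [Multiset.map_singleton, Multiset.sum_singleton, Multiset.erase_singleton,
      correlator_empty hN hβ hα, mem_antidiagonal.1 hp] at h
    change correlator N β αt {p.1 + 1, p.2} = αt * correlator N β αt {p.1, p.2} +
      ∑ q ∈ antidiagonal p.1, (2 * limitMoment αt q.1 * correlator N β αt {q.2, p.2} +
        correlator N β αt {q.1, q.2, p.2} / N) + _ + _ * (_ * (_ +
        correlator N β αt {n} / N)) at h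
    rw [h, Finset.sum_add_distrib, Finset.sum_div, Finset.mul_sum]
    simp only [mul_assoc]
    change _ + _ * (_ * (_ + correlator N β αt {p.1, p.2} / N)) + _ = _
    ring
  rw [h0, zero_add, Finset.sum_congr rfl h]
  simp only [Finset.sum_add_distrib, ← Finset.mul_sum, ← Finset.sum_div]
  rw [sum_antidiagonal_assoc n (limitMoment αt) (fun i j => correlator N β αt {i, j}),
    sum_antidiagonal_snd]
  ring

/-- The one-point correlator of fluctuations to second order, uniformly for degrees up to order
`√N`. -/
theorem exists_abs_correlator_sub_le (hβ : 0 < β) (hα : 0 < αt) : ∃ C, 0 ≤ C ∧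
    ∀ N L : ℕ, 0 < N → (L + 2) ^ 2 ≤ N → ∀ k ≤ L, |correlator N β αt {k} -
      coeff k (firstSeries (1 / (β / 2) - 1) αt) -
        coeff k (secondSeries (1 / (β / 2) - 1) (1 / (β / 2)) αt) / N| ≤
      C / N ^ 2 * (4 * growthRate β αt) ^ k := by
  have hA := growthRate_ge (αt := αt) hβ
  set η := 1 / (β / 2) - 1 with hη
  set ι := 1 / (β / 2) with hι'
  set A := growthRate β αt with hA'
  have hι : 0 < ι := by positivity
  have hA0 : 0 < A := by linarith
  set C₁ := 2 + |η| with hC₁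
  set C₂ := 6 + 2 * |η| * C₁ + 2 * |η| + ι with hC₂
  have hC₁0 : 0 ≤ C₁ := by positivity
  have hC₂0 : 0 ≤ C₂ := by positivity
  refine ⟨C₂ + |η| * C₁, by positivity, fun N L hN hL => ?_⟩
  have hN' : (0 : ℝ) < N := by exact_mod_cast hN
  have hb : ∀ T : Multiset ℕ, T.sum ≤ L →
      |correlator N β αt T| ≤ (T.card).factorial * A ^ T.sum := fun T hT =>
    abs_correlator_le hN hβ hα T (le_trans (Nat.pow_le_pow_left (by omega) 2) hL)
  have b1 : ∀ k ≤ L, |correlator N β αt {k}| ≤ A ^ k := fun k hk => by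
    simpa using hb {k} (by simpa using hk)
  have b2 : ∀ i j, i + j ≤ L → |correlator N β αt {i, j}| ≤ 2 * A ^ (i + j) := fun i j hk => by
    simpa using hb {i, j} (by simpa using hk)
  have b3 : ∀ i j l, i + j + l ≤ L → |correlator N β αt {i, j, l}| ≤ 6 * A ^ (i + j + l) :=
    fun i j l hk => by
      have := hb {i, j, l} (by simpa [← add_assoc] using hk)
      simpa [Nat.factorial, ← add_assoc] using this
  set f : ℕ → ℝ := fun k => correlator N β αt {k} with hf
  set g : ℕ → ℝ := fun n => ∑ p ∈ antidiagonal n, correlator N β αt {p.1, p.2} with hg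
  set e : ℕ → ℝ := fun k => coeff k (firstSeries η αt) with he
  set γ : ℕ → ℝ := fun k => coeff k (pairSeries η ι αt) with hγ
  set q : ℕ → ℝ := fun k => coeff k (secondSeries η ι αt) with hq
  have hf0 : f 0 = 0 := correlator_zero_cons N β αt 0
  have hg0 : g 0 = 0 := by
    simp only [hg]
    simpa using correlator_zero_cons N β αt {0}
  have pk : ∀ k : ℕ, ((k : ℝ) + 1) * A ^ k ≤ (2 * A) ^ k := succ_mul_pow_le hA0.le
  have pk2 : ∀ k : ℕ, ((k : ℝ) + 1) * (2 * A) ^ k ≤ (4 * A) ^ k := fun k => by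
    have := succ_mul_pow_le (show 0 ≤ 2 * A by positivity) k
    rwa [show 2 * (2 * A) = 4 * A by ring] at this
  have gb : ∀ n ≤ L, |g n| ≤ 2 * (2 * A) ^ n := by
    intro n hn
    calc |g n| ≤ ∑ p ∈ antidiagonal n, 2 * A ^ n := by
          refine (Finset.abs_sum_le_sum_abs _ _).trans (Finset.sum_le_sum fun p hp => ?_)
          have hp' := mem_antidiagonal.1 hp
          rw [← hp']
          exact b2 _ _ (by omega)
      _ = 2 * ((n + 1) * A ^ n) := by
          simp
          ring
      _ ≤ _ := by gcongr; exact pk n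
  -- The difference solves the linearised recursion with a source of order `1 / N`; the crude bounds
  -- on the one- and two-point correlators suffice here.
  have d1 : ∀ k ≤ L, |f k - e k| ≤ C₁ / N * (2 * A) ^ k := by
    refine abs_le_of_linear_recursion hα (by linarith) (by positivity)
      (s := fun k => g k / N + η * ((k + 1) * f k) / N) ?_ (fun k hk => ?_) (fun k hk => ?_)
    · rw [hf0, he]
      simp only
      rw [firstSeries_zero]
      simp
      positivity
    · refine (abs_add_le _ _).trans ?_
      rw [abs_div, abs_div, abs_mul, abs_mul, Nat.abs_cast,
        abs_of_nonneg (show (0 : ℝ) ≤ k + 1 by positivity)]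
      calc _ ≤ 2 * (2 * A) ^ k / N + |η| * ((k + 1) * A ^ k) / N := by
            gcongr
            · exact gb k hk.le
            · exact b1 k hk.le
        _ ≤ 2 * (2 * A) ^ k / N + |η| * (2 * A) ^ k / N := by gcongr; exact pk k
        _ = _ := by rw [hC₁]; ring
    · have h1 := correlator_singleton_succ hN hβ hα k
      have h2 := firstSeries_succ η αt k
      simp only [hf, he, hg, mul_sub, Finset.sum_sub_distrib]
      rw [h1, h2]
      ring
  -- The same for the diagonal of the two-point correlators, with `d1` and the crude bound on the
  -- three-point correlators controlling the source.
  have d2 : ∀ k ≤ L, |g k - γ k| ≤ C₂ / N * (4 * A) ^ k := by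
    refine abs_le_of_linear_recursion hα (by linarith) (by positivity)
      (s := fun n => (∑ p ∈ antidiagonal n, ∑ r ∈ antidiagonal p.1,
        correlator N β αt {r.1, r.2, p.2}) / N +
        η * (∑ p ∈ antidiagonal n, (p.1 + 1) * limitMoment αt p.1 * (f p.2 - e p.2)) +
        η * (∑ p ∈ antidiagonal n, (p.1 + 1) * correlator N β αt {p.1, p.2}) / N +
        ι / 2 * (n * (n + 1) * f n) / N) ?_ (fun n hn => ?_) (fun n hn => ?_)
    · rw [hg0, hγ]
      simp only
      rw [pairSeries_zero]
      simp
      positivity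
    · have s1 : |∑ p ∈ antidiagonal n, ∑ r ∈ antidiagonal p.1,
          correlator N β αt {r.1, r.2, p.2}| ≤ 6 * (4 * A) ^ n := by
        calc _ ≤ ∑ p ∈ antidiagonal n, (n + 1) * (6 * A ^ n) := by
              refine (Finset.abs_sum_le_sum_abs _ _).trans (Finset.sum_le_sum fun p hp => ?_)
              have hp' := mem_antidiagonal.1 hp
              calc _ ≤ ∑ r ∈ antidiagonal p.1, 6 * A ^ n := by
                    refine (Finset.abs_sum_le_sum_abs _ _).trans
                      (Finset.sum_le_sum fun r hr => ?_)
                    have hr' := mem_antidiagonal.1 hr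
                    rw [show n = r.1 + r.2 + p.2 by omega]
                    exact b3 _ _ _ (by omega)
                _ = (p.1 + 1) * (6 * A ^ n) := by simp
                _ ≤ _ := by
                    have : (p.1 : ℝ) ≤ n := by exact_mod_cast (by omega : p.1 ≤ n)
                    gcongr
          _ = 6 * ((n + 1) * ((n + 1) * A ^ n)) := by
              simp
              ring
          _ ≤ 6 * ((n + 1) * (2 * A) ^ n) := by gcongr; exact pk n
          _ ≤ _ := by gcongr; exact pk2 n
      have s2 : |∑ p ∈ antidiagonal n, (p.1 + 1) * limitMoment αt p.1 * (f p.2 - e p.2)| ≤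
          2 * C₁ / N * (4 * A) ^ n := by
        calc _ ≤ ∑ p ∈ antidiagonal n, 2 * C₁ / N * ((2 * A) ^ p.1 * (2 * A) ^ p.2) := by
              refine (Finset.abs_sum_le_sum_abs _ _).trans (Finset.sum_le_sum fun p hp => ?_)
              have hp' := mem_antidiagonal.1 hp
              have m1 := succ_mul_limitMoment_le hα (show 4 * αt + 8 ≤ 2 * A by linarith) p.1
              have m0 := limitMoment_nonneg hα p.1
              rw [abs_mul,
                abs_of_nonneg (show 0 ≤ ((p.1 : ℝ) + 1) * limitMoment αt p.1 by positivity)]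
              calc _ ≤ (2 * (2 * A) ^ p.1) * (C₁ / N * (2 * A) ^ p.2) := by
                    gcongr
                    exact d1 _ (by omega)
                _ = _ := by ring
          _ = 2 * C₁ / N * ((n + 1) * (2 * A) ^ n) := by
              rw [← Finset.mul_sum, sum_antidiagonal_pow]
          _ ≤ _ := by gcongr; exact pk2 n
      have s3 : |∑ p ∈ antidiagonal n, (p.1 + 1) * correlator N β αt {p.1, p.2}| ≤
          2 * (4 * A) ^ n := by
        calc _ ≤ ∑ p ∈ antidiagonal n, (n + 1) * (2 * A ^ n) := by
              refine (Finset.abs_sum_le_sum_abs _ _).trans (Finset.sum_le_sum fun p hp => ?_)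
              have hp' := mem_antidiagonal.1 hp
              have hpn : (p.1 : ℝ) ≤ n := by exact_mod_cast (by omega : p.1 ≤ n)
              have := b2 p.1 p.2 (by omega)
              rw [hp'] at this
              rw [abs_mul, abs_of_nonneg (show (0 : ℝ) ≤ p.1 + 1 by positivity)]
              gcongr
          _ = 2 * ((n + 1) * ((n + 1) * A ^ n)) := by
              simp
              ring
          _ ≤ 2 * ((n + 1) * (2 * A) ^ n) := by gcongr; exact pk n
          _ ≤ _ := by gcongr; exact pk2 n
      have s4 : |n * (n + 1) * f n| ≤ 2 * (4 * A) ^ n := by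
        rw [abs_mul, abs_of_nonneg (show (0 : ℝ) ≤ n * (n + 1) by positivity)]
        calc _ ≤ (n + 1) * ((n + 1) * A ^ n) := by
              rw [← mul_assoc]
              gcongr
              · linarith
              · exact b1 n hn.le
          _ ≤ (n + 1) * (2 * A) ^ n := by gcongr; exact pk n
          _ ≤ (4 * A) ^ n := pk2 n
          _ ≤ _ := by linarith [show 0 < (4 * A) ^ n by positivity]
      calc _ ≤ 6 * (4 * A) ^ n / N + |η| * (2 * C₁ / N * (4 * A) ^ n) +
            |η| * (2 * (4 * A) ^ n) / N + ι / 2 * (2 * (4 * A) ^ n) / N := by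
            refine (abs_add_le _ _).trans (add_le_add ((abs_add_le _ _).trans (add_le_add
              ((abs_add_le _ _).trans (add_le_add ?_ ?_)) ?_)) ?_)
            · rw [abs_div, Nat.abs_cast]
              gcongr
            · rw [abs_mul]
              gcongr
            · rw [abs_div, Nat.abs_cast, abs_mul]
              gcongr
            · rw [abs_div, Nat.abs_cast, abs_mul, abs_of_pos (show 0 < ι / 2 by positivity)]
              gcongr
        _ = _ := by rw [hC₂]; ring
    · have h1 := sum_correlator_pair_succ hN hβ hα n
      have h2 := pairSeries_succ η ι αt n
      simp only [hf, he, hg, hγ, mul_sub, Finset.sum_sub_distrib]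
      rw [h1, h2]
      simp only [mul_add, mul_assoc, Finset.sum_add_distrib, mul_div_assoc', ← Finset.sum_div]
      ring
  refine abs_le_of_linear_recursion hα (by linarith) (by positivity)
    (v := fun k => f k - e k - q k / N)
    (s := fun k => (g k - γ k) / N + η * ((k + 1) * (f k - e k)) / N) ?_ (fun k hk => ?_)
      (fun k hk => ?_)
  · simp only [hf0, he, hq]
    rw [firstSeries_zero, secondSeries_zero]
    simp
    positivity
  · refine (abs_add_le _ _).trans ?_
    rw [abs_div, abs_div, abs_mul, abs_mul, Nat.abs_cast,
      abs_of_nonneg (show (0 : ℝ) ≤ k + 1 by positivity)]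
    calc _ ≤ C₂ / N * (4 * A) ^ k / N + |η| * ((k + 1) * (C₁ / N * (2 * A) ^ k)) / N := by
          gcongr
          · exact d2 k hk.le
          · exact d1 k hk.le
      _ = C₂ / N * (4 * A) ^ k / N + |η| * (C₁ / N * ((k + 1) * (2 * A) ^ k)) / N := by ring
      _ ≤ C₂ / N * (4 * A) ^ k / N + |η| * (C₁ / N * (4 * A) ^ k) / N := by
          gcongr
          exact pk2 k
      _ = _ := by
          field_simp
  · have h1 := correlator_singleton_succ hN hβ hα k
    have h2 := firstSeries_succ η αt k
    have h3 := secondSeries_succ η ι αt k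
    simp only [hf, he, hg, hγ, hq, mul_sub, Finset.sum_sub_distrib]
    rw [h1, h2, h3]
    simp only [mul_div_assoc', ← Finset.sum_div]
    ring

end correlators

end

/-! ### The coefficients as analytic functions -/

section

open PowerSeries in
/-- The real power series `f` converges absolutely at `z : ℂ`, with sum `v`. -/
def HasEval (f : ℝ⟦X⟧) (z v : ℂ) : Prop :=
  Summable (fun n => ‖((coeff n f : ℝ) : ℂ) * z ^ n‖) ∧
    HasSum (fun n => ((coeff n f : ℝ) : ℂ) * z ^ n) v

namespace HasEval

open PowerSeries

variable {f g : ℝ⟦X⟧} {z v w : ℂ}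

lemma unique (hf : HasEval f z v) (hg : HasEval f z w) : v = w := hf.2.unique hg.2

lemma add (hf : HasEval f z v) (hg : HasEval g z w) : HasEval (f + g) z (v + w) := by
  have h : (fun n => ((coeff n (f + g) : ℝ) : ℂ) * z ^ n) =
      fun n => ((coeff n f : ℝ) : ℂ) * z ^ n + ((coeff n g : ℝ) : ℂ) * z ^ n := by
    funext n
    rw [map_add]
    push_cast
    ring
  refine ⟨?_, ?_⟩
  · refine Summable.of_nonneg_of_le (fun _ => norm_nonneg _) (fun n => ?_) (hf.1.add hg.1)
    exact (congrArg norm (congrFun h n)).le.trans (norm_add_le _ _)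
  · rw [h]
    exact hf.2.add hg.2

lemma mul (hf : HasEval f z v) (hg : HasEval g z w) : HasEval (f * g) z (v * w) := by
  have h : (fun n => ((coeff n (f * g) : ℝ) : ℂ) * z ^ n) =
      fun n => ∑ p ∈ antidiagonal n, (((coeff p.1 f : ℝ) : ℂ) * z ^ p.1) *
        (((coeff p.2 g : ℝ) : ℂ) * z ^ p.2) := by
    funext n
    rw [coeff_mul, Complex.ofReal_sum, Finset.sum_mul]
    refine Finset.sum_congr rfl fun p hp => ?_
    rw [← mem_antidiagonal.1 hp, pow_add]
    push_cast
    ring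
  have h1 := summable_norm_sum_mul_antidiagonal_of_summable_norm hf.1 hg.1
  have h2 := tsum_mul_tsum_eq_tsum_sum_antidiagonal_of_summable_norm hf.1 hg.1
  refine ⟨?_, ?_⟩
  · exact h1.congr fun n => congrArg norm (congrFun h n).symm
  · rw [h, ← hf.2.tsum_eq, ← hg.2.tsum_eq, h2]
    exact h1.of_norm.hasSum

lemma of_finite {n₀ : ℕ} (h : ∀ n, n ≠ n₀ → coeff n f = 0) :
    HasEval f z (((coeff n₀ f : ℝ) : ℂ) * z ^ n₀) := by
  refine ⟨(hasSum_single n₀ fun n hn => ?_).summable, hasSum_single n₀ fun n hn => ?_⟩ <;>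
    simp [h n hn]

lemma C (c : ℝ) (z : ℂ) : HasEval (C c) z c := by
  have := of_finite (f := PowerSeries.C c) (z := z) (n₀ := 0) fun n hn => by
    rw [coeff_C, if_neg hn]
  simpa using this

lemma X (z : ℂ) : HasEval (X : ℝ⟦X⟧) z z := by
  have := of_finite (f := (PowerSeries.X : ℝ⟦X⟧)) (z := z) (n₀ := 1) fun n hn => by
    rw [coeff_X, if_neg hn]
  simpa using this

lemma one (z : ℂ) : HasEval (1 : ℝ⟦X⟧) z 1 := by simpa using C 1 z

lemma pow (hf : HasEval f z v) (n : ℕ) : HasEval (f ^ n) z (v ^ n) := by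
  induction n with
  | zero => simpa using one z
  | succ n ih => simpa [pow_succ] using ih.mul hf

lemma sub (hf : HasEval f z v) (hg : HasEval g z w) : HasEval (f - g) z (v - w) := by
  have := hf.add ((C (-1) z).mul hg)
  simpa [sub_eq_add_neg] using this

lemma norm_le {c P : ℝ} (hf : ∀ k, |coeff k f| ≤ c * P ^ k) (k : ℕ) :
    ‖((coeff k f : ℝ) : ℂ) * z ^ k‖ ≤ c * (P * ‖z‖) ^ k := by
  rw [norm_mul, norm_pow, Complex.norm_real, mul_pow, ← mul_assoc, Real.norm_eq_abs]
  exact mul_le_mul_of_nonneg_right (hf k) (by positivity)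

lemma exists_of_le {c P : ℝ} (hf : ∀ k, |coeff k f| ≤ c * P ^ k) (hP : 0 ≤ P)
    (hz : P * ‖z‖ < 1) : ∃ v, HasEval f z v := by
  have h : Summable fun k => c * (P * ‖z‖) ^ k :=
    (summable_geometric_of_lt_one (by positivity) hz).mul_left c
  have h1 := Summable.of_nonneg_of_le (fun _ => norm_nonneg _) (norm_le (z := z) hf) h
  exact ⟨_, h1, h1.of_norm.hasSum⟩

lemma norm_sum_sub_le {c P : ℝ} (hf : ∀ k, |coeff k f| ≤ c * P ^ k) (hP : 0 ≤ P)
    (hz : P * ‖z‖ ≤ 1 / 2) (h : HasEval f z v) (n : ℕ) :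
    ‖∑ k ∈ Finset.range n, ((coeff k f : ℝ) : ℂ) * z ^ k - v‖ ≤ 2 * c * (1 / 2) ^ n := by
  have hc : 0 ≤ c := by simpa using (abs_nonneg _).trans (hf 0)
  have h1 : ∀ k, ‖((coeff k f : ℝ) : ℂ) * z ^ k‖ ≤ c * (1 / 2) ^ k := fun k =>
    (norm_le hf k).trans (by gcongr)
  have := norm_sub_le_of_geometric_bound_of_hasSum (by norm_num) h1 h.2 n
  refine this.trans (le_of_eq ?_)
  ring

end HasEval

lemma leftEdge_mul_rightEdge {αt : ℝ} (hα : 0 < αt) : leftEdge αt * rightEdge αt = αt ^ 2 := by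
  have := Real.sq_sqrt (show 0 ≤ αt + 1 by linarith)
  unfold leftEdge rightEdge
  rw [← mul_pow, show (√(αt + 1) - 1) * (√(αt + 1) + 1) = √(αt + 1) ^ 2 - 1 by ring, this]
  ring

lemma leftEdge_add_rightEdge {αt : ℝ} (hα : 0 < αt) :
    leftEdge αt + rightEdge αt = 2 * (αt + 2) := by
  have := Real.sq_sqrt (show 0 ≤ αt + 1 by linarith)
  unfold leftEdge rightEdge
  linarith

lemma rightEdge_sub_leftEdge (αt : ℝ) : rightEdge αt - leftEdge αt = 4 * √(αt + 1) := by
  unfold leftEdge rightEdge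
  ring

lemma leftEdge_pos {αt : ℝ} (hα : 0 < αt) : 0 < leftEdge αt := by
  have : 1 < √(αt + 1) := by
    rw [Real.lt_sqrt zero_le_one]
    linarith
  unfold leftEdge
  have : 0 < √(αt + 1) - 1 := by linarith
  positivity

lemma leftEdge_lt_rightEdge {αt : ℝ} (hα : 0 < αt) : leftEdge αt < rightEdge αt := by
  have h := rightEdge_sub_leftEdge αt
  have : 0 < √(αt + 1) := Real.sqrt_pos.2 (by linarith)
  linarith

/-- The spectral cut `[a, b]` in the complex plane. -/
def cut (αt : ℝ) : Set ℂ := (fun x : ℝ => (x : ℂ)) '' Icc (leftEdge αt) (rightEdge αt)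

/-- The branch of `√((s - a)(s - b))` that is analytic off `[a, b]` and asymptotic to `s` at
infinity. -/
def root (αt : ℝ) (s : ℂ) : ℂ :=
  (s - leftEdge αt) * ((s - rightEdge αt) / (s - leftEdge αt)) ^ (2⁻¹ : ℂ)

lemma cpow_inv_two_sq (z : ℂ) : (z ^ (2⁻¹ : ℂ)) ^ 2 = z := by
  exact_mod_cast Complex.cpow_nat_inv_pow z two_ne_zero

lemma root_sq {αt : ℝ} {s : ℂ} (hs : s ≠ leftEdge αt) :
    root αt s ^ 2 = (s - leftEdge αt) * (s - rightEdge αt) := by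
  have : s - leftEdge αt ≠ 0 := sub_ne_zero.2 hs
  rw [root, mul_pow, cpow_inv_two_sq]
  field_simp

lemma root_sq' {αt : ℝ} (hα : 0 < αt) {s : ℂ} (hs : s ≠ leftEdge αt) :
    root αt s ^ 2 = (s - αt) ^ 2 - 4 * s := by
  have h1 : (leftEdge αt : ℂ) * rightEdge αt = αt ^ 2 := by
    exact_mod_cast leftEdge_mul_rightEdge hα
  have h2 : (leftEdge αt : ℂ) + rightEdge αt = 2 * (αt + 2) := by
    exact_mod_cast leftEdge_add_rightEdge hα
  rw [root_sq hs]
  linear_combination h1 - s * h2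

lemma ne_leftEdge_of_notMem_cut {αt : ℝ} (hα : 0 < αt) {s : ℂ} (hs : s ∉ cut αt) :
    s ≠ leftEdge αt := fun h => hs ⟨leftEdge αt, left_mem_Icc.2 (leftEdge_lt_rightEdge hα).le, h.symm⟩

lemma ne_rightEdge_of_notMem_cut {αt : ℝ} (hα : 0 < αt) {s : ℂ} (hs : s ∉ cut αt) :
    s ≠ rightEdge αt := fun h =>
  hs ⟨rightEdge αt, right_mem_Icc.2 (leftEdge_lt_rightEdge hα).le, h.symm⟩

lemma root_ne_zero {αt : ℝ} (hα : 0 < αt) {s : ℂ} (hs : s ∉ cut αt) : root αt s ≠ 0 := by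
  have h1 := ne_leftEdge_of_notMem_cut hα hs
  have h2 := ne_rightEdge_of_notMem_cut hα hs
  intro h
  have h3 := root_sq h1
  rw [h, zero_pow two_ne_zero, eq_comm, mul_eq_zero, sub_eq_zero, sub_eq_zero] at h3
  tauto

lemma div_mem_slitPlane {αt : ℝ} (hα : 0 < αt) {s : ℂ} (hs : s ∉ cut αt) :
    (s - rightEdge αt) / (s - leftEdge αt) ∈ Complex.slitPlane := by
  by_contra h
  rw [Complex.mem_slitPlane_iff_not_le_zero, not_not] at h
  have h1 := sub_ne_zero.2 (ne_leftEdge_of_notMem_cut hα hs)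
  obtain ⟨t, ht, ht'⟩ : ∃ t : ℝ, 0 ≤ t ∧ (s - rightEdge αt) / (s - leftEdge αt) = -t := by
    refine ⟨-((s - rightEdge αt) / (s - leftEdge αt)).re, ?_, ?_⟩
    · simpa using (Complex.le_def.1 h).1
    · apply Complex.ext
      · simp
      · simpa using (Complex.le_def.1 h).2
  rw [div_eq_iff h1] at ht'
  have hab := leftEdge_lt_rightEdge hα
  have ht1 : (0 : ℝ) < 1 + t := by linarith
  have ht2 : (1 + t : ℂ) ≠ 0 := by exact_mod_cast ht1.ne'
  refine hs ⟨(rightEdge αt + t * leftEdge αt) / (1 + t), ⟨?_, ?_⟩, ?_⟩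
  · rw [le_div_iff₀ ht1]
    linarith
  · rw [div_le_iff₀ ht1]
    nlinarith
  · push_cast
    rw [div_eq_iff ht2]
    linear_combination -ht'

lemma differentiableAt_root {αt : ℝ} (hα : 0 < αt) {s : ℂ} (hs : s ∉ cut αt) :
    DifferentiableAt ℂ (root αt) s := by
  have h1 := sub_ne_zero.2 (ne_leftEdge_of_notMem_cut hα hs)
  have h2 := div_mem_slitPlane hα hs
  unfold root
  have h3 : DifferentiableAt ℂ (fun s : ℂ => (s - rightEdge αt) / (s - leftEdge αt)) s :=
    DifferentiableAt.div (by fun_prop) (by fun_prop) h1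
  exact DifferentiableAt.mul (by fun_prop) (h3.cpow_const h2)

/-- The denominator of the leading resolvent has no zero off the cut: a zero would force `s = 0`,
where the root is not the positive number `αt`. -/
lemma sub_add_root_ne_zero {αt : ℝ} (hα : 0 < αt) {s : ℂ} (hs : s ∉ cut αt) :
    s - αt + root αt s ≠ 0 := by
  intro h
  have h1 := root_sq' hα (ne_leftEdge_of_notMem_cut hα hs)
  have h2 : s = 0 := by
    have : root αt s = -(s - αt) := by linear_combination h
    rw [this] at h1
    linear_combination (1 / 4) * h1
  have h3 : (root αt s).re = αt := by
    have : root αt s = αt := by rw [h2] at h ⊢; linear_combination h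
    rw [this, Complex.ofReal_re]
  rw [h2, root, zero_sub, zero_sub, neg_div_neg_eq, ← Complex.ofReal_neg,
    Complex.re_ofReal_mul, Complex.cpow_inv_two_re] at h3
  have := mul_nonneg (leftEdge_pos hα).le (Real.sqrt_nonneg
    ((‖((rightEdge αt : ℂ) / leftEdge αt)‖ + ((rightEdge αt : ℂ) / leftEdge αt).re) / 2))
  linarith

/-- The limiting resolvent. -/
def resolventZero (αt : ℝ) (s : ℂ) : ℂ := 2 / (s - αt + root αt s)

/-- The first correction to the limiting resolvent. -/
def resolventOne (h αt : ℝ) (s : ℂ) : ℂ := -h * (αt * resolventZero αt s + 1) / root αt s ^ 2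

/-- The second correction to the limiting resolvent. -/
def resolventTwo (h αt : ℝ) (s : ℂ) : ℂ :=
  (1 + 5 * h ^ 2) * (αt + 1) * (s / root αt s ^ 5) + h ^ 2 * ((αt + 2) * (1 / root αt s ^ 3) -
    αt * ((s - (αt + 2)) / root αt s ^ 4))

lemma differentiableOn_resolventZero {αt : ℝ} (hα : 0 < αt) :
    DifferentiableOn ℂ (resolventZero αt) (cut αt)ᶜ := fun s hs =>
  (DifferentiableAt.div (by fun_prop) (DifferentiableAt.add (by fun_prop)
    (differentiableAt_root hα hs)) (sub_add_root_ne_zero hα hs)).differentiableWithinAt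

lemma differentiableOn_resolventOne (h : ℝ) {αt : ℝ} (hα : 0 < αt) :
    DifferentiableOn ℂ (resolventOne h αt) (cut αt)ᶜ := by
  have h0 := differentiableOn_resolventZero hα
  have h1 : DifferentiableOn ℂ (root αt) (cut αt)ᶜ := fun s hs =>
    (differentiableAt_root hα hs).differentiableWithinAt
  exact DifferentiableOn.div (by fun_prop) (by fun_prop) fun s hs =>
    pow_ne_zero _ (root_ne_zero hα hs)

lemma differentiableOn_resolventTwo (h : ℝ) {αt : ℝ} (hα : 0 < αt) :
    DifferentiableOn ℂ (resolventTwo h αt) (cut αt)ᶜ := by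
  have h1 : DifferentiableOn ℂ (root αt) (cut αt)ᶜ := fun s hs =>
    (differentiableAt_root hα hs).differentiableWithinAt
  have h2 : ∀ n, ∀ s ∈ (cut αt)ᶜ, root αt s ^ n ≠ 0 := fun n s hs =>
    pow_ne_zero _ (root_ne_zero hα hs)
  have e5 : DifferentiableOn ℂ (fun s => s / root αt s ^ 5) (cut αt)ᶜ :=
    differentiableOn_id.div (h1.pow 5) (h2 5)
  have e3 : DifferentiableOn ℂ (fun s => 1 / root αt s ^ 3) (cut αt)ᶜ :=
    (differentiableOn_const 1).div (h1.pow 3) (h2 3)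
  have e4 : DifferentiableOn ℂ (fun s => (s - (αt + 2)) / root αt s ^ 4) (cut αt)ᶜ :=
    DifferentiableOn.div (by fun_prop) (h1.pow 4) (h2 4)
  unfold resolventTwo
  fun_prop

lemma notMem_cut_of_im_ne_zero (αt : ℝ) {s : ℂ} (hs : s.im ≠ 0) : s ∉ cut αt := by
  rintro ⟨x, _, rfl⟩
  simp at hs

section evaluation

open PowerSeries

variable {β αt : ℝ} {s v : ℂ}

lemma abs_momentSeries_le (hα : 0 < αt) {A : ℝ} (hA : 2 * αt + 4 ≤ A) (k : ℕ) :
    |coeff k (momentSeries αt)| ≤ 2 * A ^ k := by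
  rw [momentSeries, coeff_mk, abs_of_nonneg (limitMoment_nonneg hα k)]
  exact limitMoment_le hα hA k

lemma hasEval_rootSeries (hv : HasEval (momentSeries αt) s⁻¹ v) :
    HasEval (rootSeries αt) s⁻¹ (1 - αt * s⁻¹ - 2 * (s⁻¹ * v)) := by
  unfold rootSeries
  have h2 : (2 : ℝ⟦X⟧) = C 2 := (map_ofNat _ 2).symm
  rw [h2]
  exact_mod_cast ((HasEval.one _).sub ((HasEval.C αt _).mul (HasEval.X _))).sub
    ((HasEval.C 2 _).mul ((HasEval.X _).mul hv))

/-- The formal root series sums to `root αt s / s`; the sign of the square root is determined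
by comparing real parts near infinity. -/
lemma eval_rootSeries_eq (hα : 0 < αt) (hs : s ∉ cut αt)
    (hR : 2 * αt + 4 + 2 * αt + 4 + 2 * leftEdge αt < ‖s‖)
    (hv : HasEval (momentSeries αt) s⁻¹ v) :
    s * (1 - αt * s⁻¹ - 2 * (s⁻¹ * v)) = root αt s := by
  have ha := leftEdge_pos hα
  have hs0 : 0 < ‖s‖ := by linarith
  have hsne : s ≠ 0 := norm_pos_iff.1 hs0
  set δ := 1 - αt * s⁻¹ - 2 * (s⁻¹ * v) with hδ
  have hsq : δ ^ 2 = (1 - αt * s⁻¹) ^ 2 - 4 * s⁻¹ := by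
    have h1 := (hasEval_rootSeries hv).pow 2
    rw [rootSeries_sq] at h1
    have h4 : (4 : ℝ⟦X⟧) = C 4 := (map_ofNat _ 4).symm
    rw [h4] at h1
    have h2 := (((HasEval.one s⁻¹).sub ((HasEval.C αt _).mul (HasEval.X _))).pow 2).sub
      ((HasEval.C 4 _).mul (HasEval.X s⁻¹))
    exact_mod_cast h1.unique h2
  have hne := ne_leftEdge_of_notMem_cut hα hs
  have hprod : (s * δ - root αt s) * (s * δ + root αt s) = 0 := by
    have h1 := root_sq' hα hne
    have h2 : s * s⁻¹ = 1 := mul_inv_cancel₀ hsne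
    linear_combination s ^ 2 * hsq - h1 +
      (-2 * s * αt - 4 * s + αt ^ 2 * (s * s⁻¹ + 1)) * h2
  rcases mul_eq_zero.1 hprod with h | h
  · exact sub_eq_zero.1 h
  exfalso
  have hvb : ‖v‖ ≤ 4 := by
    have h1 := HasEval.norm_sum_sub_le (abs_momentSeries_le hα le_rfl) (by linarith)
      (by rw [norm_inv, ← div_eq_mul_inv, div_le_iff₀ hs0]; linarith) hv 0
    simpa [← two_mul] using h1.trans (by norm_num : (2 * 2 * (1 / 2) ^ 0 : ℝ) ≤ 4)
  have hane : s - leftEdge αt ≠ 0 := sub_ne_zero.2 hne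
  set r := ((s - rightEdge αt) / (s - leftEdge αt)) ^ (2⁻¹ : ℂ) with hr
  have hrre : 0 ≤ r.re := by
    rw [hr, Complex.cpow_inv_two_re]
    exact Real.sqrt_nonneg _
  have h1 : s - leftEdge αt + r * (s - leftEdge αt) = (αt + 2 * v - leftEdge αt) := by
    have h2 : s * s⁻¹ = 1 := mul_inv_cancel₀ hsne
    have h3 : root αt s = (s - leftEdge αt) * r := rfl
    rw [h3, hδ] at h
    linear_combination h + (αt + 2 * v) * h2
  have h2 : ‖1 + r‖ * ‖s - leftEdge αt‖ = ‖(αt + 2 * v - leftEdge αt : ℂ)‖ := by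
    rw [← norm_mul, ← h1]
    congr 1
    ring
  have h3 : 1 ≤ ‖1 + r‖ := by
    refine le_trans ?_ (Complex.re_le_norm _)
    simpa using hrre
  have h4 : ‖s‖ - leftEdge αt ≤ ‖s - leftEdge αt‖ := by
    have := norm_sub_norm_le s (leftEdge αt : ℂ)
    rwa [Complex.norm_real, Real.norm_of_nonneg ha.le] at this
  have h5 : ‖(αt + 2 * v - leftEdge αt : ℂ)‖ ≤ αt + 2 * 4 + leftEdge αt := by
    refine (norm_sub_le _ _).trans ?_
    rw [Complex.norm_real, Real.norm_of_nonneg ha.le]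
    have := norm_add_le (αt : ℂ) (2 * v)
    rw [Complex.norm_real, Real.norm_of_nonneg hα.le, norm_mul] at this
    have h6 : ‖(2 : ℂ)‖ = 2 := by simp
    rw [h6] at this
    linarith
  nlinarith [norm_nonneg (s - leftEdge αt : ℂ)]

lemma eval_momentSeries (hα : 0 < αt) (hs : s ∉ cut αt)
    (hR : 2 * αt + 4 + 2 * αt + 4 + 2 * leftEdge αt < ‖s‖)
    (hv : HasEval (momentSeries αt) s⁻¹ v) : s⁻¹ * v = resolventZero αt s := by
  have hs0 : s ≠ 0 := norm_pos_iff.1 (by linarith [leftEdge_pos hα])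
  have h1 : v = 1 + αt * (s⁻¹ * v) + s⁻¹ * v ^ 2 := by
    have h2 := ((HasEval.one s⁻¹).add ((HasEval.C αt _).mul ((HasEval.X _).mul hv))).add
      ((HasEval.X _).mul (hv.pow 2))
    rw [← momentSeries_eq] at h2
    exact hv.unique h2
  rw [resolventZero, eq_div_iff (sub_add_root_ne_zero hα hs), ← eval_rootSeries_eq hα hs hR hv]
  have h2 : s * s⁻¹ = 1 := mul_inv_cancel₀ hs0
  linear_combination v * (2 - αt * s⁻¹ - 2 * s⁻¹ * v) * h2 + 2 * h1

lemma eval_firstSeries {η e : ℝ} {w : ℂ} (hα : 0 < αt) (hs : s ∉ cut αt)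
    (hR : 2 * αt + 4 + 2 * αt + 4 + 2 * leftEdge αt < ‖s‖)
    (hv : HasEval (momentSeries αt) s⁻¹ v) (hw : HasEval (firstSeries η αt) s⁻¹ w) :
    e * (s⁻¹ * w) = resolventOne (-(e * η)) αt s := by
  have hs0 : s ≠ 0 := norm_pos_iff.1 (by linarith [leftEdge_pos hα])
  have hW := eval_momentSeries hα hs hR hv
  have hy := eval_rootSeries_eq hα hs hR hv
  have hy0 := root_ne_zero hα hs
  set δ := 1 - αt * s⁻¹ - 2 * (s⁻¹ * v) with hδ
  have h1 : w * δ ^ 2 = η * s⁻¹ * (1 + αt * (s⁻¹ * v)) := by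
    have h2 := hw.mul ((hasEval_rootSeries hv).pow 2)
    rw [firstSeries_mul_sq] at h2
    exact h2.unique (((HasEval.C η _).mul (HasEval.X _)).mul
      ((HasEval.one _).add ((HasEval.C αt _).mul ((HasEval.X _).mul hv))))
  rw [resolventOne, ← hW, eq_div_iff (pow_ne_zero _ hy0), ← hy]
  have h2 : s * s⁻¹ = 1 := mul_inv_cancel₀ hs0
  push_cast
  linear_combination e * s⁻¹ * s ^ 2 * h1 + e * η * (1 + αt * s⁻¹ * v) * (s * s⁻¹ + 1) * h2

lemma eval_secondSeries {η ι κ h : ℝ} {w : ℂ} (hα : 0 < αt) (hκι : κ * ι = 1)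
    (hκη : κ * η ^ 2 = h ^ 2) (hs : s ∉ cut αt)
    (hR : 2 * αt + 4 + 2 * αt + 4 + 2 * leftEdge αt < ‖s‖)
    (hv : HasEval (momentSeries αt) s⁻¹ v) (hw : HasEval (secondSeries η ι αt) s⁻¹ w) :
    κ * (s⁻¹ * w) = resolventTwo h αt s := by
  have hs0 : s ≠ 0 := norm_pos_iff.1 (by linarith [leftEdge_pos hα])
  have hy := eval_rootSeries_eq hα hs hR hv
  have hy0 := root_ne_zero hα hs
  set δ := 1 - αt * s⁻¹ - 2 * (s⁻¹ * v) with hδ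
  have h1 : w * δ ^ 5 = (ι + 5 * η ^ 2) * (αt + 1) * s⁻¹ ^ 3 + η ^ 2 * s⁻¹ ^ 2 *
      ((αt + 2) * δ ^ 2 - αt * (1 - (αt + 2) * s⁻¹) * δ) := by
    have h2 := hw.mul ((hasEval_rootSeries hv).pow 5)
    rw [secondSeries_mul_pow] at h2
    have h3 := h2.unique ((((HasEval.C _ _).mul (HasEval.C _ _)).mul ((HasEval.X _).pow 3)).add
      (((HasEval.C _ _).mul ((HasEval.X _).pow 2)).mul (((HasEval.C _ _).mul
        ((hasEval_rootSeries hv).pow 2)).sub (((HasEval.C _ _).mul ((HasEval.one _).sub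
          ((HasEval.C _ _).mul (HasEval.X _)))).mul (hasEval_rootSeries hv)))))
    exact_mod_cast h3
  have hδy : δ = root αt s / s := by rw [← hy]; field_simp
  rw [hδy] at h1
  have hκι' : (κ * ι : ℂ) = 1 := by exact_mod_cast hκι
  have hκη' : (κ * η ^ 2 : ℂ) = h ^ 2 := by exact_mod_cast hκη
  have h4 : w = ((ι + 5 * η ^ 2) * (αt + 1) * s⁻¹ ^ 3 + η ^ 2 * s⁻¹ ^ 2 *
      ((αt + 2) * (root αt s / s) ^ 2 - αt * (1 - (αt + 2) * s⁻¹) * (root αt s / s))) /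
      (root αt s / s) ^ 5 := by
    rw [eq_div_iff (by positivity), h1]
  have h5 : κ * (s⁻¹ * w) = (κ * ι + 5 * (κ * η ^ 2)) * (αt + 1) * (s / root αt s ^ 5) +
      (κ * η ^ 2) * ((αt + 2) * (1 / root αt s ^ 3) -
        αt * ((s - (αt + 2)) / root αt s ^ 4)) := by
    rw [h4]
    field_simp
  rw [h5, hκι', hκη', resolventTwo]

end evaluation

end

/-! ### The expansion of the resolvent -/

section

open PowerSeries

/-- A resolvent is a geometric polynomial up to a remainder controlled by a high moment. -/
lemma norm_inv_sub_geom_le {s : ℂ} (hs : s.im ≠ 0) {x : ℝ} (hx : 0 ≤ x) (L : ℕ) :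
    ‖1 / (s - x) - ∑ k ∈ Finset.range L, (x : ℂ) ^ k * s⁻¹ ^ (k + 1)‖ ≤
      ‖s‖⁻¹ ^ L * |s.im|⁻¹ * x ^ L := by
  have hs0 : s ≠ 0 := fun h => hs (by simp [h])
  have hsx : s - x ≠ 0 := fun h => hs (by simpa using congrArg Complex.im h)
  have h1 : 1 / (s - x) - ∑ k ∈ Finset.range L, (x : ℂ) ^ k * s⁻¹ ^ (k + 1) =
      s⁻¹ ^ L * x ^ L * (s - x)⁻¹ := by
    have h2 : ∑ k ∈ Finset.range L, (x : ℂ) ^ k * s⁻¹ ^ (k + 1) =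
        s⁻¹ * ∑ k ∈ Finset.range L, (x * s⁻¹) ^ k := by
      rw [Finset.mul_sum]
      exact Finset.sum_congr rfl fun k _ => by ring
    have h3 := mul_neg_geom_sum ((x : ℂ) * s⁻¹) L
    have h4 : (s - x) * s⁻¹ = 1 - x * s⁻¹ := by field_simp
    rw [h2, eq_mul_inv_iff_mul_eq₀ hsx, sub_mul, one_div, inv_mul_cancel₀ hsx]
    rw [← h4] at h3
    linear_combination -h3 - mul_pow (x : ℂ) s⁻¹ L
  have h5 : |s.im| ≤ ‖s - x‖ := by
    simpa using Complex.abs_im_le_norm (s - x)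
  rw [h1, norm_mul, norm_mul, norm_pow, norm_pow, norm_inv, norm_inv, Complex.norm_real,
    Real.norm_of_nonneg hx]
  calc _ ≤ ‖s‖⁻¹ ^ L * x ^ L * |s.im|⁻¹ := by
        gcongr
    _ = _ := by ring

lemma expect_powerSum {N : ℕ} {β αt : ℝ} (hN : 0 < N) (hβ : 0 < β) (hα : 0 < αt) (k : ℕ) :
    expect N β (αt * N * (β / 2)) (fun x => ∑ j, (x j / (N * (β / 2))) ^ k) =
      N * limitMoment αt k + correlator N β αt {k} := by
  have hN' : (0 : ℝ) < N := by exact_mod_cast hN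
  have hα1 : 0 < αt * N * (β / 2) := by positivity
  have h1 := expect_add hβ hα1 (PolyBounded.const (N := N) (N * limitMoment αt k * 1))
    (polyBounded_fluctuationProd N (N * (β / 2)) αt {k})
  rw [expect_const_mul, expect_one hβ hα1, mul_one] at h1
  rw [correlator, ← h1]
  congr 1
  funext x
  simp [fluctuationProd, fluctuation]

/-- The scaled resolvent at a non-real point, up to a high moment of the ensemble. -/
lemma norm_scaledResolvent_sub_le {N : ℕ} {β αt : ℝ} (hN : 0 < N) (hβ : 0 < β) (hα : 0 < αt)
    {s : ℂ} (hs : s.im ≠ 0) (L : ℕ) :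
    ‖scaledResolvent N β αt s - ∑ k ∈ Finset.range L,
      ((N * limitMoment αt k + correlator N β αt {k} : ℝ) : ℂ) * s⁻¹ ^ (k + 1)‖ ≤
      ‖s‖⁻¹ ^ L * |s.im|⁻¹ * (N * limitMoment αt L + correlator N β αt {L}) := by
  have hN' : (0 : ℝ) < N := by exact_mod_cast hN
  set c : ℝ := N * (β / 2) with hc
  have hc0 : 0 < c := by positivity
  set α := αt * N * (β / 2) with hα'
  have hα1 : 0 < α := by positivity
  let w : (Fin N → ℝ) → ℝ := weight N β α
  let p : ℕ → (Fin N → ℝ) → ℝ := fun k x => ∑ j, (x j / c) ^ k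
  have hp : ∀ k, Integrable (fun x => w x * p k x) := fun k =>
    (polyBounded_powerSum N c k).integrable_weight hβ hα1
  have hZ := integral_weight_pos N hβ hα1
  have hE : ∀ k, (N * limitMoment αt k + correlator N β αt {k} : ℝ) =
      (∫ x, w x)⁻¹ * ∫ x, w x * p k x := fun k => (expect_powerSum hN hβ hα k).symm
  let f : (Fin N → ℝ) → ℂ := fun x => ∑ j, 1 / ((c : ℂ) * s - (x j : ℂ))
  have hcs : ∀ y : ℝ, 1 / ((c : ℂ) * s - y) = (c : ℂ)⁻¹ * (1 / (s - ((y / c : ℝ) : ℂ))) := by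
    intro y
    have : (c : ℂ) ≠ 0 := by exact_mod_cast hc0.ne'
    rw [Complex.ofReal_div, ← one_div, div_mul_div_comm, mul_sub]
    field_simp
  have hf : Integrable (fun x => w x • f x) := by
    have hw : Integrable w := by
      simpa using (PolyBounded.const (N := N) 1).integrable_weight hβ hα1
    refine (hw.mul_const (N * (c⁻¹ * |s.im|⁻¹))).mono' ?_ (Eventually.of_forall fun x => ?_)
    · refine hw.aestronglyMeasurable.smul (Measurable.aestronglyMeasurable ?_)
      fun_prop
    · rw [norm_smul, Real.norm_of_nonneg (weight_nonneg N β α x)]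
      refine mul_le_mul_of_nonneg_left ?_ (weight_nonneg N β α x)
      calc ‖f x‖ ≤ ∑ j : Fin N, c⁻¹ * |s.im|⁻¹ := by
            refine (norm_sum_le _ _).trans (Finset.sum_le_sum fun j _ => ?_)
            rw [hcs, norm_mul, norm_inv, Complex.norm_real, Real.norm_of_nonneg hc0.le, norm_div,
              norm_one, one_div]
            gcongr
            simpa using Complex.abs_im_le_norm (s - ((x j / c : ℝ) : ℂ))
        _ = _ := by simp
  have hg : ∀ k, Integrable (fun x => ((w x * p k x : ℝ) : ℂ) * s⁻¹ ^ (k + 1)) := fun k =>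
    (hp k).ofReal.mul_const _
  have hsum : scaledResolvent N β αt s - ∑ k ∈ Finset.range L,
      ((N * limitMoment αt k + correlator N β αt {k} : ℝ) : ℂ) * s⁻¹ ^ (k + 1) =
      (∫ x, w x)⁻¹ • ∫ x, ((c : ℂ) * (w x • f x) -
        ∑ k ∈ Finset.range L, ((w x * p k x : ℝ) : ℂ) * s⁻¹ ^ (k + 1)) := by
    rw [integral_sub (hf.const_mul _) (integrable_finsetSum _ fun k _ => hg k),
      integral_finsetSum _ fun k _ => hg k, integral_const_mul, smul_sub]
    congr 1
    · simp only [scaledResolvent, resolvent, average]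
      rw [mul_smul_comm]
    · rw [Finset.smul_sum]
      refine Finset.sum_congr rfl fun k _ => ?_
      rw [hE, integral_mul_const, integral_complex_ofReal, Complex.ofReal_mul, Complex.real_smul,
        mul_assoc]
  rw [hsum, hE, norm_smul, norm_inv, Real.norm_of_nonneg hZ.le, mul_left_comm]
  refine mul_le_mul_of_nonneg_left ?_ (by positivity)
  rw [← integral_const_mul]
  refine norm_integral_le_of_norm_le ((hp L).const_mul _) (Eventually.of_forall fun x => ?_)
  by_cases hx : ∀ l, 0 < x l
  · have h1 : (c : ℂ) * (w x • f x) -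
        ∑ k ∈ Finset.range L, ((w x * p k x : ℝ) : ℂ) * s⁻¹ ^ (k + 1) =
        w x * ∑ j, (1 / (s - ((x j / c : ℝ) : ℂ)) -
          ∑ k ∈ Finset.range L, ((x j / c : ℝ) : ℂ) ^ k * s⁻¹ ^ (k + 1)) := by
      have hcne : (c : ℂ) ≠ 0 := by exact_mod_cast hc0.ne'
      rw [Finset.sum_sub_distrib, mul_sub]
      congr 1
      · simp only [f, hcs, Complex.real_smul, ← Finset.mul_sum]
        field_simp
      · rw [Finset.sum_comm, Finset.mul_sum]
        refine Finset.sum_congr rfl fun k _ => ?_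
        simp only [p]
        push_cast
        rw [← Finset.sum_mul, mul_assoc]
    rw [h1, norm_mul, Complex.norm_real, Real.norm_of_nonneg (weight_nonneg N β α x), mul_left_comm]
    refine mul_le_mul_of_nonneg_left ?_ (weight_nonneg N β α x)
    refine (norm_sum_le _ _).trans ?_
    simp only [p, Finset.mul_sum]
    refine Finset.sum_le_sum fun j _ => norm_inv_sub_geom_le hs (div_nonneg (hx j).le hc0.le) L
  · have h0 : w x = 0 := weight_eq_zero hx
    simp [h0]

lemma tendsto_sqrt_atTop : Tendsto Nat.sqrt atTop atTop :=
  tendsto_atTop_mono' atTop (Eventually.of_forall fun _ => le_rfl) <|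
    tendsto_atTop_atTop.2 fun b => ⟨b ^ 2, fun _ ha => Nat.le_sqrt'.2 ha⟩

lemma isLittleO_half_pow_sqrt :
    (fun N : ℕ => (1 / 2 : ℝ) ^ (Nat.sqrt N - 2)) =o[atTop] fun N : ℕ => (1 / (N : ℝ)) ^ 2 := by
  have h1 : Tendsto (fun n : ℕ => 8 * ((n : ℝ) ^ 4 * (1 / 2) ^ n)) atTop (𝓝 0) := by
    simpa using (tendsto_pow_const_mul_const_pow_of_lt_one 4 (by norm_num : (0 : ℝ) ≤ 1 / 2)
      (by norm_num)).const_mul 8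
  have h2 := (h1.comp (tendsto_add_atTop_nat 1)).comp tendsto_sqrt_atTop
  rw [Asymptotics.isLittleO_iff_tendsto']
  · refine squeeze_zero' (Eventually.of_forall fun N => by positivity) ?_ h2
    filter_upwards [eventually_ge_atTop 4] with N hN
    have h4 : 2 ≤ Nat.sqrt N := Nat.le_sqrt'.2 hN
    have h5 : (N : ℝ) ≤ ((Nat.sqrt N + 1 : ℕ) : ℝ) ^ 2 := by
      exact_mod_cast (Nat.lt_succ_sqrt' N).le
    simp only [Function.comp]
    obtain ⟨m, hm⟩ := Nat.exists_eq_add_of_le h4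
    rw [hm] at h5 ⊢
    rw [one_div_pow (N : ℝ), div_div_eq_mul_div, div_one]
    calc (1 / 2 : ℝ) ^ (2 + m - 2) * N ^ 2
        ≤ (1 / 2 : ℝ) ^ (2 + m - 2) * (((2 + m + 1 : ℕ) : ℝ) ^ 2) ^ 2 := by gcongr
      _ = _ := by
        rw [show 2 + m - 2 = m by omega, show 2 + m + 1 = m + 3 by omega, pow_add (1 / 2 : ℝ) m 3]
        ring
  · filter_upwards [eventually_gt_atTop 0] with N hN h
    have : (0 : ℝ) < N := by exact_mod_cast hN
    exact absurd h (by positivity)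

set_option maxHeartbeats 1000000 in
/-- The large `N` expansion of the scaled resolvent at points far from the origin, with an
explicit rate. -/
theorem exists_norm_scaledResolvent_sub_le {β αt h : ℝ} (hβ : 0 < β) (hα : 0 < αt)
    (hh : h = √(β / 2) - 1 / √(β / 2)) : ∃ R : ℝ, ∀ s : ℂ, s.im ≠ 0 → R < ‖s‖ → ∃ C : ℝ,
    ∀ᶠ N : ℕ in atTop, ‖scaledResolvent N β αt s / N - (resolventZero αt s +
      resolventOne h αt s / ((N * √(β / 2) : ℝ) : ℂ) +
      resolventTwo h αt s / ((N * √(β / 2) : ℝ) : ℂ) ^ 2)‖ ≤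
      C * (1 / (N : ℝ) ^ 3 + (1 / 2) ^ (Nat.sqrt N - 2)) := by
  have hA := growthRate_ge (αt := αt) hβ
  set A := growthRate β αt with hA'
  have hA0 : 0 < A := by linarith
  have ha := leftEdge_pos hα
  set κ := β / 2 with hκ
  have hκ0 : 0 < κ := by positivity
  set η := 1 / κ - 1 with hη
  set ι := 1 / κ with hι
  obtain ⟨C₂, hC₂, hH⟩ := exists_abs_secondSeries_le hβ hα
  obtain ⟨C₃, hC₃, hV⟩ := exists_abs_correlator_sub_le hβ hα
  rw [← hκ, ← hη] at hH hV
  have hM : ∀ k, |coeff k (momentSeries αt)| ≤ 2 * (4 * A) ^ k :=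
    abs_momentSeries_le hα (by linarith)
  have hE : ∀ k, |coeff k (firstSeries η αt)| ≤ 2 * |η| * (4 * A) ^ k := fun k =>
    (abs_firstSeries_le hβ hα k).trans (by gcongr; linarith)
  have hH' : ∀ k, |coeff k (secondSeries η ι αt)| ≤ C₂ * (4 * A) ^ k := fun k =>
    (hH k).trans (by gcongr; linarith)
  -- Beyond this radius all series in `1 / s` are dominated by geometric series of ratio `1 / 2`,
  -- and the sign of the root is determined.
  refine ⟨8 * A + 4 * αt + 8 + 2 * leftEdge αt, fun s hs hR => ?_⟩
  have hs1 : 1 ≤ ‖s‖ := by linarith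
  have hs0 : 0 < ‖s‖ := by linarith
  have hz : 4 * A * ‖s⁻¹‖ ≤ 1 / 2 := by
    rw [norm_inv, ← div_eq_mul_inv, div_le_iff₀ hs0]
    linarith
  have hz1 : ‖s⁻¹‖ ≤ 1 := by
    rw [norm_inv]
    exact inv_le_one_of_one_le₀ hs1
  have hcut := notMem_cut_of_im_ne_zero αt hs
  obtain ⟨v, hv⟩ := HasEval.exists_of_le hM (by positivity) (hz.trans_lt (by norm_num))
  obtain ⟨e, he⟩ := HasEval.exists_of_le hE (by positivity) (hz.trans_lt (by norm_num))
  obtain ⟨q, hq⟩ := HasEval.exists_of_le hH' (by positivity) (hz.trans_lt (by norm_num))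
  have hsq : √κ ^ 2 = κ := Real.sq_sqrt hκ0.le
  have hsq0 : 0 < √κ := Real.sqrt_pos.2 hκ0
  have hηh : -(√κ * η) = h := by
    have : ι = 1 / √κ ^ 2 := by rw [hsq]
    rw [hh, hη, this]
    field_simp
    ring
  have e0 := eval_momentSeries hα hcut (by linarith) hv
  have e1 := eval_firstSeries (e := √κ) hα hcut (by linarith) hv he
  have e2 := eval_secondSeries (κ := κ) (h := h) hα (by rw [hι]; field_simp)
    (by rw [← hηh, neg_sq, mul_pow, hsq]) hcut (by linarith) hv hq
  rw [hηh] at e1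
  set B : ℝ := |s.im|⁻¹ with hB
  have hB0 : 0 ≤ B := by positivity
  refine ⟨2 * C₃ + 3 * B + 4 + 4 * |η| + 2 * C₂, ?_⟩
  filter_upwards [eventually_ge_atTop 4] with N hN
  have hN0 : 0 < N := by omega
  have hN' : (1 : ℝ) ≤ N := by exact_mod_cast hN0
  have hNpos : (0 : ℝ) < N := by linarith
  have hNC : (N : ℂ) ≠ 0 := by exact_mod_cast hN0.ne'
  -- The longest truncation for which the bounds on the correlators are available.
  set L := Nat.sqrt N - 2 with hL
  have h4 : 2 ≤ Nat.sqrt N := Nat.le_sqrt'.2 hN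
  have hLN : (L + 2) ^ 2 ≤ N := by
    rw [hL, Nat.sub_add_cancel h4]
    exact Nat.sqrt_le' N
  have hbd := hV N L hN0 hLN
  have main := norm_scaledResolvent_sub_le hN0 hβ hα hs L
  have tM := HasEval.norm_sum_sub_le hM (by positivity) hz hv L
  have tE := HasEval.norm_sum_sub_le hE (by positivity) hz he L
  have tH := HasEval.norm_sum_sub_le hH' (by positivity) hz hq L
  set H : ℝ := (1 / 2) ^ L with hHdef
  have hH0 : 0 ≤ H := by positivity
  set f : ℕ → ℝ := fun k => correlator N β αt {k} with hf
  set r : ℕ → ℝ := fun k => f k - coeff k (firstSeries η αt) -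
    coeff k (secondSeries η ι αt) / N with hr
  -- the remainder of the one-point correlator contributes at order `N ^ (-3)`
  have tR : ‖∑ k ∈ Finset.range L, ((r k : ℝ) : ℂ) * s⁻¹ ^ k‖ ≤ 2 * C₃ / N ^ 2 := by
    calc _ ≤ ∑ k ∈ Finset.range L, C₃ / N ^ 2 * (1 / 2) ^ k := by
          refine (norm_sum_le _ _).trans (Finset.sum_le_sum fun k hk => ?_)
          rw [norm_mul, Complex.norm_real, norm_pow, Real.norm_eq_abs]
          calc _ ≤ C₃ / N ^ 2 * (4 * A) ^ k * ‖s⁻¹‖ ^ k := by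
                gcongr
                exact hbd k (Finset.mem_range.1 hk).le
            _ = C₃ / N ^ 2 * (4 * A * ‖s⁻¹‖) ^ k := by rw [mul_pow]; ring
            _ ≤ _ := by gcongr
      _ ≤ C₃ / N ^ 2 * 2 := by
          rw [← Finset.mul_sum]
          refine mul_le_mul_of_nonneg_left ?_ (by positivity)
          have := Summable.sum_le_tsum (Finset.range L)
            (fun k _ => by positivity : ∀ k ∉ Finset.range L, (0 : ℝ) ≤ (1 / 2) ^ k)
            summable_geometric_two
          rwa [tsum_geometric_two] at this
      _ = _ := by ring
  have tL : ‖s‖⁻¹ ^ L * |s.im|⁻¹ * (N * limitMoment αt L + f L) ≤ 3 * N * B * H := by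
    have f1 : f L ≤ A ^ L := by
      have := abs_correlator_le hN0 hβ hα {L} (by simpa using hLN)
      simpa using (le_abs_self _).trans this
    have f2 := limitMoment_le hα (show 2 * αt + 4 ≤ A by linarith) L
    have f3 : N * limitMoment αt L + f L ≤ 3 * N * A ^ L := by
      have : A ^ L ≤ N * A ^ L := le_mul_of_one_le_left (by positivity) hN'
      nlinarith
    have f4 : (‖s‖⁻¹ * A) ^ L ≤ H := by
      rw [hHdef]
      gcongr
      rw [norm_inv] at hz
      nlinarith [inv_nonneg.2 hs0.le]
    calc _ ≤ ‖s‖⁻¹ ^ L * B * (3 * N * A ^ L) := by gcongr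
      _ = 3 * N * B * (‖s‖⁻¹ * A) ^ L := by rw [mul_pow]; ring
      _ ≤ _ := by gcongr
  have key : scaledResolvent N β αt s / N - (resolventZero αt s +
      resolventOne h αt s / ((N * √κ : ℝ) : ℂ) + resolventTwo h αt s / ((N * √κ : ℝ) : ℂ) ^ 2) =
      (scaledResolvent N β αt s - ∑ k ∈ Finset.range L,
        ((N * limitMoment αt k + f k : ℝ) : ℂ) * s⁻¹ ^ (k + 1)) / N +
      s⁻¹ * ((∑ k ∈ Finset.range L, ((coeff k (momentSeries αt) : ℝ) : ℂ) * s⁻¹ ^ k - v) +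
      (∑ k ∈ Finset.range L, ((coeff k (firstSeries η αt) : ℝ) : ℂ) * s⁻¹ ^ k - e) / N +
      (∑ k ∈ Finset.range L, ((coeff k (secondSeries η ι αt) : ℝ) : ℂ) * s⁻¹ ^ k - q) / N ^ 2 +
      (∑ k ∈ Finset.range L, ((r k : ℝ) : ℂ) * s⁻¹ ^ k) / N) := by
    have k0 : ∑ k ∈ Finset.range L, ((N * limitMoment αt k + f k : ℝ) : ℂ) * s⁻¹ ^ (k + 1) =
        s⁻¹ * (N * ∑ k ∈ Finset.range L, ((coeff k (momentSeries αt) : ℝ) : ℂ) * s⁻¹ ^ k +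
        ∑ k ∈ Finset.range L, ((coeff k (firstSeries η αt) : ℝ) : ℂ) * s⁻¹ ^ k +
        (∑ k ∈ Finset.range L, ((coeff k (secondSeries η ι αt) : ℝ) : ℂ) * s⁻¹ ^ k) / N +
        ∑ k ∈ Finset.range L, ((r k : ℝ) : ℂ) * s⁻¹ ^ k) := by
      rw [Finset.mul_sum, Finset.sum_div, ← Finset.sum_add_distrib, ← Finset.sum_add_distrib,
        ← Finset.sum_add_distrib, Finset.mul_sum]
      refine Finset.sum_congr rfl fun k _ => ?_
      simp only [hr, momentSeries, coeff_mk]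
      push_cast
      ring
    have hsC : ((√κ : ℝ) : ℂ) ^ 2 = κ := by exact_mod_cast hsq
    have hsC0 : ((√κ : ℝ) : ℂ) ≠ 0 := by exact_mod_cast hsq0.ne'
    have hκC0 : (κ : ℂ) ≠ 0 := by exact_mod_cast hκ0.ne'
    rw [k0, ← e0, ← e1, ← e2]
    push_cast
    rw [mul_pow, hsC]
    field_simp
    ring
  rw [key]
  have n1 : ‖(N : ℂ)‖ = N := by simp
  calc _ ≤ 3 * N * B * H / N + 1 * (2 * 2 * H + 2 * (2 * |η|) * H / N + 2 * C₂ * H / N ^ 2 +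
        2 * C₃ / N ^ 2 / N) := by
        refine (norm_add_le _ _).trans (add_le_add ?_ ?_)
        · rw [norm_div, n1]
          gcongr
          exact main.trans tL
        · rw [norm_mul]
          refine mul_le_mul hz1 ?_ (norm_nonneg _) zero_le_one
          refine (norm_add_le _ _).trans (add_le_add ((norm_add_le _ _).trans (add_le_add
            ((norm_add_le _ _).trans (add_le_add tM ?_)) ?_)) ?_)
          · rw [norm_div, n1]
            gcongr
          · rw [norm_div, norm_pow, n1]
            gcongr
          · rw [norm_div, n1]
            gcongr
    _ ≤ 3 * B * H + (4 * H + 4 * |η| * H + 2 * C₂ * H + 2 * C₃ * (1 / N ^ 3)) := by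
        have g1 : 3 * N * B * H / N = 3 * B * H := by field_simp
        have g2 : 2 * (2 * |η|) * H / N ≤ 4 * |η| * H := by
          refine (div_le_self (by positivity) hN').trans (le_of_eq (by ring))
        have g3 : 2 * C₂ * H / N ^ 2 ≤ 2 * C₂ * H :=
          div_le_self (by positivity) (one_le_pow₀ hN')
        have g4 : 2 * C₃ / N ^ 2 / N = 2 * C₃ * (1 / N ^ 3) := by field_simp
        rw [g1, g4]
        linarith
    _ ≤ _ := by
        have g5 : 0 ≤ 1 / (N : ℝ) ^ 3 := by positivity
        nlinarith [mul_nonneg hB0 g5, mul_nonneg (abs_nonneg η) g5, mul_nonneg hC₂ g5,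
          mul_nonneg hC₃ hH0]

/-- The coefficients of the expansion of the scaled resolvent. -/
def resolventCoeff (h αt : ℝ) : ℕ → ℂ → ℂ
  | 0 => resolventZero αt
  | 1 => resolventOne h αt
  | _ => resolventTwo h αt

theorem isResolventExpansion_resolventCoeff {β αt h : ℝ} (hβ : 0 < β) (hα : 0 < αt)
    (hh : h = √(β / 2) - 1 / √(β / 2)) : IsResolventExpansion β αt 2 (resolventCoeff h αt) := by
  refine ⟨fun l hl => ?_, ?_⟩
  · change DifferentiableOn ℂ _ (cut αt)ᶜ
    interval_cases l
    · exact differentiableOn_resolventZero hα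
    · exact differentiableOn_resolventOne h hα
    · exact differentiableOn_resolventTwo h hα
  · obtain ⟨R, hR⟩ := exists_norm_scaledResolvent_sub_le hβ hα hh
    refine ⟨R, fun s hs hsR => ?_⟩
    obtain ⟨C, hC⟩ := hR s hs hsR
    have h3 : (fun N : ℕ => 1 / (N : ℝ) ^ 3) =o[atTop] fun N : ℕ => (1 / (N : ℝ)) ^ 2 := by
      rw [Asymptotics.isLittleO_iff_tendsto']
      · refine tendsto_one_div_atTop_nhds_zero_nat.congr' ?_
        filter_upwards [eventually_gt_atTop 0] with N hN
        have : (0 : ℝ) < N := by exact_mod_cast hN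
        field_simp
      · filter_upwards [eventually_gt_atTop 0] with N hN h
        have : (0 : ℝ) < N := by exact_mod_cast hN
        exact absurd h (by positivity)
    refine Asymptotics.IsBigO.trans_isLittleO (Asymptotics.IsBigO.of_bound C ?_)
      (h3.add isLittleO_half_pow_sqrt)
    filter_upwards [hC] with N hN
    have : (0 : ℝ) ≤ 1 / (N : ℝ) ^ 3 + (1 / 2) ^ (Nat.sqrt N - 2) := by positivity
    rw [Real.norm_of_nonneg this]
    refine le_trans (le_of_eq ?_) hN
    simp [Finset.sum_range_succ, resolventCoeff]

end

/-! ### Boundary values in the sense of distributions -/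

section

open scoped ContDiff ComplexConjugate

/-- Complex test functions on the line: smooth with compact support. -/
structure IsTest (φ : ℝ → ℂ) : Prop where
  contDiff : ContDiff ℝ ∞ φ
  hasCompactSupport : HasCompactSupport φ

namespace IsTest

variable {φ : ℝ → ℂ}

lemma continuous (hφ : IsTest φ) : Continuous φ := hφ.contDiff.continuous

lemma differentiable (hφ : IsTest φ) : Differentiable ℝ φ :=
  hφ.contDiff.differentiable (by simp)

lemma hasDerivAt (hφ : IsTest φ) (x : ℝ) : HasDerivAt φ (deriv φ x) x :=
  (hφ.differentiable x).hasDerivAt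

lemma deriv (hφ : IsTest φ) : IsTest (deriv φ) :=
  ⟨ContDiff.iterate_deriv 1 hφ.contDiff, hφ.hasCompactSupport.deriv⟩

lemma exists_support (hφ : IsTest φ) : ∃ R : ℝ, ∀ x, R < |x| → φ x = 0 := by
  obtain ⟨R, hR⟩ := hφ.hasCompactSupport.isCompact.isBounded.exists_norm_le
  refine ⟨R, fun x hx => ?_⟩
  by_contra h
  exact absurd (hR x (subset_tsupport _ h)) (by simpa using hx)

end IsTest

/-- The jump `F(x - i0) - F(x + i0)` across the real line of a function analytic off the line
exists in the sense of distributions, and is the linear functional `T`. -/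
def HasJump (F : ℂ → ℂ) (T : (ℝ → ℂ) → ℂ) : Prop :=
  DifferentiableOn ℂ F {s | s.im ≠ 0} ∧ ∀ φ, IsTest φ →
    Tendsto (fun ε : ℝ => ∫ x : ℝ, (F (x - ε * Complex.I) - F (x + ε * Complex.I)) * φ x)
      (𝓝[>] 0) (𝓝 (T φ))

lemma isOpen_im_ne_zero : IsOpen {s : ℂ | s.im ≠ 0} :=
  isOpen_ne_fun Complex.continuous_im continuous_const

lemma hasDerivAt_shift {F : ℂ → ℂ} (hF : DifferentiableOn ℂ F {s | s.im ≠ 0}) {ε : ℝ}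
    (hε : ε ≠ 0) (x : ℝ) :
    HasDerivAt (fun x : ℝ => F (x + ε * Complex.I)) (deriv F (x + ε * Complex.I)) x := by
  have h1 : HasDerivAt F (deriv F (x + ε * Complex.I)) ((x : ℂ) + ε * Complex.I) :=
    (hF.differentiableAt (isOpen_im_ne_zero.mem_nhds (by simpa using hε))).hasDerivAt
  have h2 : HasDerivAt (fun z : ℂ => z + ε * Complex.I) 1 (x : ℂ) :=
    (hasDerivAt_id _).add_const _
  simpa using (HasDerivAt.comp (x : ℂ) h1 h2).comp_ofReal

lemma continuous_shift {F : ℂ → ℂ} (hF : DifferentiableOn ℂ F {s | s.im ≠ 0}) {ε : ℝ}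
    (hε : ε ≠ 0) : Continuous fun x : ℝ => F (x + ε * Complex.I) :=
  continuous_iff_continuousAt.2 fun x => (hasDerivAt_shift hF hε x).continuousAt

lemma sub_shift_eq (x ε : ℝ) : (x - ε * Complex.I : ℂ) = x + (-ε : ℝ) * Complex.I := by
  push_cast
  ring

lemma integrable_shift_mul {F : ℂ → ℂ} (hF : DifferentiableOn ℂ F {s | s.im ≠ 0}) {ε : ℝ}
    (hε : ε ≠ 0) {φ : ℝ → ℂ} (hφ : IsTest φ) :
    Integrable fun x : ℝ => F (x + ε * Complex.I) * φ x :=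
  ((continuous_shift hF hε).mul hφ.continuous).integrable_of_hasCompactSupport
    hφ.hasCompactSupport.mul_left

lemma integrable_jump_mul {F : ℂ → ℂ} (hF : DifferentiableOn ℂ F {s | s.im ≠ 0}) {ε : ℝ}
    (hε : ε ≠ 0) {φ : ℝ → ℂ} (hφ : IsTest φ) :
    Integrable fun x : ℝ => (F (x - ε * Complex.I) - F (x + ε * Complex.I)) * φ x := by
  simp_rw [sub_mul, sub_shift_eq]
  exact (integrable_shift_mul hF (neg_ne_zero.2 hε) hφ).sub (integrable_shift_mul hF hε hφ)

namespace HasJump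

variable {F G : ℂ → ℂ} {T U : (ℝ → ℂ) → ℂ}

lemma add (hF : HasJump F T) (hG : HasJump G U) :
    HasJump (fun s => F s + G s) fun φ => T φ + U φ := by
  refine ⟨hF.1.add hG.1, fun φ hφ => ((hF.2 φ hφ).add (hG.2 φ hφ)).congr' ?_⟩
  filter_upwards [self_mem_nhdsWithin] with ε (hε : 0 < ε)
  rw [← integral_add (integrable_jump_mul hF.1 hε.ne' hφ) (integrable_jump_mul hG.1 hε.ne' hφ)]
  refine integral_congr_ae (.of_forall fun x => ?_)
  ring

lemma const_mul (c : ℂ) (hF : HasJump F T) : HasJump (fun s => c * F s) fun φ => c * T φ := by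
  refine ⟨hF.1.const_mul c, fun φ hφ => ((hF.2 φ hφ).const_mul c).congr' ?_⟩
  filter_upwards with ε
  rw [← integral_const_mul]
  refine integral_congr_ae (.of_forall fun x => ?_)
  ring

lemma congr (hF : HasJump F T) (h : ∀ s : ℂ, s.im ≠ 0 → G s = F s) : HasJump G T := by
  refine ⟨hF.1.congr h, fun φ hφ => (hF.2 φ hφ).congr' ?_⟩
  filter_upwards [self_mem_nhdsWithin] with ε (hε : 0 < ε)
  refine integral_congr_ae (.of_forall fun x => ?_)
  simp only
  rw [h _ (by simpa using hε.ne'), h _ (by simpa using hε.ne')]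

/-- The jump of the derivative is the distributional derivative of the jump. -/
lemma deriv (hF : HasJump F T) : HasJump (deriv F) fun φ => -T (deriv φ) := by
  refine ⟨hF.1.deriv isOpen_im_ne_zero, fun φ hφ => (hF.2 _ hφ.deriv).neg.congr' ?_⟩
  filter_upwards [self_mem_nhdsWithin] with ε (hε : 0 < ε)
  have hd : DifferentiableOn ℂ (_root_.deriv F) {s | s.im ≠ 0} := hF.1.deriv isOpen_im_ne_zero
  have h1 : ∀ x : ℝ, HasDerivAt
      (fun x : ℝ => F (x - ε * Complex.I) - F (x + ε * Complex.I))
      (_root_.deriv F (x - ε * Complex.I) - _root_.deriv F (x + ε * Complex.I)) x := fun x => by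
    simp_rw [sub_shift_eq]
    exact (hasDerivAt_shift hF.1 (neg_ne_zero.2 hε.ne') x).sub (hasDerivAt_shift hF.1 hε.ne' x)
  have h2 := integral_mul_deriv_eq_deriv_mul_of_integrable (fun x _ => h1 x)
    (fun x _ => hφ.hasDerivAt x) (integrable_jump_mul hF.1 hε.ne' hφ.deriv)
    (integrable_jump_mul hd hε.ne' hφ) (integrable_jump_mul hF.1 hε.ne' hφ)
  rw [h2, neg_neg]

/-- A function commuting with conjugation that is dominated near the line and converges there
almost everywhere has a jump, given by integration of the pointwise one. -/
lemma of_dominated {f : ℝ → ℂ} {g : ℝ → ℝ} (hF : DifferentiableOn ℂ F {s | s.im ≠ 0})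
    (hconj : ∀ s : ℂ, s.im ≠ 0 → F (conj s) = conj (F s))
    (hlim : ∀ᵐ x : ℝ, Tendsto (fun ε : ℝ => F (x + ε * Complex.I)) (𝓝[>] 0) (𝓝 (f x)))
    (hg : ∀ R, IntegrableOn g (Icc (-R) R))
    (hbound : ∀ R : ℝ, ∃ M : ℝ, 0 ≤ M ∧
      ∀ᵐ x : ℝ, |x| ≤ R → ∀ ε ∈ Ioo (0 : ℝ) 1, ‖F (x + ε * Complex.I)‖ ≤ M * g x) :
    HasJump F fun φ => ∫ x : ℝ, (conj (f x) - f x) * φ x := by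
  refine ⟨hF, fun φ hφ => ?_⟩
  obtain ⟨R, hR⟩ := hφ.exists_support
  obtain ⟨C, hC⟩ := hφ.hasCompactSupport.exists_bound_of_continuous hφ.continuous
  obtain ⟨M, hM, hb⟩ := hbound R
  have hc : ∀ x ε : ℝ, ε ≠ 0 →
      F (x - ε * Complex.I) = conj (F (x + ε * Complex.I)) := fun x ε hε => by
    rw [← hconj _ (by simpa using hε)]
    congr 1
    simp [sub_eq_add_neg]
  refine tendsto_integral_filter_of_dominated_convergence
    ((Icc (-R) R).indicator fun x => 2 * M * C * g x) ?_ ?_ ?_ ?_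
  · filter_upwards [self_mem_nhdsWithin] with ε (hε : 0 < ε)
    exact (integrable_jump_mul hF hε.ne' hφ).aestronglyMeasurable
  · filter_upwards [Ioo_mem_nhdsGT one_pos] with ε hε
    filter_upwards [hb] with x hx
    by_cases hxR : |x| ≤ R
    · rw [indicator_of_mem (show x ∈ Icc (-R) R from abs_le.1 hxR), hc x ε hε.1.ne', norm_mul]
      have h1 : ‖conj (F (x + ε * Complex.I)) - F (x + ε * Complex.I)‖ ≤ 2 * (M * g x) := by
        refine (norm_sub_le _ _).trans ?_
        rw [RCLike.norm_conj]
        linarith [hx hxR ε hε]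
      have h2 : 0 ≤ M * g x := (norm_nonneg _).trans (hx hxR ε hε)
      refine (mul_le_mul h1 (hC x) (norm_nonneg _) (by linarith)).trans (le_of_eq ?_)
      ring
    · rw [hR x (not_le.1 hxR), indicator_of_notMem (by rwa [mem_Icc, ← abs_le])]
      simp
  · exact IntegrableOn.integrable_indicator ((hg R).const_mul _) measurableSet_Icc
  · filter_upwards [hlim] with x hx
    refine Tendsto.congr' (f₁ := fun ε : ℝ =>
      (conj (F (x + ε * Complex.I)) - F (x + ε * Complex.I)) * φ x) ?_ ?_
    · filter_upwards [self_mem_nhdsWithin] with ε (hε : 0 < ε)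
      rw [hc x ε hε.ne']
    · exact (((Complex.continuous_conj.tendsto _).comp hx).sub hx).mul_const _

end HasJump

lemma integrableOn_inv_sqrt_abs_sub (c R : ℝ) :
    IntegrableOn (fun x => (√|x - c|)⁻¹) (Icc (-R) R) := by
  have h0 : ∀ A : ℝ, 0 ≤ A → IntervalIntegrable (fun x => (√|x|)⁻¹) volume 0 A := fun A hA => by
    refine (intervalIntegral.intervalIntegrable_rpow' (r := -(1 / 2)) (by norm_num)).congr ?_
    intro x hx
    rw [uIoc_of_le hA] at hx
    simp only
    rw [abs_of_pos hx.1, Real.sqrt_eq_rpow, Real.rpow_neg hx.1.le]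
  have h1 : ∀ A : ℝ, 0 ≤ A → IntervalIntegrable (fun x => (√|x|)⁻¹) volume (-A) 0 := fun A hA => by
    have := (IntervalIntegrable.iff_comp_neg (f := fun x : ℝ => (√|x|)⁻¹)).1 (h0 A hA)
    simpa using this.symm
  set A := |R| + |c| with hA
  have hA0 : 0 ≤ A := by positivity
  have h2 := ((h1 A hA0).trans (h0 A hA0)).comp_sub_right c
  have h3 : -A + c ≤ A + c := by linarith
  rw [intervalIntegrable_iff_integrableOn_Icc_of_le h3] at h2
  refine h2.mono_set (Icc_subset_Icc ?_ ?_)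
  · have := le_abs_self R
    have := le_abs_self c
    linarith
  · have := le_abs_self R
    have := neg_abs_le c
    linarith

lemma inv_sqrt_mul_sqrt_le {a b : ℝ} (hab : a < b) (x : ℝ) :
    (√|x - a| * √|x - b|)⁻¹ ≤ (√((b - a) / 2))⁻¹ * ((√|x - a|)⁻¹ + (√|x - b|)⁻¹) := by
  set d := (b - a) / 2 with hd
  have hd0 : 0 < d := by rw [hd]; linarith
  rw [mul_inv, mul_add]
  rcases le_total d |x - a| with h | h
  · have h2 : (√|x - a|)⁻¹ ≤ (√d)⁻¹ :=
      inv_anti₀ (Real.sqrt_pos.2 hd0) (Real.sqrt_le_sqrt h)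
    have h3 : 0 ≤ (√d)⁻¹ * (√|x - a|)⁻¹ := by positivity
    nlinarith [mul_le_mul_of_nonneg_right h2 (by positivity : 0 ≤ (√|x - b|)⁻¹)]
  · have h4 : d ≤ |x - b| := by
      have := abs_sub_le b x a
      rw [abs_of_pos (by linarith : 0 < b - a), abs_sub_comm b x] at this
      linarith
    have h2 : (√|x - b|)⁻¹ ≤ (√d)⁻¹ :=
      inv_anti₀ (Real.sqrt_pos.2 hd0) (Real.sqrt_le_sqrt h4)
    have h3 : 0 ≤ (√d)⁻¹ * (√|x - b|)⁻¹ := by positivity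
    nlinarith [mul_le_mul_of_nonneg_right h2 (by positivity : 0 ≤ (√|x - a|)⁻¹)]

lemma continuousOn_cpow_inv_two : ContinuousOn (fun z : ℂ => z ^ (2⁻¹ : ℂ)) {z | 0 ≤ z.im} := by
  intro z hz
  by_cases h : 0 ≤ z.re ∨ z.im ≠ 0
  · exact (Complex.continuousAt_cpow_const_of_re_pos h (by norm_num)).continuousWithinAt
  push Not at h
  have hz0 : z ≠ 0 := fun h0 => by simp [h0] at h
  have h1 := Complex.continuousWithinAt_log_of_re_neg_of_im_zero h.1 h.2
  have h2 : ContinuousWithinAt (fun z : ℂ => Complex.exp (Complex.log z * 2⁻¹)) {z | 0 ≤ z.im} z :=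
    Complex.continuous_exp.continuousAt.comp_continuousWithinAt (h1.mul_const _)
  refine h2.congr_of_eventuallyEq ?_ (Complex.cpow_def_of_ne_zero hz0 _)
  filter_upwards [mem_nhdsWithin_of_mem_nhds (isOpen_ne.mem_nhds hz0)] with w hw
  exact Complex.cpow_def_of_ne_zero hw _

lemma ofReal_cpow_inv_two (t : ℝ) :
    (t : ℂ) ^ (2⁻¹ : ℂ) = if 0 ≤ t then (√t : ℂ) else √(-t) * Complex.I := by
  have h : ∀ u : ℝ, 0 ≤ u → (u : ℂ) ^ (2⁻¹ : ℂ) = √u := fun u hu => by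
    rw [Real.sqrt_eq_rpow, Complex.ofReal_cpow hu]
    norm_num
  split_ifs with ht
  · exact h t ht
  · rw [Complex.ofReal_cpow_of_nonpos (not_le.1 ht).le, ← Complex.ofReal_neg,
      h _ (by linarith), show (Real.pi * Complex.I * 2⁻¹ : ℂ) = Real.pi / 2 * Complex.I by ring,
      Complex.exp_pi_div_two_mul_I]

/-- The continuous extension of `root` from the upper half plane to its closure. -/
def upperRoot (αt : ℝ) (s : ℂ) : ℂ :=
  (s - leftEdge αt) ^ (2⁻¹ : ℂ) * (s - rightEdge αt) ^ (2⁻¹ : ℂ)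

section upperRoot

variable {αt : ℝ}

lemma continuousOn_upperRoot (αt : ℝ) : ContinuousOn (upperRoot αt) {s | 0 ≤ s.im} := by
  refine ContinuousOn.mul ?_ ?_
  · exact continuousOn_cpow_inv_two.comp (f := fun s : ℂ => s - (leftEdge αt : ℂ))
      (by fun_prop) fun s hs => by simpa using hs
  · exact continuousOn_cpow_inv_two.comp (f := fun s : ℂ => s - (rightEdge αt : ℂ))
      (by fun_prop) fun s hs => by simpa using hs

lemma upperRoot_sq (αt : ℝ) (s : ℂ) :
    upperRoot αt s ^ 2 = (s - leftEdge αt) * (s - rightEdge αt) := by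
  rw [upperRoot, mul_pow, cpow_inv_two_sq, cpow_inv_two_sq]

lemma root_eq_upperRoot {s : ℂ} (hs : 0 < s.im) : root αt s = upperRoot αt s := by
  have hu : 0 < (s - leftEdge αt).im := by simpa using hs
  have hv : 0 < (s - rightEdge αt).im := by simpa using hs
  rw [root, upperRoot]
  set u := s - (leftEdge αt : ℂ)
  set v := s - (rightEdge αt : ℂ)
  have hu0 : u ≠ 0 := fun h => by simp [h] at hu
  have hv0 : v ≠ 0 := fun h => by simp [h] at hv
  have harg : ∀ w : ℂ, 0 < w.im → 0 ≤ w.arg ∧ w.arg < Real.pi := fun w hw =>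
    ⟨Complex.arg_nonneg_iff.2 hw.le, Complex.arg_lt_pi_iff.2 (Or.inr hw.ne')⟩
  have h1 := harg u hu
  have h2 := harg v hv
  -- Both arguments lie in `(0, π)`, so their difference is again a principal argument.
  have h3 : Complex.log (v / u) = Complex.log v - Complex.log u := by
    rw [← Complex.log_exp (x := Complex.log v - Complex.log u), Complex.exp_sub,
      Complex.exp_log hu0, Complex.exp_log hv0]
    · simp only [Complex.sub_im, Complex.log_im]
      linarith [h1.1, h1.2, h2.1, h2.2]
    · simp only [Complex.sub_im, Complex.log_im]
      linarith [h1.1, h1.2, h2.1, h2.2]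
  have h4 : (v / u) ^ (2⁻¹ : ℂ) = v ^ (2⁻¹ : ℂ) / u ^ (2⁻¹ : ℂ) := by
    rw [Complex.cpow_def_of_ne_zero (div_ne_zero hv0 hu0), Complex.cpow_def_of_ne_zero hu0,
      Complex.cpow_def_of_ne_zero hv0, h3, ← Complex.exp_sub]
    ring_nf
  have h5 : u ^ (2⁻¹ : ℂ) ≠ 0 := by simp [Complex.cpow_eq_zero_iff, hu0]
  rw [h4, mul_div_assoc', div_eq_iff h5]
  linear_combination -v ^ (2⁻¹ : ℂ) * cpow_inv_two_sq u

lemma upperRoot_of_mem_Ioo {x : ℝ} (hx : x ∈ Ioo (leftEdge αt) (rightEdge αt)) :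
    upperRoot αt x = √((x - leftEdge αt) * (rightEdge αt - x)) * Complex.I := by
  rw [upperRoot, ← Complex.ofReal_sub, ← Complex.ofReal_sub, ofReal_cpow_inv_two,
    ofReal_cpow_inv_two, if_pos (by linarith [hx.1]), if_neg (by linarith [hx.2]),
    Real.sqrt_mul (by linarith [hx.1]), neg_sub, Complex.ofReal_mul, mul_assoc]

lemma upperRoot_of_lt (hα : 0 < αt) {x : ℝ} (hx : x < leftEdge αt) :
    upperRoot αt x = (-(√(leftEdge αt - x) * √(rightEdge αt - x)) : ℝ) := by
  have := leftEdge_lt_rightEdge hα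
  rw [upperRoot, ← Complex.ofReal_sub, ← Complex.ofReal_sub, ofReal_cpow_inv_two,
    ofReal_cpow_inv_two, if_neg (by linarith), if_neg (by linarith), neg_sub, neg_sub]
  push_cast
  linear_combination (√(leftEdge αt - x) * √(rightEdge αt - x) : ℂ) * Complex.I_sq

lemma upperRoot_of_gt (hα : 0 < αt) {x : ℝ} (hx : rightEdge αt < x) :
    upperRoot αt x = (√(x - leftEdge αt) * √(x - rightEdge αt) : ℝ) := by
  have := leftEdge_lt_rightEdge hα
  rw [upperRoot, ← Complex.ofReal_sub, ← Complex.ofReal_sub, ofReal_cpow_inv_two,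
    ofReal_cpow_inv_two, if_pos (by linarith), if_pos (by linarith)]
  push_cast
  ring

lemma conj_upperRoot (hα : 0 < αt) {x : ℝ} (hx : x ∉ Icc (leftEdge αt) (rightEdge αt)) :
    conj (upperRoot αt x) = upperRoot αt x := by
  rcases lt_or_ge x (leftEdge αt) with h | h
  · rw [upperRoot_of_lt hα h, Complex.conj_ofReal]
  · rw [upperRoot_of_gt hα (not_le.1 fun h' => hx ⟨h, h'⟩), Complex.conj_ofReal]

lemma sub_add_upperRoot_ne_zero (hα : 0 < αt) (s : ℂ) : s - αt + upperRoot αt s ≠ 0 := by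
  intro h
  have h1 := upperRoot_sq αt s
  have h2 : (leftEdge αt : ℂ) * rightEdge αt = αt ^ 2 := by
    exact_mod_cast leftEdge_mul_rightEdge hα
  have h3 : (leftEdge αt : ℂ) + rightEdge αt = 2 * (αt + 2) := by
    exact_mod_cast leftEdge_add_rightEdge hα
  have h4 : s = 0 := by
    have : upperRoot αt s = -(s - αt) := by linear_combination h
    rw [this] at h1
    linear_combination (1 / 4) * (h1 + h2 - s * h3)
  rw [h4, ← Complex.ofReal_zero, upperRoot_of_lt hα (leftEdge_pos hα)] at h
  norm_cast at h
  have : 0 ≤ √(leftEdge αt - 0) * √(rightEdge αt - 0) := by positivity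
  linarith

lemma conj_root (hα : 0 < αt) {s : ℂ} (hs : s.im ≠ 0) : root αt (conj s) = conj (root αt s) := by
  have h := div_mem_slitPlane hα (notMem_cut_of_im_ne_zero αt hs)
  have h1 : conj ((s - rightEdge αt) / (s - leftEdge αt)) =
      (conj s - rightEdge αt) / (conj s - leftEdge αt) := by simp
  have h2 : conj (2⁻¹ : ℂ) = 2⁻¹ := by
    rw [map_inv₀]
    exact congrArg _ (Complex.conj_ofNat 2)
  rw [root, root, map_mul, ← h1, Complex.conj_cpow _ _ (Complex.slitPlane_arg_ne_pi h), h2]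
  simp

/-- A quotient by the square root is dominated near the line by the inverse square root
singularities at the endpoints of the cut. -/
lemma hasJump_of_mul_root {F G : ℂ → ℂ} (hα : 0 < αt) (hF : DifferentiableOn ℂ F {s | s.im ≠ 0})
    (hconj : ∀ s : ℂ, s.im ≠ 0 → F (conj s) = conj (F s)) (hG : ContinuousOn G {s | 0 ≤ s.im})
    (hFG : ∀ s : ℂ, 0 < s.im → F s = G s / upperRoot αt s) :
    HasJump F fun φ => ∫ x : ℝ, (conj (G x / upperRoot αt x) - G x / upperRoot αt x) * φ x := by
  have hab := leftEdge_lt_rightEdge hα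
  set a := leftEdge αt
  set b := rightEdge αt
  have hne : ∀ᵐ x : ℝ, x ∉ ({a, b} : Set ℝ) := (toFinite _).countable.ae_notMem volume
  have him : ∀ x ε : ℝ, (x + ε * Complex.I : ℂ).im = ε := by simp
  refine HasJump.of_dominated (g := fun x => (√|x - a|)⁻¹ + (√|x - b|)⁻¹) hF hconj ?_
    (fun R => (integrableOn_inv_sqrt_abs_sub a R).add (integrableOn_inv_sqrt_abs_sub b R)) ?_
  · filter_upwards [hne] with x hx
    have hx0 : upperRoot αt x ≠ 0 := by
      intro h
      have := upperRoot_sq αt x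
      rw [h, zero_pow two_ne_zero, eq_comm, mul_eq_zero, sub_eq_zero, sub_eq_zero] at this
      exact hx (by exact_mod_cast this)
    have h1 : Tendsto (fun ε : ℝ => (x + ε * Complex.I : ℂ)) (𝓝[>] 0) (𝓝[{s | 0 ≤ s.im}] x) := by
      refine tendsto_nhdsWithin_iff.2 ⟨?_, ?_⟩
      · have : Continuous fun ε : ℝ => (x + ε * Complex.I : ℂ) := by fun_prop
        have h2 := (this.tendsto 0).mono_left (nhdsWithin_le_nhds (s := Ioi 0))
        simpa using h2
      · filter_upwards [self_mem_nhdsWithin] with ε (hε : 0 < ε)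
        simpa using hε.le
    have hx1 : (x : ℂ) ∈ {s : ℂ | 0 ≤ s.im} := by simp
    refine (((hG x hx1).tendsto.comp h1).div ((continuousOn_upperRoot αt x hx1).tendsto.comp h1)
      hx0).congr' ?_
    filter_upwards [self_mem_nhdsWithin] with ε (hε : 0 < ε)
    exact (hFG _ (by rwa [him])).symm
  · intro R
    obtain ⟨K, hK⟩ : ∃ K, ∀ s ∈ Icc (-R) R ×ℂ Icc (0 : ℝ) 1, ‖G s‖ ≤ K :=
      (isCompact_Icc.reProdIm isCompact_Icc).exists_bound_of_continuousOn
        (hG.mono fun s hs => hs.2.1)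
    set d := (b - a) / 2 with hd
    have hd0 : 0 < d := by rw [hd]; linarith
    refine ⟨|K| * (√d)⁻¹, by positivity, ?_⟩
    filter_upwards [hne] with x hx hxR ε hε
    have hxa : 0 < |x - a| := abs_pos.2 (sub_ne_zero.2 fun h => hx (by simp [h]))
    have hxb : 0 < |x - b| := abs_pos.2 (sub_ne_zero.2 fun h => hx (by simp [h]))
    have h1 : √|x - a| * √|x - b| ≤ ‖upperRoot αt (x + ε * Complex.I)‖ := by
      rw [← Real.sqrt_mul (abs_nonneg _)]
      refine Real.sqrt_le_iff.2 ⟨norm_nonneg _, ?_⟩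
      rw [← norm_pow, upperRoot_sq, norm_mul]
      have h2 : ∀ c : ℝ, |x - c| ≤ ‖(x + ε * Complex.I - c : ℂ)‖ := fun c => by
        simpa using Complex.abs_re_le_norm (x + ε * Complex.I - c : ℂ)
      exact mul_le_mul (h2 a) (h2 b) (abs_nonneg _) (norm_nonneg _)
    rw [hFG _ (by rw [him]; exact hε.1), norm_div, mul_assoc, div_eq_mul_inv]
    refine mul_le_mul ((hK _ ⟨?_, ?_⟩).trans (le_abs_self K)) ?_ (by positivity) (abs_nonneg _)
    · simpa using abs_le.1 hxR
    · simpa using ⟨hε.1.le, hε.2.le⟩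
    refine (inv_anti₀ (by positivity) h1).trans ?_
    exact inv_sqrt_mul_sqrt_le hab x

end upperRoot

end

/-! ### The jumps of the coefficients across the cut -/

section

open scoped ContDiff ComplexConjugate

lemma HasJump.of_hasDerivAt {F F' : ℂ → ℂ} {T : (ℝ → ℂ) → ℂ} (hF : HasJump F T)
    (h : ∀ s : ℂ, s.im ≠ 0 → HasDerivAt F (F' s) s) : HasJump F' fun φ => -T (_root_.deriv φ) :=
  hF.deriv.congr fun s hs => (h s hs).deriv.symm

lemma HasJump.congr_right {F : ℂ → ℂ} {T U : (ℝ → ℂ) → ℂ} (hF : HasJump F T)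
    (h : ∀ φ, IsTest φ → U φ = T φ) : HasJump F U :=
  ⟨hF.1, fun φ hφ => by rw [h φ hφ]; exact hF.2 φ hφ⟩

lemma integrableOn_abs_log_abs_sub (c R : ℝ) :
    IntegrableOn (fun x => |Real.log (|x - c|)|) (Icc (-R) R) := by
  have h1 : IntervalIntegrable (fun x => Real.log (x - c)) volume (-R) R := by
    have := (intervalIntegral.intervalIntegrable_log' (a := -R - c) (b := R - c)).comp_sub_right c
    simpa using this
  rcases le_total (-R) R with h | h
  · rw [intervalIntegrable_iff_integrableOn_Icc_of_le h] at h1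
    simp_rw [Real.log_abs]
    exact Integrable.abs h1
  · refine integrableOn_Icc_iff_integrableOn_Ioc (by finiteness) |>.2 ?_
    rw [Ioc_eq_empty_of_le h]
    exact integrableOn_empty

lemma sub_ofReal_mem_slitPlane {s : ℂ} (hs : s.im ≠ 0) (c : ℝ) : s - c ∈ Complex.slitPlane :=
  Complex.mem_slitPlane_iff.2 (Or.inr (by simpa using hs))

lemma hasJump_log (c : ℝ) :
    HasJump (fun s => Complex.log (s - c)) fun φ =>
      -(2 * Real.pi * Complex.I) * ∫ x in Iic c, φ x := by
  have him : ∀ x ε : ℝ, (x + ε * Complex.I - c : ℂ).im = ε := by simp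
  have hne : ∀ᵐ x : ℝ, x ∉ ({c} : Set ℝ) := (toFinite _).countable.ae_notMem volume
  have key := HasJump.of_dominated (F := fun s => Complex.log (s - c))
    (f := fun x => Complex.log ((x - c : ℝ) : ℂ))
    (g := fun x => |Real.log (|x - c|)| + (|x - c| + 1 + Real.pi)) ?_ ?_ ?_ ?_ ?_
  · refine key.congr_right fun φ _ => ?_
    rw [← integral_indicator measurableSet_Iic, ← integral_const_mul]
    refine integral_congr_ae ?_
    filter_upwards [hne] with x hx
    rcases lt_or_gt_of_ne (show x ≠ c from hx) with h | h
    · rw [indicator_of_mem (show x ∈ Iic c from h.le)]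
      have : (Complex.log ((x - c : ℝ) : ℂ)).im = Real.pi := by
        rw [Complex.log_im, Complex.arg_ofReal_of_neg (by linarith)]
      have h2 : conj (Complex.log ((x - c : ℝ) : ℂ)) - Complex.log ((x - c : ℝ) : ℂ) =
          -(2 * Real.pi * Complex.I) := by
        apply Complex.ext
        · simp
        · rw [Complex.sub_im, Complex.conj_im, this]
          simp
          ring
      rw [h2]
    · rw [indicator_of_notMem (show x ∉ Iic c from not_le.2 h), ← Complex.ofReal_log (by linarith),
        Complex.conj_ofReal]
      simp
  · intro s hs
    have h1 : DifferentiableAt ℂ (fun s : ℂ => s - (c : ℂ)) s := by fun_prop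
    exact (h1.clog (sub_ofReal_mem_slitPlane hs c)).differentiableWithinAt
  · intro s hs
    rw [← Complex.log_conj _ (Complex.slitPlane_arg_ne_pi (sub_ofReal_mem_slitPlane hs c))]
    simp
  · filter_upwards [hne] with x hx
    have hcont : ContinuousWithinAt Complex.log {z : ℂ | 0 ≤ z.im} ((x - c : ℝ) : ℂ) := by
      rcases lt_or_gt_of_ne (show x ≠ c from hx) with h | h
      · exact Complex.continuousWithinAt_log_of_re_neg_of_im_zero
          (by rw [Complex.ofReal_re]; linarith) (Complex.ofReal_im _)
      · refine (continuousAt_clog ?_).continuousWithinAt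
        rw [Complex.ofReal_mem_slitPlane]
        linarith
    refine hcont.tendsto.comp (tendsto_nhdsWithin_iff.2 ⟨?_, ?_⟩)
    · have : Continuous fun ε : ℝ => (x + ε * Complex.I - c : ℂ) := by fun_prop
      have h2 := (this.tendsto 0).mono_left (nhdsWithin_le_nhds (s := Ioi 0))
      simpa using h2
    · filter_upwards [self_mem_nhdsWithin] with ε (hε : 0 < ε)
      simpa using hε.le
  · intro R
    refine (integrableOn_abs_log_abs_sub c R).add (Continuous.integrableOn_Icc ?_)
    fun_prop
  · intro R
    refine ⟨1, zero_le_one, ?_⟩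
    filter_upwards [hne] with x hx _ ε hε
    have hxc : 0 < |x - c| := abs_pos.2 (sub_ne_zero.2 hx)
    rw [one_mul]
    set z : ℂ := x + ε * Complex.I - c with hz
    have h1 : |x - c| ≤ ‖z‖ := by simpa [hz] using Complex.abs_re_le_norm z
    have h2 : ‖z‖ ≤ |x - c| + 1 := by
      have h3 := Complex.norm_le_abs_re_add_abs_im z
      have h4 : z.re = x - c := by simp [hz]
      rw [h4, him, abs_of_pos hε.1] at h3
      linarith [hε.2]
    have h3 : |Real.log ‖z‖| ≤ |Real.log (|x - c|)| + (|x - c| + 1) := by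
      rw [abs_le]
      have h4 := Real.log_le_log hxc h1
      have h5 := Real.log_le_self (norm_nonneg z)
      constructor
      · linarith [neg_abs_le (Real.log (|x - c|))]
      · linarith [abs_nonneg (Real.log (|x - c|))]
    have h4 : ‖Complex.log z‖ ≤ |Real.log ‖z‖| + |z.arg| := by
      simpa [Complex.log_re, Complex.log_im] using Complex.norm_le_abs_re_add_abs_im (Complex.log z)
    linarith [Complex.abs_arg_le_pi z]

/-- The jump of a simple pole is a delta function. -/
lemma hasJump_inv_sub (c : ℝ) :
    HasJump (fun s => 1 / (s - c)) fun φ => 2 * Real.pi * Complex.I * φ c := by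
  have h := (hasJump_log c).of_hasDerivAt (F' := fun s => 1 / (s - c)) fun s hs => by
    simpa using HasDerivAt.clog ((hasDerivAt_id s).sub_const (c : ℂ))
      (sub_ofReal_mem_slitPlane hs c)
  refine h.congr_right fun φ hφ => ?_
  have h1 : ∫ x in Iic c, deriv φ x = φ c - 0 :=
    integral_Iic_of_hasDerivAt_of_tendsto' (fun x _ => hφ.hasDerivAt x)
      (hφ.deriv.continuous.integrable_of_hasCompactSupport hφ.deriv.hasCompactSupport).integrableOn
      (hφ.hasCompactSupport.is_zero_at_infty.mono_left atBot_le_cocompact)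
  rw [h1]
  ring

section cut

variable {αt : ℝ}

lemma integral_jump_eq (hα : 0 < αt) {f k φ : ℝ → ℂ}
    (hoff : ∀ x, x ∉ Icc (leftEdge αt) (rightEdge αt) → conj (f x) = f x)
    (hon : ∀ x ∈ Ioo (leftEdge αt) (rightEdge αt), conj (f x) - f x = k x) :
    ∫ x : ℝ, (conj (f x) - f x) * φ x = ∫ x in leftEdge αt..rightEdge αt, k x * φ x := by
  rw [intervalIntegral.integral_of_le (leftEdge_lt_rightEdge hα).le,
    integral_Ioc_eq_integral_Ioo, ← integral_indicator measurableSet_Ioo]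
  have hne : ∀ᵐ x : ℝ, x ∉ ({leftEdge αt, rightEdge αt} : Set ℝ) :=
    (toFinite _).countable.ae_notMem volume
  refine integral_congr_ae ?_
  filter_upwards [hne] with x hx
  by_cases h : x ∈ Ioo (leftEdge αt) (rightEdge αt)
  · rw [indicator_of_mem h, hon x h]
  · rw [indicator_of_notMem h, hoff x, sub_self, zero_mul]
    intro h1
    simp only [mem_insert_iff, mem_singleton_iff, not_or] at hx
    exact h ⟨lt_of_le_of_ne h1.1 (Ne.symm hx.1), lt_of_le_of_ne h1.2 hx.2⟩

/-- Integration against the arcsine weight `((x - a)(b - x)) ^ (-1/2)` of the cut. -/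
def arcsineIntegral (αt : ℝ) (φ : ℝ → ℂ) : ℂ :=
  ∫ x in leftEdge αt..rightEdge αt,
    (((√((x - leftEdge αt) * (rightEdge αt - x)))⁻¹ : ℝ) : ℂ) * φ x

lemma differentiableOn_root_im_ne_zero (hα : 0 < αt) :
    DifferentiableOn ℂ (root αt) {s | s.im ≠ 0} := fun _ hs =>
  (differentiableAt_root hα (notMem_cut_of_im_ne_zero αt hs)).differentiableWithinAt

lemma sqrt_pos_of_mem_Ioo {x : ℝ} (hx : x ∈ Ioo (leftEdge αt) (rightEdge αt)) :
    0 < √((x - leftEdge αt) * (rightEdge αt - x)) :=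
  Real.sqrt_pos.2 (mul_pos (by linarith [hx.1]) (by linarith [hx.2]))

lemma hasJump_div_root (hα : 0 < αt) {g : ℂ → ℂ} (hg : Differentiable ℂ g)
    (hc : ∀ s, g (conj s) = conj (g s)) :
    HasJump (fun s => g s / root αt s) fun φ =>
      2 * Complex.I * arcsineIntegral αt fun x => g x * φ x := by
  have hr : ∀ x : ℝ, conj (g x) = g x := fun x => by rw [← hc, Complex.conj_ofReal]
  have h := hasJump_of_mul_root (F := fun s => g s / root αt s) (G := g) hα
    (hg.differentiableOn.div (differentiableOn_root_im_ne_zero hα) fun _ hs =>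
      root_ne_zero hα (notMem_cut_of_im_ne_zero αt hs))
    (fun s hs => by rw [conj_root hα hs, hc, map_div₀]) hg.continuous.continuousOn
    (fun s hs => by rw [root_eq_upperRoot hs])
  refine h.congr_right fun φ hφ => ?_
  rw [integral_jump_eq hα (f := fun x => g x / upperRoot αt x)
    (k := fun x => 2 * Complex.I *
      ((((√((x - leftEdge αt) * (rightEdge αt - x)))⁻¹ : ℝ) : ℂ) * g x)), arcsineIntegral,
    ← intervalIntegral.integral_const_mul]
  · refine intervalIntegral.integral_congr fun x _ => ?_
    ring
  · intro x hx
    rw [map_div₀, conj_upperRoot hα hx, hr]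
  · intro x hx
    have h0 : (√((x - leftEdge αt) * (rightEdge αt - x)) : ℂ) ≠ 0 := by
      exact_mod_cast (sqrt_pos_of_mem_Ioo hx).ne'
    rw [map_div₀, upperRoot_of_mem_Ioo hx, hr, map_mul, Complex.conj_ofReal, Complex.conj_I]
    push_cast
    field_simp
    linear_combination -2 * g x * Complex.I_sq

lemma conj_resolventZero (hα : 0 < αt) {s : ℂ} (hs : s.im ≠ 0) :
    resolventZero αt (conj s) = conj (resolventZero αt s) := by
  rw [resolventZero, resolventZero, conj_root hα hs]
  simp [Complex.conj_ofNat]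

lemma continuousOn_inv_sub_add_upperRoot (hα : 0 < αt) :
    ContinuousOn (fun s => 2 / (s - αt + upperRoot αt s)) {s | 0 ≤ s.im} := by
  refine ContinuousOn.div continuousOn_const ?_ fun s _ => sub_add_upperRoot_ne_zero hα s
  exact ContinuousOn.add (by fun_prop) (continuousOn_upperRoot αt)

lemma upperRoot_ne_zero {s : ℂ} (hs : 0 < s.im) : upperRoot αt s ≠ 0 := by
  intro h
  have h1 := upperRoot_sq αt s
  rw [h, zero_pow two_ne_zero, eq_comm, mul_eq_zero, sub_eq_zero, sub_eq_zero] at h1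
  rcases h1 with rfl | rfl <;> simp at hs

lemma differentiableOn_resolventZero_im_ne_zero (hα : 0 < αt) :
    DifferentiableOn ℂ (resolventZero αt) {s | s.im ≠ 0} :=
  (differentiableOn_resolventZero hα).mono fun _ hs => notMem_cut_of_im_ne_zero αt hs

lemma pos_of_mem_Ioo (hα : 0 < αt) {x : ℝ} (hx : x ∈ Ioo (leftEdge αt) (rightEdge αt)) : 0 < x :=
  (leftEdge_pos hα).trans hx.1

/-- The boundary value on the cut of the limiting resolvent. -/
lemma two_div_sub_add_upperRoot (hα : 0 < αt) {x : ℝ}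
    (hx : x ∈ Ioo (leftEdge αt) (rightEdge αt)) :
    2 / (x - αt + upperRoot αt x) = (x - αt - upperRoot αt x) / (2 * x) := by
  have h0 : (x : ℂ) ≠ 0 := by exact_mod_cast (pos_of_mem_Ioo hα hx).ne'
  have h2 : (leftEdge αt : ℂ) * rightEdge αt = αt ^ 2 := by
    exact_mod_cast leftEdge_mul_rightEdge hα
  have h3 : (leftEdge αt : ℂ) + rightEdge αt = 2 * (αt + 2) := by
    exact_mod_cast leftEdge_add_rightEdge hα
  rw [div_eq_div_iff (sub_add_upperRoot_ne_zero hα _) (by simpa using h0)]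
  linear_combination upperRoot_sq αt x + h2 - x * h3

lemma hasJump_resolventZero (hα : 0 < αt) :
    HasJump (resolventZero αt) fun φ => ∫ x in leftEdge αt..rightEdge αt,
      (Complex.I * (√((x - leftEdge αt) * (rightEdge αt - x)) / x)) * φ x := by
  have h := hasJump_of_mul_root (F := resolventZero αt)
    (G := fun s => 2 / (s - αt + upperRoot αt s) * upperRoot αt s) hα
    (differentiableOn_resolventZero_im_ne_zero hα) (fun s hs => conj_resolventZero hα hs)
    ((continuousOn_inv_sub_add_upperRoot hα).mul (continuousOn_upperRoot αt)) fun s hs => by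
      rw [mul_div_cancel_right₀ _ (upperRoot_ne_zero hs), resolventZero, root_eq_upperRoot hs]
  refine h.congr_right fun φ hφ => ?_
  rw [integral_jump_eq hα (f := fun x => 2 / (x - αt + upperRoot αt x) * upperRoot αt x /
    upperRoot αt x)
    (k := fun x => Complex.I * (√((x - leftEdge αt) * (rightEdge αt - x)) / x))]
  · intro x hx
    simp [conj_upperRoot hα hx, Complex.conj_ofNat]
  · intro x hx
    have h0 : (√((x - leftEdge αt) * (rightEdge αt - x)) : ℂ) ≠ 0 := by
      exact_mod_cast (sqrt_pos_of_mem_Ioo hx).ne'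
    rw [mul_div_cancel_right₀ _ (by rw [upperRoot_of_mem_Ioo hx]; simpa using h0),
      two_div_sub_add_upperRoot hα hx, upperRoot_of_mem_Ioo hx]
    have h1 : (x : ℂ) ≠ 0 := by exact_mod_cast (pos_of_mem_Ioo hα hx).ne'
    simp only [map_div₀, map_mul, map_sub, Complex.conj_ofReal, Complex.conj_I, Complex.conj_ofNat]
    field_simp
    ring

/-- The part of the first correction with inverse square root singularities. -/
lemma hasJump_one_sub_two_mul_div_root (hα : 0 < αt) :
    HasJump (fun s => (1 - 2 * resolventZero αt s) / root αt s) fun φ =>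
      ∫ x in leftEdge αt..rightEdge αt,
        (2 * Complex.I * (αt / (x * √((x - leftEdge αt) * (rightEdge αt - x))))) * φ x := by
  have h := hasJump_of_mul_root (F := fun s => (1 - 2 * resolventZero αt s) / root αt s)
    (G := fun s => 1 - 2 * (2 / (s - αt + upperRoot αt s))) hα ?_ ?_ ?_ ?_
  · refine h.congr_right fun φ hφ => ?_
    rw [integral_jump_eq hα (f := fun x =>
        (1 - 2 * (2 / (x - αt + upperRoot αt x))) / upperRoot αt x)
      (k := fun x =>
        2 * Complex.I * (αt / (x * √((x - leftEdge αt) * (rightEdge αt - x)))))]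
    · intro x hx
      simp [conj_upperRoot hα hx, Complex.conj_ofNat]
    · intro x hx
      have h0 : (√((x - leftEdge αt) * (rightEdge αt - x)) : ℂ) ≠ 0 := by
        exact_mod_cast (sqrt_pos_of_mem_Ioo hx).ne'
      have h1 : (x : ℂ) ≠ 0 := by exact_mod_cast (pos_of_mem_Ioo hα hx).ne'
      rw [two_div_sub_add_upperRoot hα hx, upperRoot_of_mem_Ioo hx]
      simp only [map_div₀, map_mul, map_sub, map_one, Complex.conj_ofReal, Complex.conj_I,
        Complex.conj_ofNat]
      field_simp
      linear_combination (-2 * αt : ℂ) * Complex.I_sq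
  · exact ((differentiableOn_const 1).sub
      ((differentiableOn_resolventZero_im_ne_zero hα).const_mul 2)).div
      (differentiableOn_root_im_ne_zero hα) fun _ hs =>
        root_ne_zero hα (notMem_cut_of_im_ne_zero αt hs)
  · intro s hs
    rw [conj_root hα hs, conj_resolventZero hα hs]
    simp [Complex.conj_ofNat]
  · exact continuousOn_const.sub (continuousOn_const.mul (continuousOn_inv_sub_add_upperRoot hα))
  · intro s hs
    rw [resolventZero, root_eq_upperRoot hs]

lemma hasJump_resolventOne (h : ℝ) (hα : 0 < αt) :
    HasJump (resolventOne h αt) fun φ =>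
      -(h / 4) * (2 * Real.pi * Complex.I * φ (leftEdge αt)) +
      -(h / 4) * (2 * Real.pi * Complex.I * φ (rightEdge αt)) +
      h / 2 * ∫ x in leftEdge αt..rightEdge αt,
        (2 * Complex.I * (αt / (x * √((x - leftEdge αt) * (rightEdge αt - x))))) * φ x := by
  refine ((((hasJump_inv_sub (leftEdge αt)).const_mul (-(h / 4))).add
    ((hasJump_inv_sub (rightEdge αt)).const_mul (-(h / 4)))).add
    ((hasJump_one_sub_two_mul_div_root hα).const_mul (h / 2))).congr fun s hs => ?_
  have hs' := notMem_cut_of_im_ne_zero αt hs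
  have h1 := sub_ne_zero.2 (ne_leftEdge_of_notMem_cut hα hs')
  have h2 := sub_ne_zero.2 (ne_rightEdge_of_notMem_cut hα hs')
  have hy := root_ne_zero hα hs'
  have hy2 := root_sq (ne_leftEdge_of_notMem_cut hα hs')
  have hy2' := root_sq' hα (ne_leftEdge_of_notMem_cut hα hs')
  have h3 : (leftEdge αt : ℂ) + rightEdge αt = 2 * (αt + 2) := by
    exact_mod_cast leftEdge_add_rightEdge hα
  have hW : resolventZero αt s * (s - αt + root αt s) = 2 :=
    div_mul_cancel₀ _ (sub_add_root_ne_zero hα hs')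
  -- The polar parts of `resolventOne` at the two endpoints have equal coefficients; the remainder
  -- is singular only to order `-1/2`.
  have e1 : (1 / (s - leftEdge αt) + 1 / (s - rightEdge αt) : ℂ) =
      2 * (s - (αt + 2)) / root αt s ^ 2 := by
    rw [hy2]
    field_simp
    linear_combination -h3
  have e2 : (1 - 2 * resolventZero αt s) / root αt s =
      (1 - 2 * resolventZero αt s) * root αt s / root αt s ^ 2 := by
    field_simp
  have e3 : (1 - 2 * resolventZero αt s) * root αt s =
      s - αt - 4 - 2 * αt * resolventZero αt s := by
    have h4 : resolventZero αt s * (4 * s) = 2 * (s - αt - root αt s) := by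
      linear_combination (s - αt - root αt s) * hW + resolventZero αt s * hy2'
    linear_combination -2 * hW + (1 / 2) * h4
  have e4 : -(h / 4 : ℂ) * (1 / (s - leftEdge αt)) + -(h / 4 : ℂ) * (1 / (s - rightEdge αt)) =
      -(h / 4 : ℂ) * (1 / (s - leftEdge αt) + 1 / (s - rightEdge αt)) := by ring
  rw [e4, e1, e2, e3, resolventOne]
  field_simp
  ring

lemma hasDerivAt_root (hα : 0 < αt) {s : ℂ} (hs : s.im ≠ 0) :
    HasDerivAt (root αt) ((s - (αt + 2)) / root αt s) s := by
  have hs' := notMem_cut_of_im_ne_zero αt hs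
  have hy := root_ne_zero hα hs'
  have hd := (differentiableAt_root hα hs').hasDerivAt
  have h1 : HasDerivAt (fun s : ℂ => (s - αt) ^ 2 - 4 * s) (2 * (s - αt) - 4) s := by
    have := (((hasDerivAt_id s).sub_const (αt : ℂ)).pow 2).sub ((hasDerivAt_id s).const_mul 4)
    convert! this using 1
    simp
  have h2 : HasDerivAt (fun s : ℂ => (s - αt) ^ 2 - 4 * s) (2 * root αt s * deriv (root αt) s) s := by
    have := hd.pow 2
    refine HasDerivAt.congr_of_eventuallyEq (f := fun s => root αt s ^ 2) ?_ ?_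
    · convert! this using 1
      simp
    · filter_upwards [isOpen_im_ne_zero.mem_nhds hs] with z hz
      exact (root_sq' hα (ne_leftEdge_of_notMem_cut hα (notMem_cut_of_im_ne_zero αt hz))).symm
  have h3 := h1.unique h2
  have h4 : deriv (root αt) s = (s - (αt + 2)) / root αt s := by
    rw [eq_div_iff hy]
    linear_combination -(1 / 2) * h3
  rwa [h4] at hd

lemma root_sq_eq (hα : 0 < αt) {s : ℂ} (hs : s.im ≠ 0) :
    root αt s ^ 2 = (s - (αt + 2)) ^ 2 - 4 * (αt + 1) := by
  rw [root_sq' hα (ne_leftEdge_of_notMem_cut hα (notMem_cut_of_im_ne_zero αt hs))]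
  ring

lemma add_one_ne_zero_of_pos (hα : 0 < αt) : (αt + 1 : ℂ) ≠ 0 := by
  exact_mod_cast (by linarith : αt + 1 ≠ 0)

/-- The Hadamard finite part of the integral of `((x - a)(b - x)) ^ (-3/2) φ(x)`, expressed as an
integral against the arcsine weight after one integration by parts. -/
def finitePartThree (αt : ℝ) (φ : ℝ → ℂ) : ℂ :=
  -(1 / (4 * (αt + 1))) * arcsineIntegral αt fun x => (x - (αt + 2)) * deriv φ x

/-- The Hadamard finite part of the integral of `x ((x - a)(b - x)) ^ (-5/2) φ(x)`, expressed
through integrals against the arcsine weight after two integrations by parts. -/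
def finitePartFive (αt : ℝ) (φ : ℝ → ℂ) : ℂ :=
  1 / (12 * (αt + 1)) * arcsineIntegral αt (fun x => (x - (αt + 2)) * deriv (deriv φ) x) +
    (αt + 2) / (48 * (αt + 1) ^ 2) *
      (arcsineIntegral αt (fun x => (x - (αt + 2)) ^ 2 * deriv (deriv φ) x) -
        arcsineIntegral αt fun x => (x - (αt + 2)) * deriv φ x)

lemma hasJump_inv_root_pow_three (hα : 0 < αt) :
    HasJump (fun s => 1 / root αt s ^ 3) fun φ => -(2 * Complex.I * finitePartThree αt φ) := by
  have hq := add_one_ne_zero_of_pos hα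
  have h := ((hasJump_div_root hα (g := fun s => s - (αt + 2)) (by fun_prop)
    (fun s => by simp [Complex.conj_ofNat])).const_mul (-(1 / (4 * (αt + 1))))).of_hasDerivAt
      (F' := fun s => 1 / root αt s ^ 3) fun s hs => by
    have hy := root_ne_zero hα (notMem_cut_of_im_ne_zero αt hs)
    convert! (((hasDerivAt_id s).sub_const (αt + 2 : ℂ)).div (hasDerivAt_root hα hs)
      hy).const_mul (-(1 / (4 * (αt + 1))) : ℂ) using 1
    simp only [id]
    field_simp
    linear_combination root_sq_eq hα hs
  refine h.congr_right fun φ _ => ?_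
  rw [finitePartThree]
  ring

/-- Here `αt + 2 = (a + b) / 2`, so that the numerator is the derivative of `root ^ 2 / 2`. The
second term of the jump comes from writing the function through that of
`(s - (αt + 2)) ^ 2 / root` and its derivative. -/
lemma hasJump_sub_div_root_pow_three (hα : 0 < αt) :
    HasJump (fun s => (s - (αt + 2)) / root αt s ^ 3) fun φ =>
      1 / (4 * (αt + 1)) * (2 * Complex.I *
        (arcsineIntegral αt (fun x => (x - (αt + 2)) ^ 2 * deriv φ x) +
          arcsineIntegral αt fun x => (x - (αt + 2)) * φ x)) := by
  have hq := add_one_ne_zero_of_pos hα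
  have h1 := hasJump_div_root hα (g := fun s => s - (αt + 2)) (by fun_prop)
    (fun s => by simp [Complex.conj_ofNat])
  have h2 := (hasJump_div_root hα (g := fun s => (s - (αt + 2)) ^ 2) (by fun_prop)
    (fun s => by simp [Complex.conj_ofNat])).of_hasDerivAt
      (F' := fun s => (s - (αt + 2)) / root αt s -
        4 * (αt + 1) * ((s - (αt + 2)) / root αt s ^ 3)) fun s hs => by
    have hy := root_ne_zero hα (notMem_cut_of_im_ne_zero αt hs)
    convert! (((hasDerivAt_id s).sub_const (αt + 2 : ℂ)).pow 2).div (hasDerivAt_root hα hs)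
      hy using 1
    simp only [id, Pi.pow_apply]
    field_simp
    push_cast
    linear_combination (αt + 2 - s) * root_sq_eq hα hs
  refine (((h1.const_mul (1 / (4 * (αt + 1)))).add
    (h2.const_mul (-(1 / (4 * (αt + 1)))))).congr fun s _ => ?_).congr_right fun φ _ => ?_
  · field_simp
    ring
  · ring

lemma hasDerivAt_inv_root_pow_three (hα : 0 < αt) {s : ℂ} (hs : s.im ≠ 0) :
    HasDerivAt (fun s => 1 / root αt s ^ 3) (-3 * ((s - (αt + 2)) / root αt s ^ 5)) s := by
  have hy := root_ne_zero hα (notMem_cut_of_im_ne_zero αt hs)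
  convert! (hasDerivAt_const s (1 : ℂ)).div ((hasDerivAt_root hα hs).pow 3)
    (pow_ne_zero 3 hy) using 1
  simp only [Pi.pow_apply]
  field_simp
  push_cast
  ring

lemma hasJump_div_root_pow_five (hα : 0 < αt) :
    HasJump (fun s => s / root αt s ^ 5) fun φ => 2 * Complex.I * finitePartFive αt φ := by
  have hq := add_one_ne_zero_of_pos hα
  -- With `c = αt + 2`, the function `s / y ^ 5` is the sum of `(s - c) / y ^ 5`, proportional to the
  -- derivative of `1 / y ^ 3`, and of `c / y ^ 5`, obtained from the derivative of `(s - c) / y ^ 3`.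
  have h1 := (hasJump_inv_root_pow_three hα).of_hasDerivAt
    fun s hs => hasDerivAt_inv_root_pow_three hα hs
  have h2 := (hasJump_sub_div_root_pow_three hα).of_hasDerivAt
      (F' := fun s => -2 * (1 / root αt s ^ 3) - 12 * (αt + 1) * (1 / root αt s ^ 5))
      fun s hs => by
    have hy := root_ne_zero hα (notMem_cut_of_im_ne_zero αt hs)
    convert! ((hasDerivAt_id s).sub_const (αt + 2 : ℂ)).div ((hasDerivAt_root hα hs).pow 3)
      (pow_ne_zero 3 hy) using 1
    simp only [id, Pi.pow_apply]
    field_simp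
    push_cast
    linear_combination (-3 * root αt s ^ 2) * root_sq_eq hα hs
  refine (((h1.const_mul (-(1 / 3))).add ((h2.add
    ((hasJump_inv_root_pow_three hα).const_mul 2)).const_mul
      (-((αt + 2) / (12 * (αt + 1)))))).congr fun s hs => ?_).congr_right fun φ _ => ?_
  · have hy := root_ne_zero hα (notMem_cut_of_im_ne_zero αt hs)
    field_simp
    ring
  · rw [finitePartFive, finitePartThree, finitePartThree]
    field_simp
    ring

lemma hasJump_sub_div_root_pow_four (hα : 0 < αt) :
    HasJump (fun s => (s - (αt + 2)) / root αt s ^ 4) fun φ =>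
      2 * Real.pi * Complex.I *
        (1 / (8 * √(αt + 1)) * (deriv φ (rightEdge αt) - deriv φ (leftEdge αt))) := by
  have hσ : (√(αt + 1) : ℂ) ≠ 0 := by
    exact_mod_cast (Real.sqrt_pos.2 (by linarith : 0 < αt + 1)).ne'
  -- Even powers of the root are rational, and `(s - c) / y ^ 4` is the derivative of `-1 / (2 y ^ 2)`.
  have h1 : HasJump (fun s => 1 / root αt s ^ 2) _ :=
    (((hasJump_inv_sub (rightEdge αt)).const_mul (1 / (4 * √(αt + 1)))).add
      ((hasJump_inv_sub (leftEdge αt)).const_mul (-(1 / (4 * √(αt + 1)))))).congr fun s hs => by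
    have hs' := notMem_cut_of_im_ne_zero αt hs
    have h1 := sub_ne_zero.2 (ne_leftEdge_of_notMem_cut hα hs')
    have h2 := sub_ne_zero.2 (ne_rightEdge_of_notMem_cut hα hs')
    have h3 : (rightEdge αt : ℂ) - leftEdge αt = 4 * √(αt + 1) := by
      exact_mod_cast rightEdge_sub_leftEdge αt
    rw [root_sq (ne_leftEdge_of_notMem_cut hα hs')]
    field_simp
    linear_combination -h3
  have h2 := (h1.const_mul (-(1 / 2))).of_hasDerivAt
      (F' := fun s => (s - (αt + 2)) / root αt s ^ 4) fun s hs => by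
    have hy := root_ne_zero hα (notMem_cut_of_im_ne_zero αt hs)
    convert! ((hasDerivAt_const s (1 : ℂ)).div ((hasDerivAt_root hα hs).pow 2)
      (pow_ne_zero 2 hy)).const_mul (-(1 / 2) : ℂ) using 1
    simp only [Pi.pow_apply]
    field_simp
    push_cast
    ring
  refine h2.congr_right fun φ _ => ?_
  field_simp
  ring

lemma hasJump_resolventTwo (h : ℝ) (hα : 0 < αt) :
    HasJump (resolventTwo h αt) fun φ =>
      (1 + 5 * h ^ 2) * (αt + 1) * (2 * Complex.I * finitePartFive αt φ) +
      h ^ 2 * ((αt + 2) * -(2 * Complex.I * finitePartThree αt φ) + -αt *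
        (2 * Real.pi * Complex.I *
          (1 / (8 * √(αt + 1)) * (deriv φ (rightEdge αt) - deriv φ (leftEdge αt))))) := by
  refine (((hasJump_div_root_pow_five hα).const_mul ((1 + 5 * h ^ 2) * (αt + 1))).add
    ((((hasJump_inv_root_pow_three hα).const_mul (αt + 2)).add
      ((hasJump_sub_div_root_pow_four hα).const_mul (-αt))).const_mul (h ^ 2))).congr
        fun s _ => ?_
  rw [resolventTwo]
  ring

end cut

end

/-! ### Hadamard finite parts -/

section

open scoped ContDiff

/-- The finite part as `ε → 0⁺` of a function of `ε`: its limit after subtraction of a finite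
linear combination of negative powers. -/
def HasFinitePartAtZero (g : ℝ → ℂ) (v : ℂ) : Prop :=
  ∃ (S : Finset ℝ) (c : ℝ → ℂ), (∀ p ∈ S, 0 < p) ∧
    Tendsto (fun ε : ℝ => g ε - ∑ p ∈ S, c p * ((ε ^ (-p) : ℝ) : ℂ)) (𝓝[>] 0) (𝓝 v)

namespace HasFinitePartAtZero

variable {f g : ℝ → ℂ} {v w : ℂ}

lemma of_tendsto (h : Tendsto g (𝓝[>] 0) (𝓝 v)) : HasFinitePartAtZero g v :=
  ⟨∅, fun _ => 0, by simp, by simpa using h⟩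

lemma congr (h : HasFinitePartAtZero f v) (hfg : f =ᶠ[𝓝[>] 0] g) : HasFinitePartAtZero g v := by
  obtain ⟨S, c, hS, h⟩ := h
  refine ⟨S, c, hS, h.congr' ?_⟩
  filter_upwards [hfg] with ε hε
  rw [hε]

lemma const_mul (k : ℂ) (h : HasFinitePartAtZero g v) :
    HasFinitePartAtZero (fun ε => k * g ε) (k * v) := by
  obtain ⟨S, c, hS, h⟩ := h
  refine ⟨S, fun p => k * c p, hS, (h.const_mul k).congr fun ε => ?_⟩
  simp_rw [mul_sub, Finset.mul_sum, mul_assoc]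

lemma add (hf : HasFinitePartAtZero f v) (hg : HasFinitePartAtZero g w) :
    HasFinitePartAtZero (fun ε => f ε + g ε) (v + w) := by
  classical
  obtain ⟨S, c, hS, hf⟩ := hf
  obtain ⟨S', c', hS', hg⟩ := hg
  refine ⟨S ∪ S', fun p => (if p ∈ S then c p else 0) + if p ∈ S' then c' p else 0, ?_,
    (hf.add hg).congr fun ε => ?_⟩
  · intro p hp
    rcases Finset.mem_union.1 hp with h | h
    exacts [hS p h, hS' p h]
  · have h1 : ∑ p ∈ S ∪ S', (if p ∈ S then c p else 0) * ((ε ^ (-p) : ℝ) : ℂ) =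
        ∑ p ∈ S, c p * ((ε ^ (-p) : ℝ) : ℂ) := by
      rw [← Finset.sum_subset Finset.subset_union_left fun p _ hp => by rw [if_neg hp, zero_mul]]
      exact Finset.sum_congr rfl fun p hp => by rw [if_pos hp]
    have h2 : ∑ p ∈ S ∪ S', (if p ∈ S' then c' p else 0) * ((ε ^ (-p) : ℝ) : ℂ) =
        ∑ p ∈ S', c' p * ((ε ^ (-p) : ℝ) : ℂ) := by
      rw [← Finset.sum_subset Finset.subset_union_right fun p _ hp => by rw [if_neg hp, zero_mul]]
      exact Finset.sum_congr rfl fun p hp => by rw [if_pos hp]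
    simp_rw [add_mul, Finset.sum_add_distrib]
    rw [h1, h2]
    ring

lemma neg (h : HasFinitePartAtZero g v) : HasFinitePartAtZero (fun ε => -g ε) (-v) := by
  simpa using h.const_mul (-1)

lemma sub (hf : HasFinitePartAtZero f v) (hg : HasFinitePartAtZero g w) :
    HasFinitePartAtZero (fun ε => f ε - g ε) (v - w) := by
  simpa [sub_eq_add_neg] using hf.add hg.neg

lemma rpow {p : ℝ} (hp : 0 < p) (k : ℂ) :
    HasFinitePartAtZero (fun ε => k * ((ε ^ (-p) : ℝ) : ℂ)) 0 :=
  ⟨{p}, fun _ => k, by simpa using hp, by simp⟩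

lemma sum {ι : Type*} {s : Finset ι} {F : ι → ℝ → ℂ}
    (h : ∀ i ∈ s, HasFinitePartAtZero (F i) 0) :
    HasFinitePartAtZero (fun ε => ∑ i ∈ s, F i ε) 0 := by
  classical
  induction s using Finset.induction_on with
  | empty => exact of_tendsto (by simp)
  | insert i s hi ih =>
    have := (h i (Finset.mem_insert_self _ _)).add
      (ih fun j hj => h j (Finset.mem_insert_of_mem hj))
    simpa [Finset.sum_insert hi] using this

/-- By Taylor's formula a smooth function times a negative half-integer power has finite part
zero: no term of order `ε ^ 0` can occur. -/
lemma rpow_mul {δ : ℝ} (hδ : 0 < δ) (n : ℕ) {H : ℝ → ℂ} (hH : ContDiffOn ℝ (n + 1) H (Icc 0 δ)) :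
    HasFinitePartAtZero (fun ε => ((ε ^ (-(n + 1 / 2) : ℝ) : ℝ) : ℂ) * H ε) 0 := by
  obtain ⟨C, hC⟩ := exists_taylor_mean_remainder_bound hδ.le hH
  have h1 : HasFinitePartAtZero (fun ε => ∑ k ∈ Finset.range (n + 1),
      ((((Nat.factorial k : ℝ)⁻¹ : ℝ) : ℂ) * iteratedDerivWithin k H (Icc 0 δ) 0) *
        ((ε ^ (-(n + 1 / 2 - k) : ℝ) : ℝ) : ℂ)) 0 := by
    refine sum fun k hk => rpow ?_ _
    have : (k : ℝ) ≤ n := by exact_mod_cast Nat.lt_succ_iff.1 (Finset.mem_range.1 hk)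
    linarith
  have h2 : HasFinitePartAtZero (fun ε => ((ε ^ (-(n + 1 / 2) : ℝ) : ℝ) : ℂ) *
      (H ε - taylorWithinEval H n (Icc 0 δ) 0 ε)) 0 := by
    refine of_tendsto ?_
    have h3 : Tendsto (fun ε : ℝ => C * ε ^ (1 / 2 : ℝ)) (𝓝[>] 0) (𝓝 0) := by
      have h4 := (Real.continuous_rpow_const (q := 1 / 2) (by norm_num)).tendsto 0
      rw [Real.zero_rpow (by norm_num)] at h4
      simpa using (h4.mono_left nhdsWithin_le_nhds).const_mul C
    refine squeeze_zero_norm' ?_ h3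
    filter_upwards [Ioo_mem_nhdsGT hδ] with ε hε
    have h4 := hC ε ⟨hε.1.le, hε.2.le⟩
    rw [norm_mul, Complex.norm_real, Real.norm_of_nonneg (Real.rpow_nonneg hε.1.le _)]
    refine (mul_le_mul_of_nonneg_left h4 (Real.rpow_nonneg hε.1.le _)).trans (le_of_eq ?_)
    rw [sub_zero, mul_left_comm, ← Real.rpow_natCast ε, ← Real.rpow_add hε.1]
    congr 2
    push_cast
    ring
  have h3 := h1.add h2
  rw [add_zero] at h3
  refine h3.congr ?_
  filter_upwards [self_mem_nhdsWithin] with ε (hε : 0 < ε)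
  rw [taylor_within_apply, mul_sub, Finset.mul_sum]
  rw [← Finset.sum_congr rfl fun k _ => ?_]
  · exact add_sub_cancel _ _
  · rw [sub_zero, neg_sub, sub_eq_add_neg, Real.rpow_add hε, Real.rpow_natCast, Complex.real_smul]
    push_cast
    ring

lemma rpow_mul_sub_mul {L : ℝ} (hL : 0 < L) (n : ℕ) {ψ : ℝ → ℂ} (hψ : ContDiff ℝ ∞ ψ) {p : ℝ}
    (hp : p = n + 1 / 2) :
    HasFinitePartAtZero (fun ε => (((ε * (L - ε)) ^ (-p) : ℝ) : ℂ) * ψ ε) 0 := by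
  subst hp
  have h : ContDiffOn ℝ (n + 1) (fun ε : ℝ => (((L - ε) ^ (-(n + 1 / 2) : ℝ) : ℝ) : ℂ) * ψ ε)
      (Icc 0 (L / 2)) := by
    refine ContDiffOn.mul ?_ (hψ.of_le (by exact_mod_cast le_top)).contDiffOn
    refine Complex.ofRealCLM.contDiff.comp_contDiffOn ?_
    refine ContDiffOn.rpow_const_of_ne (by fun_prop) fun x hx => ?_
    linarith [hx.2]
  refine (rpow_mul (half_pos hL) n h).congr ?_
  filter_upwards [Ioo_mem_nhdsGT hL] with ε hε
  rw [Real.mul_rpow hε.1.le (by linarith [hε.2])]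
  push_cast
  ring

lemma integral {F : ℝ → ℂ} {a b : ℝ} (hab : a < b) (hF : IntervalIntegrable F volume a b) :
    HasFinitePartAtZero (fun ε => ∫ x in (a + ε)..(b - ε), F x) (∫ x in a..b, F x) := by
  have h1 := intervalIntegral.continuousOn_primitive_interval' hF left_mem_uIcc
  rw [uIcc_of_le hab.le] at h1
  have h2 : Tendsto (fun ε : ℝ => ∫ x in a..(b - ε), F x) (𝓝[>] 0) (𝓝 (∫ x in a..b, F x)) := by
    refine (h1 b (right_mem_Icc.2 hab.le)).tendsto.comp (tendsto_nhdsWithin_iff.2 ⟨?_, ?_⟩)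
    · have : Continuous fun ε : ℝ => b - ε := by fun_prop
      simpa using (this.tendsto 0).mono_left (nhdsWithin_le_nhds (s := Ioi 0))
    · filter_upwards [Ioo_mem_nhdsGT (sub_pos.2 hab)] with ε hε
      exact ⟨by linarith [hε.2], by linarith [hε.1]⟩
  have h3 : Tendsto (fun ε : ℝ => ∫ x in a..(a + ε), F x) (𝓝[>] 0) (𝓝 (∫ x in a..a, F x)) := by
    refine (h1 a (left_mem_Icc.2 hab.le)).tendsto.comp (tendsto_nhdsWithin_iff.2 ⟨?_, ?_⟩)
    · have : Continuous fun ε : ℝ => a + ε := by fun_prop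
      simpa using (this.tendsto 0).mono_left (nhdsWithin_le_nhds (s := Ioi 0))
    · filter_upwards [Ioo_mem_nhdsGT (sub_pos.2 hab)] with ε hε
      exact ⟨by linarith [hε.1], by linarith [hε.2]⟩
  have h4 := h2.sub h3
  rw [intervalIntegral.integral_same, sub_zero] at h4
  refine of_tendsto (h4.congr' ?_)
  filter_upwards [Ioo_mem_nhdsGT (sub_pos.2 hab)] with ε hε
  refine intervalIntegral.integral_interval_sub_left ?_ ?_
  · refine hF.mono_set ?_
    rw [uIcc_of_le hab.le, uIcc_of_le (by linarith [hε.2])]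
    exact Icc_subset_Icc le_rfl (by linarith [hε.1])
  · refine hF.mono_set ?_
    rw [uIcc_of_le hab.le, uIcc_of_le (by linarith [hε.1])]
    exact Icc_subset_Icc le_rfl (by linarith [hε.2])

end HasFinitePartAtZero

section cut

variable {αt : ℝ}

/-- The quadratic `(x - a)(b - x)`, positive inside the cut. -/
def cutQuadratic (αt x : ℝ) : ℝ := (x - leftEdge αt) * (rightEdge αt - x)

lemma cutQuadratic_pos {x : ℝ} (hx : x ∈ Ioo (leftEdge αt) (rightEdge αt)) :
    0 < cutQuadratic αt x :=
  mul_pos (by linarith [hx.1]) (by linarith [hx.2])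

lemma sq_add_cutQuadratic (hα : 0 < αt) (x : ℝ) :
    (x - (αt + 2)) ^ 2 + cutQuadratic αt x = 4 * (αt + 1) := by
  rw [cutQuadratic]
  linear_combination x * leftEdge_add_rightEdge hα - leftEdge_mul_rightEdge hα

lemma hasDerivAt_cutQuadratic (hα : 0 < αt) (x : ℝ) :
    HasDerivAt (cutQuadratic αt) (-2 * (x - (αt + 2))) x := by
  have := ((hasDerivAt_id x).sub_const (leftEdge αt)).mul
    ((hasDerivAt_id x).const_sub (rightEdge αt))
  convert! this using 1
  simp only [id]
  linear_combination -leftEdge_add_rightEdge hα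

lemma cutQuadratic_rpow_add_one {x p q : ℝ} (hx : x ∈ Ioo (leftEdge αt) (rightEdge αt))
    (hpq : p = q + 1) : cutQuadratic αt x ^ p = cutQuadratic αt x ^ q * cutQuadratic αt x := by
  rw [hpq, Real.rpow_add_one (cutQuadratic_pos hx).ne']

lemma hasDerivAt_cutQuadratic_rpow (hα : 0 < αt) {x p q : ℝ}
    (hx : x ∈ Ioo (leftEdge αt) (rightEdge αt)) (hpq : p = q + 1) :
    HasDerivAt (fun x => cutQuadratic αt x ^ p)
      (-2 * p * ((x - (αt + 2)) * cutQuadratic αt x ^ q)) x := by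
  have h := (hasDerivAt_cutQuadratic hα x).rpow_const (p := p) (Or.inl (cutQuadratic_pos hx).ne')
  rw [show p - 1 = q by linarith] at h
  convert! h using 1
  ring

lemma hasDerivAt_sub_mul_cutQuadratic_rpow (hα : 0 < αt) {x p q : ℝ}
    (hx : x ∈ Ioo (leftEdge αt) (rightEdge αt)) (hpq : p = q + 1) :
    HasDerivAt (fun x => (x - (αt + 2)) * cutQuadratic αt x ^ p)
      ((1 + 2 * p) * cutQuadratic αt x ^ p - 8 * p * (αt + 1) * cutQuadratic αt x ^ q) x := by
  have h := ((hasDerivAt_id x).sub_const (αt + 2)).mul (hasDerivAt_cutQuadratic_rpow hα hx hpq)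
  convert! h using 1
  simp only [id]
  rw [cutQuadratic_rpow_add_one hx hpq]
  linear_combination (2 * p * cutQuadratic αt x ^ q) * sq_add_cutQuadratic hα x

/-- Integration by parts for Hadamard finite parts: the boundary terms do not contribute. -/
lemma finitePart_integral_by_parts (hα : 0 < αt) {φ : ℝ → ℂ} (hφ : ContDiff ℝ ∞ φ) {u u' : ℝ → ℝ}
    (hu : ∀ x ∈ Ioo (leftEdge αt) (rightEdge αt), HasDerivAt u (u' x) x)
    (hu' : ContinuousOn u' (Ioo (leftEdge αt) (rightEdge αt))) {g : ℝ → ℝ} (hg : ContDiff ℝ ∞ g)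
    {p : ℝ} {n : ℕ} (hp : p = n + 1 / 2)
    (hug : ∀ x ∈ Ioo (leftEdge αt) (rightEdge αt), u x = g x * cutQuadratic αt x ^ (-p)) {v : ℂ}
    (h : HasFinitePartAtZero (fun ε => ∫ x in (leftEdge αt + ε)..(rightEdge αt - ε),
      (u x : ℂ) * deriv φ x) v) :
    HasFinitePartAtZero (fun ε => ∫ x in (leftEdge αt + ε)..(rightEdge αt - ε),
      (u' x : ℂ) * φ x) (-v) := by
  set a := leftEdge αt
  set b := rightEdge αt
  have hab : a < b := leftEdge_lt_rightEdge hα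
  have hgc : ContDiff ℝ ∞ fun x => (g x : ℂ) := Complex.ofRealCLM.contDiff.comp hg
  have hL : 0 < b - a := sub_pos.2 hab
  have hb := HasFinitePartAtZero.rpow_mul_sub_mul hL n (ψ := fun ε => (g (b - ε) : ℂ) * φ (b - ε))
    ((hgc.comp (contDiff_const.sub contDiff_id)).mul (hφ.comp (contDiff_const.sub contDiff_id))) hp
  have ha := HasFinitePartAtZero.rpow_mul_sub_mul hL n (ψ := fun ε => (g (a + ε) : ℂ) * φ (a + ε))
    ((hgc.comp (contDiff_const.add contDiff_id)).mul (hφ.comp (contDiff_const.add contDiff_id))) hp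
  have key := (hb.sub ha).sub h
  rw [sub_zero, zero_sub] at key
  refine key.congr ?_
  filter_upwards [Ioo_mem_nhdsGT (half_pos hL)] with ε hε
  have hle : a + ε ≤ b - ε := by linarith [hε.2]
  have hsub : uIcc (a + ε) (b - ε) ⊆ Ioo a b := by
    rw [uIcc_of_le hle]
    exact fun x hx => ⟨by linarith [hx.1, hε.1], by linarith [hx.2, hε.1]⟩
  have hd : ∀ x, HasDerivAt φ (deriv φ x) x := fun x =>
    (hφ.differentiable (by simp) x).hasDerivAt
  have hφ' : Continuous (deriv φ) := hφ.continuous_deriv (by simp)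
  have hu'c : ContinuousOn (fun x => (u' x : ℂ)) (Ioo a b) :=
    Complex.continuous_ofReal.comp_continuousOn hu'
  have h1 := intervalIntegral.integral_mul_deriv_eq_deriv_mul (u := fun x => (u x : ℂ))
    (u' := fun x => (u' x : ℂ)) (v := φ) (v' := deriv φ) (a := a + ε) (b := b - ε)
    (fun x hx => (hu x (hsub hx)).ofReal_comp) (fun x _ => hd x)
    (hu'c.mono hsub).intervalIntegrable (hφ'.intervalIntegrable _ _)
  have hbm : b - ε ∈ Ioo a b := hsub right_mem_uIcc
  have ham : a + ε ∈ Ioo a b := hsub left_mem_uIcc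
  have e1 : cutQuadratic αt (b - ε) = ε * (b - a - ε) := by
    change (b - ε - a) * (b - (b - ε)) = _
    ring
  have e2 : cutQuadratic αt (a + ε) = ε * (b - a - ε) := by
    change (a + ε - a) * (b - (a + ε)) = _
    ring
  rw [h1, hug _ hbm, hug _ ham, e1, e2]
  push_cast
  ring

lemma continuousOn_cutQuadratic_rpow (αt p : ℝ) :
    ContinuousOn (fun x => cutQuadratic αt x ^ p) (Ioo (leftEdge αt) (rightEdge αt)) := by
  refine ContinuousOn.rpow_const ?_ fun x hx => Or.inl (cutQuadratic_pos hx).ne'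
  unfold cutQuadratic
  fun_prop

lemma intervalIntegrable_arcsine (hα : 0 < αt) {φ : ℝ → ℂ} (hφ : Continuous φ) :
    IntervalIntegrable (fun x => (((√((x - leftEdge αt) * (rightEdge αt - x)))⁻¹ : ℝ) : ℂ) * φ x)
      volume (leftEdge αt) (rightEdge αt) := by
  have hab := leftEdge_lt_rightEdge hα
  have ha := leftEdge_pos hα
  refine IntervalIntegrable.mul_continuousOn ?_ hφ.continuousOn
  rw [intervalIntegrable_iff_integrableOn_Icc_of_le hab.le]
  refine Integrable.ofReal (𝕜 := ℂ) (f := fun x => (√((x - leftEdge αt) * (rightEdge αt - x)))⁻¹) ?_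
  have hsub : Icc (leftEdge αt) (rightEdge αt) ⊆ Icc (-rightEdge αt) (rightEdge αt) :=
    Icc_subset_Icc (by linarith) le_rfl
  have h1 := ((integrableOn_inv_sqrt_abs_sub (leftEdge αt) (rightEdge αt)).add
    (integrableOn_inv_sqrt_abs_sub (rightEdge αt) (rightEdge αt))).mono_set hsub
  refine Integrable.mono' (Integrable.const_mul h1 (√((rightEdge αt - leftEdge αt) / 2))⁻¹)
    (Measurable.aestronglyMeasurable (by fun_prop)) ?_
  filter_upwards [ae_restrict_mem measurableSet_Icc] with x hx
  have h2 := inv_sqrt_mul_sqrt_le hab x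
  rw [Real.norm_of_nonneg (by positivity), Real.sqrt_mul (sub_nonneg.2 hx.1)]
  simp only [Pi.add_apply]
  rw [abs_of_nonneg (sub_nonneg.2 hx.1), abs_sub_comm x (rightEdge αt),
    abs_of_nonneg (sub_nonneg.2 hx.2)] at h2 ⊢
  exact h2

lemma finitePart_arcsine (hα : 0 < αt) {φ : ℝ → ℂ} (hφ : Continuous φ) :
    HasFinitePartAtZero (fun ε => ∫ x in (leftEdge αt + ε)..(rightEdge αt - ε),
      ((cutQuadratic αt x ^ (-(1 / 2) : ℝ) : ℝ) : ℂ) * φ x) (arcsineIntegral αt φ) := by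
  refine (HasFinitePartAtZero.integral (leftEdge_lt_rightEdge hα)
    (intervalIntegrable_arcsine hα hφ)).congr ?_
  have hL := sub_pos.2 (leftEdge_lt_rightEdge hα)
  filter_upwards [Ioo_mem_nhdsGT (half_pos hL)] with ε hε
  refine intervalIntegral.integral_congr fun x hx => ?_
  rw [uIcc_of_le (by linarith [hε.2])] at hx
  have hx' : x ∈ Ioo (leftEdge αt) (rightEdge αt) :=
    ⟨by linarith [hx.1, hε.1], by linarith [hx.2, hε.1]⟩
  rw [Real.rpow_neg (cutQuadratic_pos hx').le, ← Real.sqrt_eq_rpow, cutQuadratic]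

lemma arcsineIntegral_add (hα : 0 < αt) {φ ψ : ℝ → ℂ} (hφ : Continuous φ) (hψ : Continuous ψ) :
    arcsineIntegral αt (fun x => φ x + ψ x) = arcsineIntegral αt φ + arcsineIntegral αt ψ := by
  simp_rw [arcsineIntegral, mul_add]
  exact intervalIntegral.integral_add (intervalIntegrable_arcsine hα hφ)
    (intervalIntegrable_arcsine hα hψ)

lemma finitePart_three (hα : 0 < αt) {φ : ℝ → ℂ} (hφ : ContDiff ℝ ∞ φ) :
    HasFinitePartAtZero (fun ε => ∫ x in (leftEdge αt + ε)..(rightEdge αt - ε),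
      ((cutQuadratic αt x ^ (-(3 / 2) : ℝ) : ℝ) : ℂ) * φ x) (finitePartThree αt φ) := by
  have hq := add_one_ne_zero_of_pos hα
  have hφ' : Continuous (deriv φ) := hφ.continuous_deriv (by simp)
  have h1 := finitePart_arcsine hα (φ := fun x => (x - (αt + 2)) * deriv φ x) (by fun_prop)
  -- The derivative of `(x - c) r ^ (-1/2)`, with `c = αt + 2` and `r` the quadratic, is
  -- `4 (αt + 1) r ^ (-3/2)`.
  have h2 := finitePart_integral_by_parts hα hφ
    (fun x hx => hasDerivAt_sub_mul_cutQuadratic_rpow hα hx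
      (by norm_num : (-(1 / 2) : ℝ) = -(3 / 2) + 1))
    ((continuousOn_const.mul (continuousOn_cutQuadratic_rpow αt _)).sub
      (continuousOn_const.mul (continuousOn_cutQuadratic_rpow αt _)))
    (g := fun x => x - (αt + 2)) (by fun_prop) (p := 1 / 2) (n := 0) (by norm_num)
    (fun x _ => rfl) (v := arcsineIntegral αt fun x => (x - (αt + 2)) * deriv φ x)
    (h1.congr (.of_forall fun ε => intervalIntegral.integral_congr fun x _ => by
      push_cast
      ring))
  have h3 := h2.const_mul (1 / (4 * (αt + 1)))
  rw [finitePartThree, neg_mul, ← mul_neg]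
  refine h3.congr (.of_forall fun ε => ?_)
  simp only
  rw [← intervalIntegral.integral_const_mul]
  refine intervalIntegral.integral_congr fun x _ => ?_
  push_cast
  field_simp
  ring

lemma finitePartThree_sub_mul_deriv (hα : 0 < αt) {φ : ℝ → ℂ} (hφ : ContDiff ℝ ∞ φ) :
    finitePartThree αt (fun x => (x - (αt + 2)) * deriv φ x) = -(1 / (4 * (αt + 1))) *
      (arcsineIntegral αt (fun x => (x - (αt + 2)) * deriv φ x) +
        arcsineIntegral αt (fun x => (x - (αt + 2)) ^ 2 * deriv (deriv φ) x)) := by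
  have h1 : ContDiff ℝ ∞ (deriv φ) := ContDiff.iterate_deriv 1 hφ
  have hφ' : Continuous (deriv φ) := h1.continuous
  have hφ'' : Continuous (deriv (deriv φ)) := h1.continuous_deriv (by simp)
  rw [finitePartThree, ← arcsineIntegral_add hα (by fun_prop) (by fun_prop)]
  congr 2
  funext x
  have h2 : HasDerivAt (fun x : ℝ => ((x : ℂ) - (αt + 2)) * deriv φ x)
      (1 * deriv φ x + (x - (αt + 2)) * deriv (deriv φ) x) x :=
    (((hasDerivAt_id x).ofReal_comp).sub_const _).mul
      (h1.differentiable (by simp) x).hasDerivAt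
  rw [h2.deriv]
  ring

lemma finitePart_five (hα : 0 < αt) {φ : ℝ → ℂ} (hφ : ContDiff ℝ ∞ φ) :
    HasFinitePartAtZero (fun ε => ∫ x in (leftEdge αt + ε)..(rightEdge αt - ε),
      ((x * cutQuadratic αt x ^ (-(5 / 2) : ℝ) : ℝ) : ℂ) * φ x) (finitePartFive αt φ) := by
  have hq := add_one_ne_zero_of_pos hα
  have h1 : ContDiff ℝ ∞ (deriv φ) := ContDiff.iterate_deriv 1 hφ
  -- The derivatives of `r ^ (-3/2)` and `(x - c) r ^ (-3/2)` are `3 (x - c) r ^ (-5/2)` and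
  -- `-2 r ^ (-3/2) + 12 (αt + 1) r ^ (-5/2)`; together they produce `x r ^ (-5/2)`.
  have h2 := finitePart_integral_by_parts hα hφ
    (fun x hx => hasDerivAt_cutQuadratic_rpow hα hx
      (by norm_num : (-(3 / 2) : ℝ) = -(5 / 2) + 1))
    (continuousOn_const.mul (ContinuousOn.mul (by fun_prop)
      (continuousOn_cutQuadratic_rpow αt _)))
    (g := fun _ => 1) (by fun_prop) (p := 3 / 2) (n := 1) (by norm_num)
    (fun x _ => (one_mul _).symm) (finitePart_three hα h1)
  have h3 := finitePart_integral_by_parts hα hφ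
    (fun x hx => hasDerivAt_sub_mul_cutQuadratic_rpow hα hx
      (by norm_num : (-(3 / 2) : ℝ) = -(5 / 2) + 1))
    ((continuousOn_const.mul (continuousOn_cutQuadratic_rpow αt _)).sub
      (continuousOn_const.mul (continuousOn_cutQuadratic_rpow αt _)))
    (g := fun x => x - (αt + 2)) (by fun_prop) (p := 3 / 2) (n := 1) (by norm_num)
    (fun x _ => rfl) (v := finitePartThree αt fun x => (x - (αt + 2)) * deriv φ x)
    ((finitePart_three hα (φ := fun x => (x - (αt + 2)) * deriv φ x)
      (ContDiff.mul (Complex.ofRealCLM.contDiff.sub contDiff_const) h1)).congr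
        (.of_forall fun ε => intervalIntegral.integral_congr fun x _ => by
          push_cast
          ring))
  have key := (h2.const_mul (1 / 3)).add ((h3.add ((finitePart_three hα hφ).const_mul 2)).const_mul
    ((αt + 2) / (12 * (αt + 1))))
  have hval : 1 / 3 * -finitePartThree αt (deriv φ) + (αt + 2) / (12 * (αt + 1)) *
      (-finitePartThree αt (fun x => (x - (αt + 2)) * deriv φ x) + 2 * finitePartThree αt φ) =
      finitePartFive αt φ := by
    rw [finitePartThree_sub_mul_deriv hα hφ, finitePartFive, finitePartThree, finitePartThree]
    field_simp
    ring
  rw [hval] at key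
  refine key.congr ?_
  have hL := sub_pos.2 (leftEdge_lt_rightEdge hα)
  filter_upwards [Ioo_mem_nhdsGT (half_pos hL)] with ε hε
  have hle : leftEdge αt + ε ≤ rightEdge αt - ε := by linarith [hε.2]
  have hsub : uIcc (leftEdge αt + ε) (rightEdge αt - ε) ⊆ Ioo (leftEdge αt) (rightEdge αt) := by
    rw [uIcc_of_le hle]
    exact fun x hx => ⟨by linarith [hx.1, hε.1], by linarith [hx.2, hε.1]⟩
  have hint : ∀ {G : ℝ → ℝ}, ContinuousOn G (Ioo (leftEdge αt) (rightEdge αt)) →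
      IntervalIntegrable (fun x => (G x : ℂ) * φ x) volume
        (leftEdge αt + ε) (rightEdge αt - ε) := fun hG =>
    (((Complex.continuous_ofReal.comp_continuousOn hG).mono hsub).mul
      hφ.continuous.continuousOn).intervalIntegrable
  rw [← intervalIntegral.integral_const_mul, ← intervalIntegral.integral_const_mul 2,
    ← intervalIntegral.integral_add, ← intervalIntegral.integral_const_mul,
    ← intervalIntegral.integral_add]
  · refine intervalIntegral.integral_congr fun x _ => ?_
    push_cast
    field_simp
    ring
  · refine (hint ?_).const_mul _
    exact continuousOn_const.mul (ContinuousOn.mul (by fun_prop)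
      (continuousOn_cutQuadratic_rpow αt _))
  · refine ((hint ?_).add ((hint ?_).const_mul _)).const_mul _
    · exact (continuousOn_const.mul (continuousOn_cutQuadratic_rpow αt _)).sub
        (continuousOn_const.mul (continuousOn_cutQuadratic_rpow αt _))
    · exact continuousOn_cutQuadratic_rpow αt _
  · refine hint ?_
    exact (continuousOn_const.mul (continuousOn_cutQuadratic_rpow αt _)).sub
      (continuousOn_const.mul (continuousOn_cutQuadratic_rpow αt _))
  · refine (hint ?_).const_mul _
    exact continuousOn_cutQuadratic_rpow αt _

end cut

end

/-! ### Uniqueness of the expansion -/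

section

open scoped ContDiff

/-- The coefficients of an expansion in powers of `1 / N` to second order are determined. -/
lemma eq_zero_of_isLittleO_sq {k : ℝ} (hk : 0 < k) {d : ℕ → ℂ}
    (h : (fun N : ℕ => ∑ l ∈ Finset.range 3, d l / ((N * k : ℝ) : ℂ) ^ l)
      =o[atTop] fun N : ℕ => (1 / (N : ℝ)) ^ 2) : ∀ l ≤ 2, d l = 0 := by
  have hk' : (k : ℂ) ≠ 0 := by exact_mod_cast hk.ne'
  have hz : Tendsto (fun N : ℕ => (1 / (N : ℂ))) atTop (𝓝 0) :=
    tendsto_one_div_atTop_nhds_zero_nat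
  have h2 : Tendsto (fun N : ℕ => (N : ℂ) ^ 2 * d 0 + N * (d 1 / k) + d 2 / k ^ 2) atTop (𝓝 0) := by
    have h3 := h.tendsto_inv_smul_nhds_zero
    refine h3.congr' ?_
    filter_upwards [eventually_gt_atTop 0] with N hN
    have hN' : (N : ℂ) ≠ 0 := by exact_mod_cast hN.ne'
    simp only [Finset.sum_range_succ, Finset.sum_range_zero, Complex.real_smul]
    push_cast
    field_simp
    ring
  have h0 : d 0 = 0 := by
    have h3 := (h2.mul (hz.pow 2)).sub ((hz.mul_const (d 1 / k)).add
      ((hz.pow 2).mul_const (d 2 / k ^ 2)))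
    have h4 : Tendsto (fun _ : ℕ => d 0) atTop (𝓝 0) := by
      convert! h3.congr' (f₂ := fun _ : ℕ => d 0) ?_ using 2
      · simp
      · filter_upwards [eventually_gt_atTop 0] with N hN
        have hN' : (N : ℂ) ≠ 0 := by exact_mod_cast hN.ne'
        field_simp
        ring
    exact tendsto_nhds_unique tendsto_const_nhds h4
  have h1 : d 1 = 0 := by
    have h3 := (h2.mul hz).sub (hz.mul_const (d 2 / k ^ 2))
    have h4 : Tendsto (fun _ : ℕ => d 1 / k) atTop (𝓝 0) := by
      convert! h3.congr' (f₂ := fun _ : ℕ => d 1 / k) ?_ using 2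
      · simp
      · filter_upwards [eventually_gt_atTop 0] with N hN
        have hN' : (N : ℂ) ≠ 0 := by exact_mod_cast hN.ne'
        rw [h0]
        field_simp
        ring
    simpa [hk'] using tendsto_nhds_unique tendsto_const_nhds h4
  have h5 : d 2 = 0 := by
    simp only [h0, h1, mul_zero, zero_div, zero_add] at h2
    simpa [hk'] using tendsto_nhds_unique tendsto_const_nhds h2
  intro l hl
  interval_cases l
  exacts [h0, h1, h5]

/-- Analytic functions off the line that agree near infinity agree. -/
lemma eq_of_eq_near_infinity {F G : ℂ → ℂ} (hF : DifferentiableOn ℂ F {s | s.im ≠ 0})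
    (hG : DifferentiableOn ℂ G {s | s.im ≠ 0}) {R : ℝ}
    (h : ∀ s : ℂ, s.im ≠ 0 → R < ‖s‖ → F s = G s) {s : ℂ} (hs : s.im ≠ 0) : F s = G s := by
  -- The complement of the line is disconnected, so the identity theorem is applied in each half
  -- plane separately.
  have key : ∀ U : Set ℂ, IsOpen U → Convex ℝ U → U ⊆ {s | s.im ≠ 0} →
      (∃ z ∈ U, R < ‖z‖) → s ∈ U → F s = G s := by
    intro U hU hconv hsub hz hsU
    obtain ⟨z, hzU, hzR⟩ := hz
    refine AnalyticOnNhd.eqOn_of_preconnected_of_eventuallyEq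
      ((hF.mono hsub).analyticOnNhd hU) ((hG.mono hsub).analyticOnNhd hU)
      hconv.isPreconnected hzU ?_ hsU
    filter_upwards [hU.mem_nhds hzU, (isOpen_lt continuous_const continuous_norm).mem_nhds hzR]
      with w hw hw'
    exact h w (hsub hw) hw'
  have hR : R < |R| + 1 := (le_abs_self R).trans_lt (lt_add_one _)
  have hpos : 0 < |R| + 1 := by positivity
  have hnorm : ‖(((|R| + 1 : ℝ) : ℂ) * Complex.I)‖ = |R| + 1 := by
    rw [norm_mul, Complex.norm_I, mul_one, Complex.norm_real, Real.norm_of_nonneg hpos.le]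
  rcases lt_or_gt_of_ne hs with h1 | h1
  · refine key {s | s.im < 0} (isOpen_lt Complex.continuous_im continuous_const)
      (convex_halfSpace_im_lt 0) (fun z hz => ne_of_lt hz)
      ⟨-(((|R| + 1 : ℝ) : ℂ) * Complex.I), ?_, by rwa [norm_neg, hnorm]⟩ h1
    simpa only [mem_ofPred_eq, Complex.neg_im, Complex.re_ofReal_mul, Complex.im_ofReal_mul,
      Complex.I_im, mul_one, neg_lt_zero] using hpos
  · refine key {s | 0 < s.im} (isOpen_lt continuous_const Complex.continuous_im)
      (convex_halfSpace_im_gt 0) (fun z hz => ne_of_gt hz)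
      ⟨((|R| + 1 : ℝ) : ℂ) * Complex.I, ?_, by rwa [hnorm]⟩ h1
    simpa only [mem_ofPred_eq, Complex.im_ofReal_mul, Complex.I_im, mul_one] using hpos

theorem IsResolventExpansion.eq_of_im_ne_zero {β αt : ℝ} (hβ : 0 < β) {V W : ℕ → ℂ → ℂ}
    (hV : IsResolventExpansion β αt 2 V) (hW : IsResolventExpansion β αt 2 W) {l : ℕ} (hl : l ≤ 2)
    {s : ℂ} (hs : s.im ≠ 0) : W l s = V l s := by
  have hsub : {s : ℂ | s.im ≠ 0} ⊆ (cut αt)ᶜ := fun s hs => notMem_cut_of_im_ne_zero αt hs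
  obtain ⟨R, hR⟩ := hV.expansion
  obtain ⟨R', hR'⟩ := hW.expansion
  refine eq_of_eq_near_infinity ((hW.analytic l hl).mono hsub) ((hV.analytic l hl).mono hsub)
    (R := max R R') (fun z hz hzR => ?_) hs
  have h1 := (hR z hz ((le_max_left _ _).trans_lt hzR)).sub
    (hR' z hz ((le_max_right _ _).trans_lt hzR))
  have h2 := eq_zero_of_isLittleO_sq (k := √(β / 2)) (Real.sqrt_pos.2 (half_pos hβ))
    (d := fun l => W l z - V l z) (h1.congr_left fun N => by
      rw [sub_sub_sub_cancel_left, ← Finset.sum_sub_distrib]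
      exact Finset.sum_congr rfl fun l _ => (sub_div _ _ _).symm) l hl
  exact sub_eq_zero.1 h2

lemma isTest_testFunction (φ : 𝓓((⊤ : TopologicalSpace.Opens ℝ), ℂ)) : IsTest φ :=
  ⟨φ.contDiff, φ.hasCompactSupport⟩

lemma HasJump.hasInverseStieltjes {F : ℂ → ℂ} {T : (ℝ → ℂ) → ℂ} (hF : HasJump F T)
    (φ : 𝓓((⊤ : TopologicalSpace.Opens ℝ), ℂ)) {v : ℂ}
    (hv : T φ = 2 * Real.pi * Complex.I * v) : HasInverseStieltjes F φ v := by
  have hpi : (2 * Real.pi * Complex.I : ℂ) ≠ 0 := by simp [Real.pi_ne_zero]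
  have h := (hF.2 φ (isTest_testFunction φ)).const_mul (1 / (2 * Real.pi * Complex.I))
  rwa [hv, one_div, inv_mul_cancel_left₀ hpi, ← one_div] at h

end

end

end LaguerreEnsemble

theorem proposition3p9 (β κ αt h a b : ℝ) (hβ : 0 < β) (hκ : κ = β / 2) (hα : 0 < αt)
    (hh : h = √κ - 1 / √κ) (ha : a = leftEdge αt) (hb : b = rightEdge αt) :
    (∃ W : ℕ → ℂ → ℂ, IsResolventExpansion β αt 2 W) ∧
    ∀ W : ℕ → ℂ → ℂ, IsResolventExpansion β αt 2 W →
      ∀ φ : 𝓓((⊤ : TopologicalSpace.Opens ℝ), ℂ),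
        HasInverseStieltjes (W 0) φ
          (∫ x in a..b, ((1 / (2 * Real.pi * x) * √((x - a) * (b - x)) : ℝ) : ℂ) * φ x) ∧
        HasInverseStieltjes (W 1) φ
          ((h / 2 : ℂ) *
              ((∫ x in a..b,
                  ((αt / (Real.pi * x) * ((x - a) * (b - x)) ^ (-(1 / 2) : ℝ) : ℝ) : ℂ) * φ x) -
                (((αt + 2) / (4 * √(αt + 1)) : ℝ) : ℂ) * (delta b φ - delta a φ)) +
            (h / 2 : ℂ) * (((αt ^ 2 / (4 * √(αt + 1)) : ℝ) : ℂ) *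
                ((1 / b : ℂ) * delta b φ - (1 / a : ℂ) * delta a φ))) ∧
        ∃ I₅ I₃ : ℂ,
          HasFinitePart
            (fun x => ((x * ((x - a) * (b - x)) ^ (-(5 / 2) : ℝ) : ℝ) : ℂ) * φ x) a b I₅ ∧
          HasFinitePart
            (fun x => ((((x - a) * (b - x)) ^ (-(3 / 2) : ℝ) : ℝ) : ℂ) * φ x) a b I₃ ∧
          HasInverseStieltjes (W 2) φ
            (((αt + 1) / Real.pi : ℂ) * I₅ +
              (h ^ 2 / Real.pi : ℂ) * (5 * (αt + 1) * I₅ - (αt + 2) * I₃) -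
              (h ^ 2 * αt / (16 * (αt + 1)) : ℂ) *
                (deltaDeriv b (fun x => ((αt + 2 - x : ℝ) : ℂ) * φ x) +
                  deltaDeriv a (fun x => ((αt + 2 - x : ℝ) : ℂ) * φ x) +
                  ((1 / (2 * √(αt + 1)) : ℝ) : ℂ) *
                    (delta b (fun x => ((αt + 2 - x : ℝ) : ℂ) * φ x) -
                      delta a (fun x => ((αt + 2 - x : ℝ) : ℂ) * φ x)))) := by
  subst hκ ha hb
  have hV := isResolventExpansion_resolventCoeff hβ hα hh
  refine ⟨⟨_, hV⟩, fun W hW φ => ?_⟩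
  have hσ0 : 0 < √(αt + 1) := Real.sqrt_pos.2 (by linarith)
  have hσ : (√(αt + 1) : ℂ) ≠ 0 := by exact_mod_cast hσ0.ne'
  have hσ2 : (√(αt + 1) : ℂ) ^ 2 = αt + 1 := by
    exact_mod_cast Real.sq_sqrt (by linarith : 0 ≤ αt + 1)
  have hq := add_one_ne_zero_of_pos hα
  have hpi : (Real.pi : ℂ) ≠ 0 := by exact_mod_cast Real.pi_ne_zero
  have ha : (leftEdge αt : ℂ) = αt + 2 - 2 * √(αt + 1) := by
    rw [leftEdge]
    push_cast
    linear_combination hσ2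
  have hb : (rightEdge αt : ℂ) = αt + 2 + 2 * √(αt + 1) := by
    rw [rightEdge]
    push_cast
    linear_combination hσ2
  have ha0 : (leftEdge αt : ℂ) ≠ 0 := by exact_mod_cast (leftEdge_pos hα).ne'
  have hb0 : (rightEdge αt : ℂ) ≠ 0 := by
    exact_mod_cast ((leftEdge_pos hα).trans (leftEdge_lt_rightEdge hα)).ne'
  have hab : (leftEdge αt : ℂ) * rightEdge αt = αt ^ 2 := by
    exact_mod_cast leftEdge_mul_rightEdge hα
  refine ⟨?_, ?_, finitePartFive αt φ, finitePartThree αt φ,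
    finitePart_five hα (isTest_testFunction φ).contDiff,
    finitePart_three hα (isTest_testFunction φ).contDiff, ?_⟩
  · refine ((hasJump_resolventZero hα).congr fun s hs =>
      hV.eq_of_im_ne_zero hβ hW (Nat.zero_le 2) hs).hasInverseStieltjes φ ?_
    rw [← intervalIntegral.integral_const_mul]
    refine intervalIntegral.integral_congr fun x _ => ?_
    push_cast
    field_simp
  · refine ((hasJump_resolventOne h hα).congr fun s hs =>
      hV.eq_of_im_ne_zero hβ hW one_le_two hs).hasInverseStieltjes φ ?_
    have h1 : ∫ x in leftEdge αt..rightEdge αt, (2 * Complex.I * (αt / (x *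
          √((x - leftEdge αt) * (rightEdge αt - x))))) * φ x =
        2 * Real.pi * Complex.I * ∫ x in leftEdge αt..rightEdge αt,
          ((αt / (Real.pi * x) * ((x - leftEdge αt) * (rightEdge αt - x)) ^ (-(1 / 2) : ℝ) : ℝ) : ℂ)
            * φ x := by
      rw [← intervalIntegral.integral_const_mul]
      refine intervalIntegral.integral_congr fun x hx => ?_
      rw [uIcc_of_le (leftEdge_lt_rightEdge hα).le] at hx
      rw [Real.rpow_neg (mul_nonneg (sub_nonneg.2 hx.1) (sub_nonneg.2 hx.2)), ← Real.sqrt_eq_rpow]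
      push_cast
      field_simp
    rw [h1, delta, delta]
    -- The two contributions at each endpoint combine to `-1/2`, as `αt ^ 2 = a * b`.
    have e1 : (αt ^ 2 : ℂ) * (1 / rightEdge αt) = leftEdge αt := by
      rw [← hab]
      field_simp
    have e2 : (αt ^ 2 : ℂ) * (1 / leftEdge αt) = rightEdge αt := by
      rw [← hab]
      field_simp
    have e3 : (αt ^ 2 / (4 * √(αt + 1)) : ℂ) *
        (1 / rightEdge αt * φ (rightEdge αt) - 1 / leftEdge αt * φ (leftEdge αt)) =
        1 / (4 * √(αt + 1)) *
          (leftEdge αt * φ (rightEdge αt) - rightEdge αt * φ (leftEdge αt)) := by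
      linear_combination 1 / (4 * √(αt + 1) : ℂ) *
        (φ (rightEdge αt) * e1 - φ (leftEdge αt) * e2)
    push_cast
    rw [e3, ha, hb]
    field_simp
    ring
  · refine ((hasJump_resolventTwo h hα).congr fun s hs =>
      hV.eq_of_im_ne_zero hβ hW le_rfl hs).hasInverseStieltjes φ ?_
    have hd : ∀ c : ℝ, deriv (fun x : ℝ => ((αt + 2 - x : ℝ) : ℂ) * φ x) c =
        -φ c + (αt + 2 - c) * deriv φ c := fun c => by
      have h1 : HasDerivAt (fun x : ℝ => ((αt + 2 - x : ℝ) : ℂ)) ((-1 : ℝ) : ℂ) c :=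
        ((hasDerivAt_id c).const_sub (αt + 2)).ofReal_comp
      have h2 : HasDerivAt (fun x : ℝ => ((αt + 2 - x : ℝ) : ℂ) * φ x) _ c :=
        h1.mul ((isTest_testFunction φ).hasDerivAt c)
      rw [h2.deriv]
      push_cast
      ring
    simp only [deltaDeriv, delta]
    rw [hd, hd]
    push_cast
    rw [ha, hb, ← hσ2]
    field_simp
    ring
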